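/- For matrices $A\in\mathbb R^{I\times R}$, $B\in\mathbb R^{J\times R}$, $C\in\mathbb R^{K\times R}$ with columns $a_r,b_r,c_r$, let $[A,B,C]_R=\sum_{r=1}^R a_r\circ b_r\circ c_r\in\mathbb R^{I\times J\times K}$, i.e. the tensor with entries $\sum_{r=1}^R a_{ir}b_{jr}c_{kr}$. The rank $r_{\mathcal T}$ of a tensor $\mathcal T$ is the least $R$ for which $\mathcal T=[A,B,C]_R$ for some $A,B,C$; such a decomposition with $R=r_{\mathcal T}$ is called a canonical polyadic decomposition (CPD) of $\mathcal T$. The CPD of $\mathcal T$ is unique if any two CPDs $[A,B,C]_R$, $[A',B',C']_R$ of $\mathcal T$ coincide up to a permutation $\sigma$ of the terms and a scaling within each term: $a'_r=\alpha_r a_{\sigma(r)}$, $b'_r=\beta_r b_{\sigma(r)}$, $c'_r=\gamma_r c_{\sigma(r)}$ with $\alpha_r\beta_r\gamma_r=1$ for all $r$. The $k$-rank $k_A$ of $A$ is the largest $k\le R$ such that every $k$ columns of $A$ are linearly independent. An algebraic algorithm is a finite program, the same for all sizes $I,J,K,R$, that works with natural numbers, real numbers and real matrices. Its only constants are natural numbers.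 Its operations are: addition, truncated subtraction, multiplication, integer division and remainder of natural numbers; conversion of natural numbers to reals; field operations on real numbers; reading the size and the entries of a matrix, building a matrix entry by entry, transposition, multiplication and inversion of matrices; compound matrices (the matrices of all $k\times k$ minors); a basis of the orthogonal complement of the column space of a matrix; and the generalized eigenvalue decomposition (GEVD) of a square pencil $(M,N)$, i.e. an invertible real $X$ and a real diagonal $D$ with $MX=NXD$, where $N$ is nonsingular (nothing is assumed about the answer when no such decomposition exists). These are combined by composition, branching on whether a real number is zero, and loops whose number of rounds is fixed on entry. **Theorem.** 1. Let $\mathcal T=[A,B,C]_R$ with $A\in\mathbb R^{I\times R}$, $B\in\mathbb R^{J\times R}$, $C\in\mathbb R^{K\times R}$, and suppose that Kruskal's condition $k_A+k_B+k_C\ge 2R+2$ holds. Then $r_{\mathcal T}=R$ (so $[A,B,C]_R$ is a CPD of $\mathcal T$) and the CPD of $\mathcal T$ is unique. 2. The CPD can be found algebraically: there is an algebraic algorithm that, for all $I,J,K,R$ and every $\mathcal T\in\mathbb R^{I\times J\times K}$ that can be written as $[A,B,C]_R$ with $k_A+k_B+k_C\ge 2R+2$, computes from $I$, $J$, $R$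 and the $IJ\times K$ matrix unfolding of $\mathcal T$ (whose rows are indexed by the pairs $(i,j)$ in lexicographic order) three matrices $A',B',C'$ such that $\mathcal T=[A',B',C']_R$ is a CPD of $\mathcal T$, whichever bases of orthogonal complements and whichever GEVDs its subroutines return. -/

import Mathlib

namespace CPD

open Matrix

/-! ### Third-order tensors, polyadic decompositions, k-rank -/

/-- A real `I × J × K` tensor. -/
abbrev Tensor (I J K : ℕ) : Type := Fin I → Fin J → Fin K → ℝ

/-- `[A, B, C]_R`, the sum over `r` of the outer products of the `r`-th columns of
`A`, `B` and `C`. -/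
def ofFactors {I J K R : ℕ} (A : Matrix (Fin I) (Fin R) ℝ) (B : Matrix (Fin J) (Fin R) ℝ)
    (C : Matrix (Fin K) (Fin R) ℝ) : Tensor I J K :=
  fun i j k => ∑ r, A i r * B j r * C k r

/-- The rank of a tensor: the least number of terms in a polyadic decomposition. -/
noncomputable def tensorRank {I J K : ℕ} (T : Tensor I J K) : ℕ :=
  sInf {R : ℕ | ∃ (A : Matrix (Fin I) (Fin R) ℝ) (B : Matrix (Fin J) (Fin R) ℝ)
    (C : Matrix (Fin K) (Fin R) ℝ), T = ofFactors A B C}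

/-- `T = [A, B, C]_R` is a canonical polyadic decomposition: the number `R` of terms is
minimal. (Minimality forces all columns to be nonzero.) -/
def IsCPD {I J K R : ℕ} (T : Tensor I J K) (A : Matrix (Fin I) (Fin R) ℝ)
    (B : Matrix (Fin J) (Fin R) ℝ) (C : Matrix (Fin K) (Fin R) ℝ) : Prop :=
  T = ofFactors A B C ∧ tensorRank T = R

/-- The CPD of `T` is unique: any two CPDs of `T` differ only by a permutation of the rank-one
terms and by scalings of the vectors within each term that leave the term unchanged. -/
def CPDUnique {I J K : ℕ} (T : Tensor I J K) : Prop :=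
  ∀ (R : ℕ) (A A' : Matrix (Fin I) (Fin R) ℝ) (B B' : Matrix (Fin J) (Fin R) ℝ)
    (C C' : Matrix (Fin K) (Fin R) ℝ), IsCPD T A B C → IsCPD T A' B' C' →
    ∃ (σ : Equiv.Perm (Fin R)) (a b c : Fin R → ℝ), ∀ r, a r * b r * c r = 1 ∧
      (∀ i, A' i r = a r * A i (σ r)) ∧ (∀ j, B' j r = b r * B j (σ r)) ∧
      (∀ k, C' k r = c r * C k (σ r))

/-- The k-rank: the largest `k` such that every set of `k` columns is linearly independent. -/
noncomputable def kRank {I R : ℕ} (A : Matrix (Fin I) (Fin R) ℝ) : ℕ :=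
  sSup {k : ℕ | k ≤ R ∧ ∀ s : Finset (Fin R), s.card = k →
    LinearIndependent ℝ (fun j : s => A.col (j : Fin R))}

/-! ### Matrices of arbitrary size, and the matrix operations used by algorithms -/

/-- A real matrix together with its size. -/
structure Mat where
  rows : ℕ
  cols : ℕ
  val : Matrix (Fin rows) (Fin cols) ℝ

namespace Mat

/-- The empty matrix, returned by operations whose arguments have inadmissible sizes. -/
def empty : Mat := ⟨0, 0, 0⟩

/-- The entry with (zero-based) position `(i, j)`; zero outside the matrix. -/
def entry (M : Mat) (i j : ℕ) : ℝ :=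
  if h : i < M.rows ∧ j < M.cols then M.val ⟨i, h.1⟩ ⟨j, h.2⟩ else 0

/-- The `m × n` matrix with prescribed entries. -/
def build (m n : ℕ) (f : ℕ → ℕ → ℝ) : Mat := ⟨m, n, fun i j => f i j⟩

def transpose (M : Mat) : Mat := ⟨M.cols, M.rows, M.valᵀ⟩

/-- The matrix product. -/
def mul (M N : Mat) : Mat :=
  if h : N.rows = M.cols then ⟨M.rows, N.cols, M.val * N.val.submatrix (Fin.cast h.symm) id⟩
  else empty

/-- The inverse of a nonsingular square matrix (the zero matrix for singular ones). -/
noncomputable def inv (M : Mat) : Mat :=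
  if h : M.rows = M.cols then ⟨M.rows, M.rows, (M.val.submatrix id (Fin.cast h))⁻¹⟩ else empty

/-- The `k`-element subsets of `{0, …, n - 1}`, each as an increasing list, in lexicographic
order. -/
def subsets (n k : ℕ) : List (List ℕ) := ((List.range n).sublistsLen k).reverse

/-- The `k`-th compound matrix: all `k × k` minors, with row and column index sets in
lexicographic order. -/
noncomputable def compound (M : Mat) (k : ℕ) : Mat :=
  build (subsets M.rows k).length (subsets M.cols k).length fun p q =>
    Matrix.det (Matrix.of fun a b : Fin k =>
      M.entry (((subsets M.rows k).getD p []).getD a 0) (((subsets M.cols k).getD q []).getD b 0))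

end Mat

/-- The columns of `N` form a basis of the orthogonal complement of the column space of `M`. -/
def IsOrthBasis {m n d : ℕ} (M : Matrix (Fin m) (Fin n) ℝ) (N : Matrix (Fin m) (Fin d) ℝ) :
    Prop :=
  LinearIndependent ℝ N.col ∧ Submodule.span ℝ (Set.range N.col) = LinearMap.ker Mᵀ.mulVecLin

/-- A (real) generalized eigenvalue decomposition of the pencil `(M, N)`, with `N` nonsingular:
a basis of generalized eigenvectors, the columns of `X`, with their eigenvalues `d`. -/
def IsGEVD {n : ℕ} (M N X : Matrix (Fin n) (Fin n) ℝ) (d : Fin n → ℝ) : Prop :=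
  IsUnit N ∧ IsUnit X ∧ M * X = N * X * Matrix.diagonal d

/-- An implementation of the two matrix computations whose results are not uniquely determined.
Nothing is known about the `gevd` of a pencil that has no generalized eigenvalue decomposition. -/
structure Solver where
  orth : ∀ {m n : ℕ}, Matrix (Fin m) (Fin n) ℝ → (d : ℕ) × Matrix (Fin m) (Fin d) ℝ
  orth_spec : ∀ {m n : ℕ} (M : Matrix (Fin m) (Fin n) ℝ), IsOrthBasis M (orth M).2
  gevd : ∀ {n : ℕ}, Matrix (Fin n) (Fin n) ℝ → Matrix (Fin n) (Fin n) ℝ →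
    Matrix (Fin n) (Fin n) ℝ × (Fin n → ℝ)
  gevd_spec : ∀ {n : ℕ} (M N : Matrix (Fin n) (Fin n) ℝ), (∃ X d, IsGEVD M N X d) →
    IsGEVD M N (gevd M N).1 (gevd M N).2

theorem Solver.nonempty : Nonempty Solver := by
  classical
  have h1 : ∀ (m n : ℕ) (M : Matrix (Fin m) (Fin n) ℝ),
      ∃ N : (d : ℕ) × Matrix (Fin m) (Fin d) ℝ, IsOrthBasis M N.2 := by
    intro m n M
    let b := Module.finBasis ℝ (LinearMap.ker Mᵀ.mulVecLin)
    refine ⟨⟨_, Matrix.of fun i j => (b j : Fin m → ℝ) i⟩, ?_, ?_⟩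
    · exact b.linearIndependent.map' (Submodule.subtype _) (Submodule.ker_subtype _)
    · have h := congrArg (Submodule.map (Submodule.subtype _)) b.span_eq
      rw [Submodule.map_span, Submodule.map_top, Submodule.range_subtype, ← Set.range_comp] at h
      exact h
  have h2 : ∀ (n : ℕ) (M N : Matrix (Fin n) (Fin n) ℝ),
      ∃ Y : Matrix (Fin n) (Fin n) ℝ × (Fin n → ℝ), (∃ X d, IsGEVD M N X d) →
        IsGEVD M N Y.1 Y.2 := by
    intro n M N
    by_cases h : ∃ X d, IsGEVD M N X d
    · obtain ⟨X, d, hX⟩ := h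
      exact ⟨(X, d), fun _ => hX⟩
    · exact ⟨(0, 0), fun h' => absurd h' h⟩
  choose f hf using h1
  choose g hg using h2
  exact ⟨⟨fun {m n} M => f m n M, fun {m n} M => hf m n M, fun {n} M N => g n M N,
    fun {n} M N => hg n M N⟩⟩

namespace Solver

/-- A matrix whose columns form a basis of the orthogonal complement of the column space. -/
def orthMat (S : Solver) (M : Mat) : Mat := ⟨M.rows, (S.orth M.val).1, (S.orth M.val).2⟩

/-- The eigenvector matrix and the diagonal eigenvalue matrix of a pencil of two square matrices
of the same size. -/
def gevdMat (S : Solver) (M N : Mat) : Mat × Mat :=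
  if h : M.cols = M.rows ∧ N.rows = M.rows ∧ N.cols = M.rows then
    let Y := S.gevd (M.val.submatrix id (Fin.cast h.1.symm))
      (N.val.submatrix (Fin.cast h.2.1.symm) (Fin.cast h.2.2.symm))
    (⟨M.rows, M.rows, Y.1⟩, ⟨M.rows, M.rows, Matrix.diagonal Y.2⟩)
  else (Mat.empty, Mat.empty)

end Solver

/-! ### Algebraic algorithms -/

/-- The data types of an algebraic algorithm. -/
inductive Ty : Type
  | nat : Ty
  | scalar : Ty
  | mat : Ty
  | prod : Ty → Ty → Ty

/-- The values of a data type. -/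
@[reducible] def Ty.El : Ty → Type
  | .nat => ℕ
  | .scalar => ℝ
  | .mat => Mat
  | .prod a b => a.El × b.El

/-- Algebraic algorithms: finite programs built from arithmetic, elementary operations on
matrices, compound matrices, orthogonal complements and generalized eigenvalue decompositions,
by composition, branching on zero tests and loops whose number of rounds is known on entry.
The only constants are natural numbers. -/
inductive Prog : Ty → Ty → Type
  -- plumbing
  | id {a : Ty} : Prog a a
  | comp {a b c : Ty} (g : Prog b c) (f : Prog a b) : Prog a c
  | pair {a b c : Ty} (f : Prog a b) (g : Prog a c) : Prog a (.prod b c)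
  | fst {a b : Ty} : Prog (.prod a b) a
  | snd {a b : Ty} : Prog (.prod a b) b
  -- arithmetic of natural numbers (indices, sizes, counters)
  | natConst {a : Ty} (n : ℕ) : Prog a .nat
  | natAdd : Prog (.prod .nat .nat) .nat
  | natSub : Prog (.prod .nat .nat) .nat
  | natMul : Prog (.prod .nat .nat) .nat
  | natDiv : Prog (.prod .nat .nat) .nat
  | natMod : Prog (.prod .nat .nat) .nat
  -- arithmetic of real numbers
  | cast : Prog .nat .scalar
  | add : Prog (.prod .scalar .scalar) .scalar
  | neg : Prog .scalar .scalar
  | mul : Prog (.prod .scalar .scalar) .scalar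
  | inv : Prog .scalar .scalar
  -- elementary operations on matrices
  | rows : Prog .mat .nat
  | cols : Prog .mat .nat
  | entry : Prog (.prod .mat (.prod .nat .nat)) .scalar
  | build {a : Ty} (f : Prog (.prod a (.prod .nat .nat)) .scalar) :
      Prog (.prod a (.prod .nat .nat)) .mat
  | matTranspose : Prog .mat .mat
  | matMul : Prog (.prod .mat .mat) .mat
  | matInv : Prog .mat .mat
  -- the three further matrix computations
  | compound : Prog (.prod .mat .nat) .mat
  | orth : Prog .mat .mat
  | gevd : Prog (.prod .mat .mat) (.prod .mat .mat)
  -- control flow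
  | ifZero {a b : Ty} (t : Prog a .scalar) (f g : Prog a b) : Prog a b
  | iter {a : Ty} (f : Prog a a) : Prog (.prod .nat a) a

open Classical in
/-- The result of a program, for a given implementation of orthogonal complements and generalized
eigenvalue decompositions. In `build f` the input is `(x, (m, n))` and the result is the
`m × n` matrix with entries `f (x, (i, j))`; in `iter f` the input is `(n, x)` and `f` is
applied `n` times to `x`. -/
noncomputable def Prog.run (S : Solver) : {a b : Ty} → Prog a b → a.El → b.El
  | _, _, .id => fun x => x
  | _, _, .comp g f => fun x => g.run S (f.run S x)
  | _, _, .pair f g => fun x => (f.run S x, g.run S x)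
  | _, _, .fst => fun x => x.1
  | _, _, .snd => fun x => x.2
  | _, _, .natConst n => fun _ => n
  | _, _, .natAdd => fun (x : ℕ × ℕ) => (x.1 + x.2 : ℕ)
  | _, _, .natSub => fun (x : ℕ × ℕ) => (x.1 - x.2 : ℕ)
  | _, _, .natMul => fun (x : ℕ × ℕ) => (x.1 * x.2 : ℕ)
  | _, _, .natDiv => fun (x : ℕ × ℕ) => (x.1 / x.2 : ℕ)
  | _, _, .natMod => fun (x : ℕ × ℕ) => (x.1 % x.2 : ℕ)
  | _, _, .cast => fun (n : ℕ) => (n : ℝ)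
  | _, _, .add => fun (x : ℝ × ℝ) => (x.1 + x.2 : ℝ)
  | _, _, .neg => fun (x : ℝ) => (-x : ℝ)
  | _, _, .mul => fun (x : ℝ × ℝ) => (x.1 * x.2 : ℝ)
  | _, _, .inv => fun (x : ℝ) => (x⁻¹ : ℝ)
  | _, _, .rows => fun (M : Mat) => M.rows
  | _, _, .cols => fun (M : Mat) => M.cols
  | _, _, .entry => fun (x : Mat × ℕ × ℕ) => x.1.entry x.2.1 x.2.2
  | _, _, .build f => fun x =>
      Mat.build x.2.1 x.2.2 fun (i j : ℕ) => f.run S (x.1, ((i, j) : ℕ × ℕ))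
  | _, _, .matTranspose => fun (M : Mat) => M.transpose
  | _, _, .matMul => fun (x : Mat × Mat) => x.1.mul x.2
  | _, _, .matInv => fun (M : Mat) => M.inv
  | _, _, .compound => fun (x : Mat × ℕ) => x.1.compound x.2
  | _, _, .orth => fun (M : Mat) => S.orthMat M
  | _, _, .gevd => fun (x : Mat × Mat) => S.gevdMat x.1 x.2
  | _, _, .ifZero t f g => fun x => if t.run S x = (0 : ℝ) then f.run S x else g.run S x
  | _, _, .iter f => fun x => (f.run S)^[x.1] x.2

/-- The matrix unfolding of `T`, of size `IJ × K`: row `i * J + j` of column `k` is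
`T i j k`. -/
def unfolding {I J K : ℕ} (T : Tensor I J K) : Mat :=
  ⟨I * J, K, fun p k => T p.divNat p.modNat k⟩

/-- Input of a CPD algorithm: `((I, J), (R, unfolding of T))`. -/
abbrev InputTy : Ty := .prod (.prod .nat .nat) (.prod .nat .mat)

/-- Output of a CPD algorithm: three factor matrices. -/
abbrev OutputTy : Ty := .prod .mat (.prod .mat .mat)

def input {I J K : ℕ} (T : Tensor I J K) (R : ℕ) : InputTy.El := ((I, J), (R, unfolding T))

def output {I J K R : ℕ} (A : Matrix (Fin I) (Fin R) ℝ) (B : Matrix (Fin J) (Fin R) ℝ)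
    (C : Matrix (Fin K) (Fin R) ℝ) : OutputTy.El := (⟨I, R, A⟩, ⟨J, R, B⟩, ⟨K, R, C⟩)

/-- Given `T` and `R`, the program finds a CPD of `T` with `R` terms, whatever bases and
generalized eigenvalue decompositions its subroutines return. -/
def Prog.FindsCPD (P : Prog InputTy OutputTy) {I J K : ℕ} (T : Tensor I J K) (R : ℕ) : Prop :=
  ∀ S : Solver, ∃ (A : Matrix (Fin I) (Fin R) ℝ) (B : Matrix (Fin J) (Fin R) ℝ)
    (C : Matrix (Fin K) (Fin R) ℝ), P.run S (input T R) = output A B C ∧ IsCPD T A B C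

end CPD

namespace CPD
open Matrix

/-! A slice is a matrix A diag(d) Bᵀ; those with d = Cᵀx are contractions of the tensor, hence the
same for all its decompositions. Both parts rest on `exists_selectors`: if A and B have k-ranks at
least a and b, and s is a set of terms with |s| ≤ a and R + |s| ≤ a + b, then fixed matrices F and G
satisfy F A diag(d) Bᵀ Gᵀ = diag(d_r)_{r ∈ s} for all d. The third factor, of k-rank k, is
compressed to k rows without losing general position (`ColIndep.exists_momentRows`). Put μ = R + 1 -
k. Each μ-set s then has a normal x_s, orthogonal to exactly the k - 1 columns outside s, which span
its orthogonal complement (`ColIndep.exists_normal`). Kruskal's condition reads R + (μ + 1) ≤ a + b: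
there are selectors for all sets of up to μ + 1 terms.

Uniqueness. Comparing ranks of slices of two decompositions, selectors show that Cᵀx has no more
nonzero entries than C'ᵀx whenever the latter has at most μ. Kruskal's permutation lemma
(`exists_perm_smul_col`), proved by counting columns in flats of decreasing dimension, then matches
the third factors. The slice at x_s has range span(a_r : r ∈ s), and intersecting over sets
containing r isolates a_r, likewise b_r; the remaining scalars are forced. A decomposition with
fewer terms is excluded by padding it with zeros.

Algorithm. By Cauchy–Binet and selectors, the ν-minors of slices span, as functions of x, the same
space as the products P_s(x) = ∏_{r ∈ s} ⟨c_r, x⟩ with |s| = ν, for ν = μ and ν = μ + 1. Polynomials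
of degree at most μ + 1 are represented by their values on a grid. Let w be a functional
annihilating the products of μ + 1 forms. For a linear form l, w(l P_s) vanishes when l = c_r with r
∉ s, so it equals ⟨l, x_s⟩ z_s(w). The matrices of (g, w) ↦ w(l g) thus factor as E diag(⟨l, x_s⟩) Z
with E and Z independent of l. A GEVD for two forms with distinct ratios of these values recovers
every x_s up to scale (`gevd_recovers_normals`). This yields the slices at the normals,
intersections of their ranges give A and B, and a linear system gives C.

Everything not known from the input (the k-rank k, the parameters of the compression and of the two
forms, and which eigenvector and which minor serve which set) is a bounded natural number. The
program tries all values and keeps a candidate with zero residual. One good choice exists for every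
solver (`exists_isGuess`), and by the first part every exact decomposition with R terms is a CPD. -/

/-! ### Duality and column independence. -/

/-- Linear functionals on coordinate spaces are dot products. -/
theorem exists_dotProduct_eq {m : Type*} [Fintype m] (f : (m → ℝ) →ₗ[ℝ] ℝ) :
    ∃ w, ∀ v, f v = v ⬝ᵥ w := by
  classical
  refine ⟨fun i => f (Pi.single i 1), fun v => ?_⟩
  rw [LinearMap.pi_apply_eq_sum_univ f v]
  simp only [dotProduct, smul_eq_mul]
  refine Finset.sum_congr rfl fun i _ => ?_
  congr 2
  ext j; simp [Pi.single_apply, eq_comm]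

/-- A vector orthogonal to the kernel of `Mᵀ` lies in the range of `M`. -/
theorem exists_mulVec_eq {m n : Type*} [Fintype m] [Fintype n] (M : Matrix m n ℝ) (g : m → ℝ)
    (h : ∀ w, Mᵀ *ᵥ w = 0 → g ⬝ᵥ w = 0) : ∃ v, M *ᵥ v = g := by
  classical
  by_contra hg
  have hg' : g ∉ LinearMap.range M.mulVecLin := fun ⟨v, hv⟩ => hg ⟨v, hv⟩
  obtain ⟨f, hf, hf'⟩ := Submodule.exists_le_ker_of_notMem hg'
  obtain ⟨w, hw⟩ := exists_dotProduct_eq f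
  apply hf
  rw [hw]
  apply h
  ext j
  have : f (M *ᵥ Pi.single j 1) = 0 := hf' ⟨_, rfl⟩
  rw [hw] at this
  rw [Pi.zero_apply, ← this]
  simp [mulVec, dotProduct, Pi.single_apply]

/-- Any at most `k` columns of `A` are linearly independent. -/
def ColIndep {ι : Type*} {R : ℕ} (A : Matrix ι (Fin R) ℝ) (k : ℕ) : Prop :=
  ∀ (s : Finset (Fin R)) (v : Fin R → ℝ), s.card ≤ k → (∀ r ∉ s, v r = 0) → A *ᵥ v = 0 → v = 0

theorem ColIndep.mono {ι : Type*} {R : ℕ} {A : Matrix ι (Fin R) ℝ} {k l : ℕ}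
    (h : ColIndep A k) (hl : l ≤ k) : ColIndep A l :=
  fun s v hs => h s v (hs.trans hl)

/-- The supremum is attained, since its set contains 0 and is bounded by R; a smaller set of columns
is handled by extending it to one of exactly the maximal size. -/
theorem kRank_spec {I R : ℕ} (A : Matrix (Fin I) (Fin R) ℝ) :
    kRank A ≤ R ∧ ColIndep A (kRank A) := by
  have hne : {k : ℕ | k ≤ R ∧ ∀ s : Finset (Fin R), s.card = k →
      LinearIndependent ℝ (fun j : s => A.col (j : Fin R))}.Nonempty := by
    refine ⟨0, Nat.zero_le _, fun s hs => ?_⟩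
    obtain rfl := Finset.card_eq_zero.mp hs
    exact linearIndependent_empty_type
  have hmem := Nat.sSup_mem hne ⟨R, fun k hk => hk.1⟩
  refine ⟨hmem.1, fun s v hs hv h0 => ?_⟩
  obtain ⟨t, hst, -, ht⟩ := Finset.exists_subsuperset_card_eq (Finset.subset_univ s) hs
    (by simpa [kRank] using hmem.1)
  have hli := Fintype.linearIndependent_iff.mp (hmem.2 t ht) (fun j => v j) (by
    rw [Finset.sum_coe_sort t (fun r => v r • A.col r)]
    rw [Finset.sum_subset (Finset.subset_univ t)
      (fun r _ hr => by rw [hv r (fun h => hr (hst h)), zero_smul])]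
    rw [← h0]
    ext i
    simp [mulVec, dotProduct, mul_comm])
  ext r
  by_cases hr : r ∈ t
  · exact hli ⟨r, hr⟩
  · exact hv r fun h => hr (hst h)

/-- Coordinate functionals on independent columns. -/
theorem ColIndep.exists_dual {ι : Type*} [Fintype ι] {R k : ℕ} {A : Matrix ι (Fin R) ℝ}
    (h : ColIndep A k) {s : Finset (Fin R)} (hs : s.card ≤ k) (i : Fin R) :
    ∃ f : ι → ℝ, ∀ j ∈ s, f ⬝ᵥ A.col j = if j = i then 1 else 0 := by
  classical
  let M : Matrix (Fin R) ι ℝ := Matrix.of fun j x => if j ∈ s then A x j else 0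
  obtain ⟨f, hf⟩ := exists_mulVec_eq M (fun j => if j ∈ s ∧ j = i then 1 else 0) (by
    intro w hw
    have := h s (fun j => if j ∈ s then w j else 0) hs (fun r hr => by simp [hr]) (by
      rw [← hw]
      ext x
      simp [M, mulVec, dotProduct])
    refine Finset.sum_eq_zero fun j _ => ?_
    have hj := congrFun this j
    by_cases hjs : j ∈ s
    · simp [hjs] at hj; simp [hj]
    · simp [hjs])
  refine ⟨f, fun j hj => ?_⟩
  have := congrFun hf j
  simp only [M, mulVec, hj, true_and, Matrix.of_apply, if_true] at this
  rw [dotProduct_comm]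
  exact this

theorem ColIndep.linearIndependent {ι : Type*} {R k : ℕ} {C : Matrix ι (Fin R) ℝ}
    (h : ColIndep C k) {s : Finset (Fin R)} (hs : s.card ≤ k) :
    LinearIndependent ℝ (fun j : s => C.col (j : Fin R)) := by
  classical
  rw [Fintype.linearIndependent_iff]
  intro g hg j
  have := h s (fun r => if hr : r ∈ s then g ⟨r, hr⟩ else 0) hs (fun r hr => by simp [hr]) (by
    rw [← hg]
    ext i
    simp only [mulVec, dotProduct, Finset.sum_apply, Pi.smul_apply, smul_eq_mul]
    rw [← Finset.sum_subset (Finset.subset_univ s) (fun r _ hr => by simp [hr]),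
      ← Finset.sum_coe_sort s]
    refine Finset.sum_congr rfl fun r _ => ?_
    simp [mul_comm])
  simpa using congrFun this j

/-- `k` independent vectors span a space of dimension `k`. -/
theorem ColIndep.exists_mulVec_eq {R k : ℕ} {C : Matrix (Fin k) (Fin R) ℝ}
    (h : ColIndep C k) {s : Finset (Fin R)} (hs : s.card = k) (y : Fin k → ℝ) :
    ∃ v, (∀ r ∉ s, v r = 0) ∧ C *ᵥ v = y := by
  classical
  have hli := h.linearIndependent hs.le
  have hsp := hli.span_eq_top_of_card_eq_finrank' (by simp [hs])
  have hy : y ∈ Submodule.span ℝ (Set.range (fun j : s => C.col (j : Fin R))) := by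
    rw [hsp]; trivial
  obtain ⟨g, hg⟩ := (Submodule.mem_span_range_iff_exists_fun ℝ).mp hy
  refine ⟨fun r => if hr : r ∈ s then g ⟨r, hr⟩ else 0, fun r hr => by simp [hr], ?_⟩
  rw [← hg]
  ext i
  simp only [mulVec, dotProduct, Finset.sum_apply, Pi.smul_apply, smul_eq_mul]
  rw [← Finset.sum_subset (Finset.subset_univ s) (fun r _ hr => by simp [hr]),
    ← Finset.sum_coe_sort s]
  refine Finset.sum_congr rfl fun r _ => ?_
  simp [mul_comm]

/-! ### Slices, selectors and ranges of slices. -/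

/-- The matrix slice `∑ k, x k • T k` of `[A, B, C]`, with `d = Cᵀ x`. -/
def slice {I J R : ℕ} (A : Matrix (Fin I) (Fin R) ℝ) (B : Matrix (Fin J) (Fin R) ℝ)
    (d : Fin R → ℝ) : Matrix (Fin I) (Fin J) ℝ := A * diagonal d * Bᵀ

theorem slice_apply {I J R : ℕ} (A : Matrix (Fin I) (Fin R) ℝ) (B : Matrix (Fin J) (Fin R) ℝ)
    (d : Fin R → ℝ) (i : Fin I) (j : Fin J) : slice A B d i j = ∑ r, A i r * B j r * d r := by
  rw [slice, Matrix.mul_apply]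
  simp only [mul_diagonal, transpose_apply]
  exact Finset.sum_congr rfl fun r _ => by ring

theorem slice_transpose {I J R : ℕ} (A : Matrix (Fin I) (Fin R) ℝ) (B : Matrix (Fin J) (Fin R) ℝ)
    (d : Fin R → ℝ) : (slice A B d)ᵀ = slice B A d := by
  simp [slice, Matrix.transpose_mul, Matrix.mul_assoc]

/-- Linear functionals that isolate the terms in `s` of a decomposition with two factors of large
k-rank. -/
theorem exists_selectors {I J R a b : ℕ} {A : Matrix (Fin I) (Fin R) ℝ}
    {B : Matrix (Fin J) (Fin R) ℝ} (hA : ColIndep A a) (hB : ColIndep B b) (s : Finset (Fin R))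
    (ha : a ≤ R) (hsa : s.card ≤ a) (hab : R + s.card ≤ a + b) :
    ∃ (F : Matrix s (Fin I) ℝ) (G : Matrix s (Fin J) ℝ), ∀ d : Fin R → ℝ,
      F * slice A B d * Gᵀ = diagonal fun i : s => d i := by
  classical
  obtain ⟨p, hsp, -, hp⟩ := Finset.exists_subsuperset_card_eq (Finset.subset_univ s) hsa
    (by simpa using ha)
  -- F is dual to the columns of A in a set p ⊇ s of size a, G to the columns of B in s ∪ pᶜ. The
  -- latter set has at most |s| + R - a elements, so it fits into b by `hab`.
  have hq : (s ∪ pᶜ).card ≤ b := by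
    refine (Finset.card_union_le _ _).trans ?_
    rw [Finset.card_compl, hp, Fintype.card_fin]
    omega
  choose f hf using fun i : s => hA.exists_dual hp.le (i : Fin R)
  choose g hg using fun i : s => hB.exists_dual hq (i : Fin R)
  refine ⟨Matrix.of f, Matrix.of g, fun d => ?_⟩
  have h1 : Matrix.of f * slice A B d * (Matrix.of g)ᵀ =
      (Matrix.of f * A) * diagonal d * (Matrix.of g * B)ᵀ := by
    simp only [slice, Matrix.transpose_mul, Matrix.mul_assoc]
  rw [h1]
  ext i j
  rw [Matrix.mul_apply]
  simp only [mul_diagonal, transpose_apply]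
  have hfa : ∀ r, (Matrix.of f * A) i r = f i ⬝ᵥ A.col r := fun r => rfl
  have hgb : ∀ r, (Matrix.of g * B) j r = g j ⬝ᵥ B.col r := fun r => rfl
  rw [diagonal_apply]
  rw [Finset.sum_eq_single (i : Fin R)]
  · rw [hfa, hgb, hf i i (hsp i.2), hg j i (by simp)]
    by_cases hij : i = j
    · simp [hij]
    · have : (i : Fin R) ≠ j := fun h => hij (Subtype.ext h)
      simp [hij, this]
  · intro r _ hr
    -- An unwanted term is removed by F if it lies in p and by G otherwise.
    by_cases hrp : r ∈ p
    · rw [hfa, hf i r hrp, if_neg hr]; simp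
    · by_cases hrj : r = j
      · subst hrj; exact absurd (hsp j.2) hrp
      · rw [hgb, hg j r (by simp [hrp]), if_neg hrj]; simp
  · simp

/-- The Khatri–Rao product of two factors of large k-rank has full column rank. -/
theorem eq_zero_of_slice_eq_zero {I J R a b : ℕ} {A : Matrix (Fin I) (Fin R) ℝ}
    {B : Matrix (Fin J) (Fin R) ℝ} (hA : ColIndep A a) (hB : ColIndep B b)
    (ha : a ≤ R) (h1 : 1 ≤ a) (hab : R + 1 ≤ a + b) {d : Fin R → ℝ} (h : slice A B d = 0) :
    d = 0 := by
  ext r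
  obtain ⟨F, G, hFG⟩ := exists_selectors hA hB {r} ha (by simpa) (by simpa)
  have := congrFun (congrFun (hFG d) ⟨r, by simp⟩) ⟨r, by simp⟩
  simpa [h] using this.symm

/-- The range of a slice whose coefficients are supported on `s`. -/
theorem mem_range_slice_iff {I J R : ℕ} {A : Matrix (Fin I) (Fin R) ℝ}
    {B : Matrix (Fin J) (Fin R) ℝ} {s : Finset (Fin R)} (hB : ColIndep B s.card) {d : Fin R → ℝ}
    (hd : ∀ r, d r = 0 ↔ r ∉ s) (v : Fin I → ℝ) :
    (∃ u, slice A B d *ᵥ u = v) ↔ ∃ l : Fin R → ℝ, (∀ r ∉ s, l r = 0) ∧ A *ᵥ l = v := by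
  classical
  constructor
  · rintro ⟨u, rfl⟩
    refine ⟨diagonal d *ᵥ (Bᵀ *ᵥ u), fun r hr => ?_, ?_⟩
    · simp [mulVec_diagonal, (hd r).2 hr]
    · simp [slice, Matrix.mul_assoc]
  · rintro ⟨l, hl, rfl⟩
    choose g hg using fun i : Fin R => hB.exists_dual le_rfl i
    -- The vectors g i are dual to the columns of B in s, so the weights l i / d i undo the diagonal
    -- matrix on its support.
    refine ⟨∑ i ∈ s, (l i / d i) • g i, ?_⟩
    have : diagonal d *ᵥ (Bᵀ *ᵥ ∑ i ∈ s, (l i / d i) • g i) = l := by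
      ext r
      rw [mulVec_diagonal]
      by_cases hr : r ∈ s
      · have hdr : d r ≠ 0 := fun h => (hd r).1 h hr
        have : (Bᵀ *ᵥ ∑ i ∈ s, (l i / d i) • g i) r = l r / d r := by
          rw [mulVec_sum, Finset.sum_apply, Finset.sum_eq_single r]
          · rw [mulVec_smul, Pi.smul_apply]
            have : (Bᵀ *ᵥ g r) r = 1 := by
              have := hg r r hr
              rw [if_pos rfl, dotProduct_comm] at this
              exact this
            rw [this]; simp
          · intro i _ hir
            rw [mulVec_smul, Pi.smul_apply]
            have : (Bᵀ *ᵥ g i) r = 0 := by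
              have := hg i r hr
              rw [if_neg (Ne.symm hir), dotProduct_comm] at this
              exact this
            rw [this]; simp
          · exact fun h => absurd hr h
        rw [this]; field_simp
      · rw [(hd r).2 hr, hl r hr, zero_mul]
    rw [slice, ← mulVec_mulVec, ← mulVec_mulVec, this]

/-- Spans of independent columns intersect in the span of the common columns; here a family of
index sets with only `r` in common. -/
theorem exists_smul_col {I R k : ℕ} {A : Matrix (Fin I) (Fin R) ℝ} (hA : ColIndep A k)
    {s : Finset (Fin R)} {r t : Fin R} (hs : s.card + 1 ≤ k)
    {v : Fin I → ℝ} (h0 : ∃ l : Fin R → ℝ, (∀ i ∉ s, l i = 0) ∧ A *ᵥ l = v)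
    (h : ∀ j ∈ s, j ≠ r → ∃ l : Fin R → ℝ, (∀ i ∉ insert t (s.erase j), l i = 0) ∧ A *ᵥ l = v)
    (ht : t ∉ s) : ∃ c : ℝ, v = c • A.col r := by
  classical
  obtain ⟨l, hl, rfl⟩ := h0
  have hz : ∀ j, j ≠ r → l j = 0 := by
    intro j hjr
    by_cases hj : j ∈ s
    · obtain ⟨l', hl', hll⟩ := h j hj hjr
      have := hA (insert t s) (l - l') ((Finset.card_insert_le _ _).trans hs) (fun i hi => by
        simp only [Finset.mem_insert, not_or] at hi
        rw [Pi.sub_apply, hl i hi.2, hl' i (by simp [hi.1, hi.2]), sub_zero])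
        (by rw [mulVec_sub, hll, sub_self])
      have h2 := congrFun this j
      rw [Pi.sub_apply, hl' j (by simp; rintro rfl; exact ht hj), sub_zero] at h2
      exact h2
    · exact hl j hj
  refine ⟨l r, ?_⟩
  ext i
  rw [mulVec, dotProduct, Finset.sum_eq_single r (fun j _ hj => by rw [hz j hj, mul_zero])
    (by simp)]
  simp [mul_comm]

/-! ### Compression of the third mode. -/

/-- Finitely many nonzero vectors are not orthogonal to some integer point of the moment curve. -/
theorem exists_pow_ne_zero {ι : Type*} [Fintype ι] {K : ℕ} (f : ι → Fin K → ℝ)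
    (hf : ∀ i, f i ≠ 0) :
    ∃ t : ℕ, t ≤ Fintype.card ι * K ∧ ∀ i, ∑ κ, f i κ * (t : ℝ) ^ (κ : ℕ) ≠ 0 := by
  classical
  let p : ι → Polynomial ℝ := fun i => ∑ κ : Fin K, Polynomial.monomial (κ : ℕ) (f i κ)
  have hp : ∀ i, p i ≠ 0 := by
    intro i h
    apply hf i
    ext κ
    have := congrArg (fun q => Polynomial.coeff q (κ : ℕ)) h
    simpa [p, Polynomial.finsetSum_coeff, Polynomial.coeff_monomial, Fin.val_inj] using this
  have hdeg : ∀ i, (p i).natDegree ≤ K := fun i =>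
    Polynomial.natDegree_sum_le_of_forall_le _ _ fun κ _ =>
      (Polynomial.natDegree_monomial_le _).trans κ.2.le
  have heval : ∀ i t, (p i).eval t = ∑ κ, f i κ * t ^ (κ : ℕ) := by
    intro i t
    simp [p, Polynomial.eval_finsetSum]
  by_contra! hcon
  -- The product of all polynomials has degree at most card ι * K, but would vanish at card ι * K +
  -- 1 integers.
  have hP : (∏ i, p i) = 0 := by
    apply Polynomial.eq_zero_of_natDegree_lt_card_of_eval_eq_zero' _
      ((Finset.range (Fintype.card ι * K + 1)).image (Nat.cast : ℕ → ℝ))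
    · intro x hx
      obtain ⟨t, ht, rfl⟩ := Finset.mem_image.mp hx
      obtain ⟨i, hi⟩ := hcon t (by simpa [Nat.lt_succ_iff] using ht)
      rw [Polynomial.eval_prod]
      exact Finset.prod_eq_zero (Finset.mem_univ i) (by rw [heval, hi])
    · rw [Finset.card_image_of_injective _ Nat.cast_injective, Finset.card_range]
      refine Nat.lt_succ_of_le ((Polynomial.natDegree_prod_le _ _).trans ?_)
      refine (Finset.sum_le_sum fun i _ => hdeg i).trans ?_
      simp
  obtain ⟨i, -, hi⟩ := Finset.prod_eq_zero_iff.mp hP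
  exact hp i hi

/-- The matrix whose rows are the points with parameters `t` of the moment curve. -/
def momentRows (K : ℕ) (t : ℕ → ℕ) (n : ℕ) : Matrix (Fin n) (Fin K) ℝ :=
  Matrix.of fun a κ => (t a : ℝ) ^ (κ : ℕ)

theorem momentRows_mul_mulVec_eq_zero {K R n : ℕ} (t : ℕ → ℕ) (C : Matrix (Fin K) (Fin R) ℝ)
    (v : Fin R → ℝ) : (momentRows K t n * C) *ᵥ v = 0 ↔
      ∀ a < n, ∑ κ, (C *ᵥ v) κ * (t a : ℝ) ^ (κ : ℕ) = 0 := by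
  rw [← mulVec_mulVec, funext_iff, Fin.forall_iff]
  refine forall₂_congr fun a ha => ?_
  rw [mulVec, dotProduct, Pi.zero_apply]
  simp only [momentRows, Matrix.of_apply]
  simp_rw [mul_comm]

/-- Compression of a matrix of k-rank at least `k` to `k` rows. -/
theorem ColIndep.exists_momentRows {K R k : ℕ} {C : Matrix (Fin K) (Fin R) ℝ}
    (h : ColIndep C k) :
    ∃ t : ℕ → ℕ, (∀ i, t i ≤ 2 ^ R * K) ∧ ColIndep (momentRows K t k * C) k := by
  classical
  suffices H : ∀ n ≤ k, ∃ t : ℕ → ℕ, (∀ i, t i ≤ 2 ^ R * K) ∧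
      ColIndep (momentRows K t n * C) n from H k le_rfl
  intro n
  induction n with
  | zero =>
    refine fun _ => ⟨fun _ => 0, fun _ => Nat.zero_le _, fun s v hs hv _ => ?_⟩
    obtain rfl := Finset.card_eq_zero.mp (Nat.le_zero.mp hs)
    ext r; exact hv r (by simp)
  | succ n ih =>
    intro hn
    obtain ⟨t, ht, hC⟩ := ih (by omega)
    -- By the inductive hypothesis, a set of at most n + 1 columns carries, up to scale, at most one
    -- dependency of the first n rows. So a single witness per set has to be broken by the new row,
    -- and there are at most 2 ^ R sets.
    let ι := {s : Finset (Fin R) // s.card ≤ n + 1 ∧ ∃ v : Fin R → ℝ, v ≠ 0 ∧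
      (∀ r ∉ s, v r = 0) ∧ (momentRows K t n * C) *ᵥ v = 0}
    have hι : Fintype.card ι ≤ 2 ^ R := by
      refine (Fintype.card_subtype_le _).trans ?_
      simp
    choose l hl0 hls hlC using fun i : ι => i.2.2
    obtain ⟨τ, hτ, hτ'⟩ := exists_pow_ne_zero (fun i => C *ᵥ l i)
      (fun i h0 => hl0 i (h i.1 (l i) (i.2.1.trans hn) (hls i) h0))
    refine ⟨Function.update t n τ, fun i => ?_, fun s v hs hv hv0 => ?_⟩
    · by_cases hi : i = n
      · subst hi
        rw [Function.update_self]
        exact hτ.trans (Nat.mul_le_mul_right _ hι)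
      · rw [Function.update_of_ne hi]; exact ht i
    · rw [momentRows_mul_mulVec_eq_zero] at hv0
      have hvn : (momentRows K t n * C) *ᵥ v = 0 := by
        rw [momentRows_mul_mulVec_eq_zero]
        intro a ha
        have := hv0 a (by omega)
        rwa [Function.update_of_ne (by omega)] at this
      by_contra hvne
      let i : ι := ⟨s, hs, v, hvne, hv, hvn⟩
      obtain ⟨j, hj⟩ := Function.ne_iff.mp (hl0 i)
      rw [Pi.zero_apply] at hj
      have hjs : j ∈ s := by
        by_contra hjs
        exact hj (hls i j hjs)
      -- Eliminating the coordinate j leaves a dependency on at most n columns, which must be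
      -- trivial; hence v is proportional to the chosen witness.
      have hw := hC (s.erase j) (l i j • v - v j • l i)
        (by rw [Finset.card_erase_of_mem hjs]; omega)
        (fun r hr => by
          by_cases hrj : r = j
          · subst hrj; simp [mul_comm]
          · have hrs : r ∉ s := fun h => hr (by simp [hrj, h])
            simp [hv r hrs, hls i r hrs])
        (by rw [mulVec_sub, mulVec_smul, mulVec_smul, hvn, hlC i]; simp)
      have hveq : v = (v j / l i j) • l i := by
        ext r
        have := congrFun hw r
        simp only [Pi.sub_apply, Pi.smul_apply, smul_eq_mul, Pi.zero_apply] at this ⊢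
        field_simp
        linarith
      have hvj : v j / l i j ≠ 0 := by
        intro h0
        rw [h0, zero_smul] at hveq
        exact hvne hveq
      have hlast := hv0 n (by omega)
      rw [Function.update_self, hveq, mulVec_smul] at hlast
      simp only [Pi.smul_apply, smul_eq_mul, mul_assoc] at hlast
      rw [← Finset.mul_sum] at hlast
      rcases mul_eq_zero.mp hlast with h0 | h0
      · exact hvj h0
      · exact hτ' i h0

/-! ### Normals of hyperplanes spanned by columns. -/

/-- For a `k × R` matrix with columns in general position and a set `s` of `R + 1 - k` columns, the
vector orthogonal to exactly the columns outside `s`. -/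
theorem ColIndep.exists_normal {R k : ℕ} {C : Matrix (Fin k) (Fin R) ℝ} (hC : ColIndep C k)
    {s : Finset (Fin R)} (hs : s.card + k = R + 1) (hne : s.Nonempty) :
    ∃ x : Fin k → ℝ, (∀ r, (Cᵀ *ᵥ x) r = 0 ↔ r ∉ s) ∧
      ∀ v, v ⬝ᵥ x = 0 → ∃ l, (∀ r ∈ s, l r = 0) ∧ C *ᵥ l = v := by
  classical
  have hcard : ∀ r ∈ s, (insert r sᶜ).card = k := by
    intro r hr
    rw [Finset.card_insert_of_notMem (by simpa using hr), Finset.card_compl, Fintype.card_fin]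
    have := Finset.card_le_univ s
    rw [Fintype.card_fin] at this
    omega
  obtain ⟨r₀, hr₀⟩ := hne
  -- The normal is the r₀-th coordinate functional for the basis formed by the column r₀ and the
  -- columns outside s.
  obtain ⟨x, hx⟩ := hC.exists_dual (hcard r₀ hr₀).le r₀
  have hxC : ∀ r, (Cᵀ *ᵥ x) r = x ⬝ᵥ C.col r := fun r => dotProduct_comm _ _
  have hout : ∀ r ∉ s, (Cᵀ *ᵥ x) r = 0 := by
    intro r hr
    rw [hxC, hx r (by simp [hr]), if_neg (by rintro rfl; exact hr hr₀)]
  have h1 : (Cᵀ *ᵥ x) r₀ = 1 := by rw [hxC, hx r₀ (by simp), if_pos rfl]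
  have hdot : ∀ l : Fin R → ℝ, (C *ᵥ l) ⬝ᵥ x = l ⬝ᵥ (Cᵀ *ᵥ x) := by
    intro l
    rw [mulVec_transpose, dotProduct_comm, dotProduct_mulVec, dotProduct_comm]
  refine ⟨x, fun r => ⟨fun h0 hr => ?_, hout r⟩, fun v hv => ?_⟩
  -- If the entry at r ∈ s vanished, x would be orthogonal to the basis of columns insert r sᶜ, in
  -- which x itself can be expanded.
  · obtain ⟨l, hl, hlx⟩ := hC.exists_mulVec_eq (hcard r hr) x
    have : x ⬝ᵥ x = 0 := by
      nth_rw 1 [← hlx]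
      rw [hdot]
      refine Finset.sum_eq_zero fun i _ => ?_
      by_cases hir : i = r
      · rw [hir, h0, mul_zero]
      · by_cases his : i ∈ s
        · rw [hl i (by simp [hir, his]), zero_mul]
        · rw [hout i his, mul_zero]
    rw [dotProduct_self_eq_zero] at this
    rw [this] at h1
    simp at h1
  · obtain ⟨l, hl, rfl⟩ := hC.exists_mulVec_eq (hcard r₀ hr₀) v
    refine ⟨l, fun r hr => ?_, rfl⟩
    by_cases hr0 : r = r₀
    · subst hr0
      rw [hdot, dotProduct, Finset.sum_eq_single r, h1, mul_one] at hv
      · exact hv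
      · intro i _ hir
        by_cases his : i ∈ s
        · rw [hl i (by simp [hir, his]), zero_mul]
        · rw [hout i his, mul_zero]
      · simp
    · exact hl r (by simp [hr0, hr])

theorem exists_orthogonal_of_ne_top {k : ℕ} {F : Submodule ℝ (Fin k → ℝ)} (hF : F ≠ ⊤) :
    ∃ x : Fin k → ℝ, x ≠ 0 ∧ (∀ v ∈ F, v ⬝ᵥ x = 0) ∧
      (Module.finrank ℝ F + 1 = k → ∀ v, v ⬝ᵥ x = 0 → v ∈ F) := by
  obtain ⟨f, hf0, hf⟩ := Submodule.exists_le_ker_of_lt_top F (lt_top_iff_ne_top.mpr hF)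
  obtain ⟨x, hx⟩ := exists_dotProduct_eq f
  refine ⟨x, ?_, fun v hv => ?_, fun hk v hv => ?_⟩
  · rintro rfl
    exact hf0 (LinearMap.ext fun v => by rw [hx]; simp)
  · rw [← hx]; exact hf hv
  · have h1 := Module.Dual.finrank_ker_add_one_of_ne_zero (f := f) hf0
    rw [Module.finrank_fin_fun] at h1
    have := Submodule.eq_of_le_of_finrank_eq hf (by omega)
    rw [this, LinearMap.mem_ker, hx, hv]

/-! ### Counting columns in flats: Kruskal's permutation lemma. -/

section Flats

variable {R k : ℕ} (C : Matrix (Fin k) (Fin R) ℝ)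

open Classical in
/-- The number of columns of `C` in a subspace. -/
noncomputable def colCount (F : Submodule ℝ (Fin k → ℝ)) : ℕ :=
  (Finset.univ.filter fun r => C.col r ∈ F).card

open Classical in
/-- Columns inside and outside `F` among those in a larger subspace. -/
theorem colCount_eq_add {F G : Submodule ℝ (Fin k → ℝ)} (h : F ≤ G) :
    colCount C G = colCount C F +
      ((Finset.univ.filter fun r => C.col r ∉ F).filter fun r => C.col r ∈ G).card := by
  rw [colCount, colCount, ← Finset.card_union_of_disjoint]
  · congr 1
    ext r
    simp only [Finset.mem_filter, Finset.mem_univ, true_and, Finset.mem_union]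
    constructor
    · intro hr
      by_cases hF : C.col r ∈ F
      · exact Or.inl hF
      · exact Or.inr ⟨hF, hr⟩
    · rintro (hr | hr)
      · exact h hr
      · exact hr.2
  · rw [Finset.disjoint_left]
    intro r hr hr'
    simp only [Finset.mem_filter, Finset.mem_univ, true_and] at hr hr'
    exact hr'.1 hr

open Classical in
theorem colCount_add_compl (F : Submodule ℝ (Fin k → ℝ)) :
    colCount C F + (Finset.univ.filter fun r => C.col r ∉ F).card = R := by
  rw [colCount, Finset.card_filter_add_card_filter_not, Finset.card_univ, Fintype.card_fin]

open Classical in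
-- The nonzero entries of Cᵀ x are exactly the columns off the hyperplane with normal x. This
-- translates the comparison of weights into one of column counts.
theorem card_col_ne_zero_add_colCount {F : Submodule ℝ (Fin k → ℝ)} {x : Fin k → ℝ}
    (h : ∀ v, v ∈ F ↔ v ⬝ᵥ x = 0) :
    (Finset.univ.filter fun r => (Cᵀ *ᵥ x) r ≠ 0).card + colCount C F = R := by
  have := colCount_add_compl C F
  simp_rw [h] at this
  rw [add_comm]
  exact this

theorem exists_col_notMem (hspan : ∀ x, Cᵀ *ᵥ x = 0 → x = 0) {F : Submodule ℝ (Fin k → ℝ)}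
    (hF : F ≠ ⊤) : ∃ r, C.col r ∉ F := by
  by_contra! h
  obtain ⟨x, hx, hxF, -⟩ := exists_orthogonal_of_ne_top hF
  exact hx (hspan x (funext fun r => hxF _ (h r)))

/-- A subspace spanned by columns of `C`. -/
def IsFlat (F : Submodule ℝ (Fin k → ℝ)) : Prop :=
  F ≤ Submodule.span ℝ (C.col '' {r | C.col r ∈ F})

theorem IsFlat.finrank_le {F : Submodule ℝ (Fin k → ℝ)} (h : IsFlat C F) :
    Module.finrank ℝ F ≤ colCount C F := by
  classical
  refine (Submodule.finrank_mono h).trans ?_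
  have : C.col '' {r | C.col r ∈ F} =
      (((Finset.univ.filter fun r => C.col r ∈ F).image C.col : Finset _) : Set _) := by
    ext; simp
  rw [this]
  exact (finrank_span_finset_le_card _).trans Finset.card_image_le

theorem IsFlat.sup_span {F : Submodule ℝ (Fin k → ℝ)} (h : IsFlat C F) (r : Fin R) :
    IsFlat C (F ⊔ Submodule.span ℝ {C.col r}) := by
  refine sup_le (h.trans (Submodule.span_mono (Set.image_mono fun i hi => ?_)))
    (Submodule.span_mono ?_)
  · exact Submodule.mem_sup_left hi
  · rintro _ rfl
    exact ⟨r, Submodule.mem_sup_right (Submodule.mem_span_singleton_self _), rfl⟩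

/-- The subspaces one dimension above F partition the vectors outside F, so column counts in them
become sizes of fibres of r ↦ F ⊔ span of the column r. -/
theorem sup_span_eq_iff {F G : Submodule ℝ (Fin k → ℝ)} (hFG : F ≤ G)
    (hG : Module.finrank ℝ G = Module.finrank ℝ F + 1) {v : Fin k → ℝ} (hv : v ∉ F) :
    F ⊔ Submodule.span ℝ {v} = G ↔ v ∈ G := by
  constructor
  · rintro rfl
    exact Submodule.mem_sup_right (Submodule.mem_span_singleton_self _)
  · intro h
    refine Submodule.eq_of_le_of_finrank_eq (sup_le hFG (by simpa using h)) ?_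
    rw [Submodule.finrank_sup_span_singleton hv, hG]

variable {C} {C' : Matrix (Fin k) (Fin R) ℝ}

open Classical in
/-- If `Cᵀ x` has at most as many nonzero entries as `C'ᵀ x`, whenever the latter has few, then each
proper flat of `C'` contains at least as many columns of `C` as of `C'`. -/
theorem colCount_le (hspan : ∀ x, C'ᵀ *ᵥ x = 0 → x = 0)
    (hw : ∀ x, (Finset.univ.filter fun r => (C'ᵀ *ᵥ x) r ≠ 0).card + k ≤ R + 1 →
      (Finset.univ.filter fun r => (Cᵀ *ᵥ x) r ≠ 0).card ≤
        (Finset.univ.filter fun r => (C'ᵀ *ᵥ x) r ≠ 0).card) (e : ℕ) :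
    ∀ F : Submodule ℝ (Fin k → ℝ), IsFlat C' F → Module.finrank ℝ F + e + 1 = k →
      colCount C' F ≤ colCount C F := by
  induction e with
  | zero =>
    intro F hF hk
    have hne : F ≠ ⊤ := by
      rintro rfl
      rw [finrank_top, Module.finrank_fin_fun] at hk
      omega
    obtain ⟨x, -, hx, hx'⟩ := exists_orthogonal_of_ne_top hne
    have hmem : ∀ v, v ∈ F ↔ v ⬝ᵥ x = 0 := fun v => ⟨hx v, hx' hk v⟩
    have h1 := card_col_ne_zero_add_colCount C hmem
    have h2 := card_col_ne_zero_add_colCount C' hmem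
    -- A flat hyperplane contains at least k - 1 columns of C', so the weight of C'ᵀ x is at most R
    -- + 1 - k, the range where `hw` applies.
    have h3 := hF.finrank_le
    have := hw x (by omega)
    omega
  | succ e ih =>
    intro F hF hk
    let O' := Finset.univ.filter fun r => C'.col r ∉ F
    let O := Finset.univ.filter fun r => C.col r ∉ F
    let g' : Fin R → Submodule ℝ (Fin k → ℝ) := fun r => F ⊔ Submodule.span ℝ {C'.col r}
    let g : Fin R → Submodule ℝ (Fin k → ℝ) := fun r => F ⊔ Submodule.span ℝ {C.col r}
    -- The flats of C' covering F. Each column of C' outside F lies in exactly one of them, each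
    -- column of C outside F in at most one.
    let 𝓕 := O'.image g'
    have hfin : ∀ G ∈ 𝓕, F ≤ G ∧ Module.finrank ℝ G = Module.finrank ℝ F + 1 ∧ IsFlat C' G := by
      intro G hG
      obtain ⟨r, hr, rfl⟩ := Finset.mem_image.mp hG
      exact ⟨le_sup_left, Submodule.finrank_sup_span_singleton (by simpa [O'] using hr),
        hF.sup_span C' r⟩
    have hG' : ∀ G ∈ 𝓕, colCount C' G = colCount C' F + (O'.filter fun r => g' r = G).card := by
      intro G hG
      rw [colCount_eq_add C' (hfin G hG).1]
      congr 2
      refine Finset.filter_congr fun r hr => ?_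
      exact (sup_span_eq_iff (hfin G hG).1 (hfin G hG).2.1 (by simpa [O'] using hr)).symm
    have hG : ∀ G ∈ 𝓕, colCount C G = colCount C F + (O.filter fun r => g r = G).card := by
      intro G hG
      rw [colCount_eq_add C (hfin G hG).1]
      congr 2
      refine Finset.filter_congr fun r hr => ?_
      exact (sup_span_eq_iff (hfin G hG).1 (hfin G hG).2.1 (by simpa [O] using hr)).symm
    -- With M covers and c', c the counts in F for C' and C, the sum reads M c' + (R - c') ≤ M c +
    -- (R - c); since M ≥ 2, this gives c' ≤ c.
    have hsum : ∑ G ∈ 𝓕, colCount C' G ≤ ∑ G ∈ 𝓕, colCount C G :=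
      Finset.sum_le_sum fun G hG => ih G (hfin G hG).2.2 (by rw [(hfin G hG).2.1]; omega)
    rw [Finset.sum_congr rfl hG', Finset.sum_congr rfl hG, Finset.sum_add_distrib,
      Finset.sum_add_distrib, Finset.sum_const, Finset.sum_const, smul_eq_mul, smul_eq_mul,
      ← Finset.card_eq_sum_card_image, Finset.sum_card_fiberwise_eq_card_filter] at hsum
    have h1 : (O.filter fun r => g r ∈ 𝓕).card ≤ O.card := Finset.card_filter_le _ _
    have h2 : colCount C' F + O'.card = R := colCount_add_compl C' F
    have h3 : colCount C F + O.card = R := colCount_add_compl C F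
    have hM : 2 ≤ 𝓕.card := by
      have hFtop : F ≠ ⊤ := by
        rintro rfl
        rw [finrank_top, Module.finrank_fin_fun] at hk
        omega
      obtain ⟨r₁, hr₁⟩ := exists_col_notMem C' hspan hFtop
      have hm₁ : g' r₁ ∈ 𝓕 := Finset.mem_image_of_mem _ (by simpa [O'] using hr₁)
      have hGtop : g' r₁ ≠ ⊤ := by
        intro h
        have := (hfin _ hm₁).2.1
        rw [h, finrank_top, Module.finrank_fin_fun] at this
        omega
      obtain ⟨r₂, hr₂⟩ := exists_col_notMem C' hspan hGtop
      have hm₂ : g' r₂ ∈ 𝓕 := Finset.mem_image_of_mem _ (by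
        simpa [O'] using fun h => hr₂ (le_sup_left (a := F) h))
      refine Finset.one_lt_card.mpr ⟨_, hm₁, _, hm₂, fun h => hr₂ ?_⟩
      rw [h]
      exact Submodule.mem_sup_right (Submodule.mem_span_singleton_self _)
    by_contra hlt
    have hlt' : colCount C F + 1 ≤ colCount C' F := by omega
    nlinarith

open Classical in
/-- Kruskal's permutation lemma. -/
theorem exists_perm_smul_col (hC : ColIndep C 2) (hk : 2 ≤ k)
    (hspan : ∀ x, C'ᵀ *ᵥ x = 0 → x = 0)
    (hw : ∀ x, (Finset.univ.filter fun r => (C'ᵀ *ᵥ x) r ≠ 0).card + k ≤ R + 1 →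
      (Finset.univ.filter fun r => (Cᵀ *ᵥ x) r ≠ 0).card ≤
        (Finset.univ.filter fun r => (C'ᵀ *ᵥ x) r ≠ 0).card) :
    ∃ (σ : Equiv.Perm (Fin R)) (γ : Fin R → ℝ), ∀ r, γ r ≠ 0 ∧ C'.col r = γ r • C.col (σ r) := by
  have hli : ∀ r s, ∀ a b : ℝ, r ≠ s → a • C.col r = b • C.col s → a = 0 := by
    intro r s a b hrs h
    have := hC {r, s} (Pi.single r a - Pi.single s b) Finset.card_le_two
      (fun i hi => by
        simp only [Finset.mem_insert, Finset.mem_singleton, not_or] at hi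
        simp [hi.1, hi.2])
      (by
        rw [mulVec_sub, mulVec_single, mulVec_single, op_smul_eq_smul, op_smul_eq_smul, h,
          sub_self])
    simpa [hrs] using congrFun this r
  have hC0 : ∀ r, C.col r ≠ 0 := by
    intro r h
    have := hC {r} (Pi.single r 1) (by simp) (fun i hi => by
      simp only [Finset.mem_singleton] at hi
      simp [hi]) (by rw [mulVec_single_one, h])
    simpa using congrFun this r
  have hC'0 : ∀ r, C'.col r ≠ 0 := by
    intro r h
    -- The zero subspace is a flat and contains no column of C, hence none of C'.
    have h0 := colCount_le hspan hw (k - 1) ⊥ bot_le (by rw [finrank_bot]; omega)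
    have h1 : colCount C ⊥ = 0 := by
      rw [colCount, Finset.card_eq_zero, Finset.filter_eq_empty_iff]
      intro r _
      simpa using hC0 r
    rw [h1, Nat.le_zero, colCount, Finset.card_eq_zero, Finset.filter_eq_empty_iff] at h0
    exact h0 (Finset.mem_univ r) (by simpa using h)
  have hline : ∀ r, colCount C' (Submodule.span ℝ {C'.col r}) ≤
      colCount C (Submodule.span ℝ {C'.col r}) := fun r =>
    colCount_le hspan hw (k - 2) _ (Submodule.span_mono (by
      rintro _ rfl
      exact ⟨r, Submodule.mem_span_singleton_self _, rfl⟩))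
      (by rw [finrank_span_singleton (hC'0 r)]; omega)
  have hle1 : ∀ r, colCount C (Submodule.span ℝ {C'.col r}) ≤ 1 := by
    intro r
    refine Finset.card_le_one.mpr fun i hi j hj => ?_
    simp only [Finset.mem_filter, Finset.mem_univ, true_and, Submodule.mem_span_singleton] at hi hj
    obtain ⟨a, ha⟩ := hi
    obtain ⟨b, hb⟩ := hj
    by_contra hij
    have hb0 : b = 0 := hli i j b a hij (by rw [← ha, ← hb, smul_smul, smul_smul, mul_comm])
    rw [hb0, zero_smul] at hb
    exact hC0 j hb.symm
  have hex : ∀ r, ∃ i, C.col i ∈ Submodule.span ℝ {C'.col r} := by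
    intro r
    have h1 : 0 < colCount C' (Submodule.span ℝ {C'.col r}) :=
      Finset.card_pos.mpr ⟨r, by simp⟩
    obtain ⟨i, hi⟩ := Finset.card_pos.mp (h1.trans_le (hline r))
    exact ⟨i, by simpa using hi⟩
  choose σ hσ using hex
  simp_rw [Submodule.mem_span_singleton] at hσ
  choose a ha using hσ
  have ha0 : ∀ r, a r ≠ 0 := by
    intro r h
    have := ha r
    rw [h, zero_smul] at this
    exact hC0 _ this.symm
  -- If σ r = σ s, the line of C'.col r contains two columns of C' unless r = s, while by `hline`
  -- and `hle1` it contains at most one.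
  have hinj : Function.Injective σ := by
    intro r s hrs
    refine Finset.card_le_one.mp ((hline r).trans (hle1 r)) r ?_ s ?_
    · simp
    · simp only [Finset.mem_filter, Finset.mem_univ, true_and, Submodule.mem_span_singleton]
      refine ⟨(a s)⁻¹ * a r, ?_⟩
      rw [mul_smul, ha, hrs, ← ha s, smul_smul, inv_mul_cancel₀ (ha0 s), one_smul]
  refine ⟨Equiv.ofBijective σ (Finite.injective_iff_bijective.mp hinj), fun r => (a r)⁻¹,
    fun r => ⟨inv_ne_zero (ha0 r), ?_⟩⟩
  rw [Equiv.ofBijective_apply, ← ha, smul_smul, inv_mul_cancel₀ (ha0 r), one_smul]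

end Flats

/-! ### Uniqueness under Kruskal's condition. -/

theorem ofFactors_mulVec {I J K R : ℕ} (A : Matrix (Fin I) (Fin R) ℝ) (B : Matrix (Fin J) (Fin R) ℝ)
    (C : Matrix (Fin K) (Fin R) ℝ) (y : Fin K → ℝ) (i : Fin I) (j : Fin J) :
    slice A B (Cᵀ *ᵥ y) i j = ∑ k, ofFactors A B C i j k * y k := by
  rw [slice_apply]
  simp only [ofFactors, mulVec, dotProduct, transpose_apply, Finset.sum_mul, Finset.mul_sum]
  rw [Finset.sum_comm]
  exact Finset.sum_congr rfl fun k _ => Finset.sum_congr rfl fun r _ => by ring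

theorem slice_eq_of_ofFactors_eq {I J K R R' : ℕ} {A : Matrix (Fin I) (Fin R) ℝ}
    {B : Matrix (Fin J) (Fin R) ℝ} {C : Matrix (Fin K) (Fin R) ℝ} {A' : Matrix (Fin I) (Fin R') ℝ}
    {B' : Matrix (Fin J) (Fin R') ℝ} {C' : Matrix (Fin K) (Fin R') ℝ}
    (h : ofFactors A B C = ofFactors A' B' C') (y : Fin K → ℝ) :
    slice A B (Cᵀ *ᵥ y) = slice A' B' (C'ᵀ *ᵥ y) := by
  ext i j
  rw [ofFactors_mulVec, ofFactors_mulVec, h]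

/-- If the third factors agree up to permutation and scaling, so do the first factors. -/
theorem exists_smul_col_of_slice_eq {I J R b k : ℕ} {A : Matrix (Fin I) (Fin R) ℝ}
    {B : Matrix (Fin J) (Fin R) ℝ} {D : Matrix (Fin k) (Fin R) ℝ} {A' : Matrix (Fin I) (Fin R) ℝ}
    {B' : Matrix (Fin J) (Fin R) ℝ} {D' : Matrix (Fin k) (Fin R) ℝ} (hA : ColIndep A (R - k + 2))
    (hB : ColIndep B b) (hb : R + 1 - k ≤ b) (hD : ColIndep D k) (hk : 2 ≤ k) (hkR : k ≤ R)
    (h : ∀ x, slice A B (Dᵀ *ᵥ x) = slice A' B' (D'ᵀ *ᵥ x))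
    {σ : Equiv.Perm (Fin R)} {γ : Fin R → ℝ} (hσ : ∀ r, D'.col r = γ r • D.col (σ r))
    (r : Fin R) : ∃ c : ℝ, A'.col r = c • A.col (σ r) := by
  classical
  -- The slice at the normal of s has range the span of the columns s of A. In the other
  -- decomposition its coefficients live on σ⁻¹(s), so this range lies in a span of s.card columns
  -- of A'; equal dimensions make the two spans coincide.
  have key : ∀ s : Finset (Fin R), s.card + k = R + 1 → σ r ∈ s →
      ∃ l : Fin R → ℝ, (∀ i ∉ s, l i = 0) ∧ A *ᵥ l = A'.col r := by
    intro s hs hr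
    obtain ⟨x, hx, -⟩ := hD.exists_normal hs ⟨_, hr⟩
    have hBs : ColIndep B s.card := hB.mono (by omega)
    have hAs : ColIndep A s.card := hA.mono (by omega)
    have hQ : ∀ v, v ∈ Submodule.span ℝ (A.col '' s) ↔
        ∃ l : Fin R → ℝ, (∀ i ∉ s, l i = 0) ∧ A *ᵥ l = v := by
      intro v
      rw [Submodule.mem_span_image_finset_iff_exists_fun']
      constructor
      · rintro ⟨c, rfl⟩
        refine ⟨fun i => if i ∈ s then c i else 0, fun i hi => if_neg hi, ?_⟩
        ext j
        simp [mulVec, dotProduct, mul_comm]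
      · rintro ⟨l, hl, rfl⟩
        refine ⟨l, ?_⟩
        ext j
        rw [Finset.sum_subset (Finset.subset_univ s) fun i _ hi => by rw [hl i hi, zero_smul]]
        simp [mulVec, dotProduct, mul_comm]
    let P := Submodule.span ℝ (A'.col '' (s.map σ.symm.toEmbedding))
    have hQP : Submodule.span ℝ (A.col '' s) ≤ P := by
      intro v hv
      obtain ⟨u, rfl⟩ := (mem_range_slice_iff hBs hx v).mpr ((hQ v).mp hv)
      rw [h, Submodule.mem_span_image_finset_iff_exists_fun']
      refine ⟨diagonal (D'ᵀ *ᵥ x) *ᵥ (B'ᵀ *ᵥ u), ?_⟩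
      rw [Finset.sum_subset (Finset.subset_univ _)]
      · rw [slice, ← mulVec_mulVec, ← mulVec_mulVec]
        ext j
        simp [mulVec, dotProduct, mul_comm]
      · intro i _ hi
        have : (D'ᵀ *ᵥ x) i = γ i * (Dᵀ *ᵥ x) (σ i) := by
          change D'.col i ⬝ᵥ x = γ i * (D.col (σ i) ⬝ᵥ x)
          rw [hσ, smul_dotProduct, smul_eq_mul]
        have h0 : (Dᵀ *ᵥ x) (σ i) = 0 := (hx _).mpr fun his => hi (by
          simpa using his)
        rw [mulVec_diagonal, this, h0, mul_zero, zero_mul, zero_smul]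
    have heq : Submodule.span ℝ (A.col '' s) = P := by
      refine Submodule.eq_of_le_of_finrank_le hQP ?_
      have h1 := finrank_span_eq_card (hAs.linearIndependent le_rfl)
      have h2 : Set.range (fun j : s => A.col (j : Fin R)) = A.col '' s := by
        ext; simp
      rw [h2, Fintype.card_coe] at h1
      rw [h1]
      have h3 : A'.col '' (s.map σ.symm.toEmbedding) =
          (((s.map σ.symm.toEmbedding).image A'.col : Finset _) : Set _) := by simp
      change Module.finrank ℝ (Submodule.span ℝ (A'.col '' (s.map σ.symm.toEmbedding))) ≤ _
      rw [h3]
      exact (finrank_span_finset_le_card _).trans (Finset.card_image_le.trans (by simp))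
    rw [← hQ, heq]
    exact Submodule.subset_span ⟨r, by simpa using hr, rfl⟩
  obtain ⟨s, hrs, -, hs⟩ := Finset.exists_subsuperset_card_eq (Finset.subset_univ {σ r})
    (n := R + 1 - k) (by simp; omega) (by simp; omega)
  rw [Finset.singleton_subset_iff] at hrs
  -- Since k ≥ 2 some term is outside s; exchanging it for the elements of s other than σ r gives
  -- sets whose spans meet only in the line of A.col (σ r).
  obtain ⟨t, ht⟩ : ∃ t, t ∉ s := by
    by_contra! hall
    rw [Finset.eq_univ_of_forall hall, Finset.card_univ, Fintype.card_fin] at hs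
    omega
  refine exists_smul_col hA (s := s) (t := t) (by omega) (key s (by omega) hrs)
    (fun j hj hjr => key _ ?_ ?_) ht
  · rw [Finset.card_insert_of_notMem (fun h => ht (Finset.mem_of_mem_erase h)),
      Finset.card_erase_of_mem hj]
    have := Finset.card_pos.mpr ⟨j, hj⟩
    omega
  · simp [hrs, Ne.symm hjr]

/-- Kruskal's theorem for two decompositions of the same length. -/
theorem kruskal {I J K R a b k : ℕ} {A A' : Matrix (Fin I) (Fin R) ℝ}
    {B B' : Matrix (Fin J) (Fin R) ℝ} {C C' : Matrix (Fin K) (Fin R) ℝ} (hA : ColIndep A a)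
    (hB : ColIndep B b) (hC : ColIndep C k) (ha : a ≤ R) (hb : b ≤ R) (hk : k ≤ R)
    (habk : 2 * R + 2 ≤ a + b + k) (h : ofFactors A B C = ofFactors A' B' C') :
    ∃ (σ : Equiv.Perm (Fin R)) (α β γ : Fin R → ℝ), ∀ r, α r * β r * γ r = 1 ∧
      A'.col r = α r • A.col (σ r) ∧ B'.col r = β r • B.col (σ r) ∧
      C'.col r = γ r • C.col (σ r) := by
  classical
  obtain ⟨t, -, hD⟩ := hC.exists_momentRows
  set D := momentRows K t k * C
  let D' := momentRows K t k * C'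
  have hsl : ∀ x, slice A B (Dᵀ *ᵥ x) = slice A' B' (D'ᵀ *ᵥ x) := by
    intro x
    have := slice_eq_of_ofFactors_eq h ((momentRows K t k)ᵀ *ᵥ x)
    simpa only [D, D', transpose_mul, mulVec_mulVec] using this
  have hspan : ∀ x, D'ᵀ *ᵥ x = 0 → x = 0 := by
    intro x hx
    have h1 : slice A B (Dᵀ *ᵥ x) = 0 := by
      rw [hsl, hx]; simp [slice]
    have h2 := eq_zero_of_slice_eq_zero hA hB ha (by omega) (by omega) h1
    obtain ⟨s, -, -, hs⟩ := Finset.exists_subsuperset_card_eq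
      (Finset.subset_univ (∅ : Finset (Fin R))) (n := k) (by simp) (by simpa using hk)
    obtain ⟨v, -, hv⟩ := hD.exists_mulVec_eq hs x
    rw [← dotProduct_self_eq_zero]
    nth_rw 1 [← hv]
    rw [dotProduct_comm, dotProduct_mulVec, ← mulVec_transpose, h2, zero_dotProduct]
  have hw : ∀ x, (Finset.univ.filter fun r => (D'ᵀ *ᵥ x) r ≠ 0).card + k ≤ R + 1 →
      (Finset.univ.filter fun r => (Dᵀ *ᵥ x) r ≠ 0).card ≤
        (Finset.univ.filter fun r => (D'ᵀ *ᵥ x) r ≠ 0).card := by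
    intro x hx
    by_contra! hlt
    -- Take s inside the support of Dᵀ x with one element more than the weight of D'ᵀ x. Then s.card
    -- ≤ R + 2 - k, just within reach of selectors, and the selected diagonal block has rank s.card,
    -- more than the second decomposition allows.
    obtain ⟨s, hs, hsc⟩ := Finset.exists_subset_card_eq (Nat.succ_le_of_lt hlt)
    obtain ⟨F, G, hFG⟩ := exists_selectors hA hB s ha (by omega) (by omega)
    have h1 := congrArg Matrix.rank (hFG (Dᵀ *ᵥ x))
    rw [hsl, rank_diagonal, slice] at h1
    have h2 : (F * (A' * diagonal (D'ᵀ *ᵥ x) * B'ᵀ) * Gᵀ).rank ≤ (diagonal (D'ᵀ *ᵥ x)).rank :=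
      (rank_mul_le_left _ _).trans ((rank_mul_le_right _ _).trans
        ((rank_mul_le_left _ _).trans (rank_mul_le_right _ _)))
    rw [h1, rank_diagonal, Fintype.card_subtype, Fintype.card_subtype, Finset.filter_true_of_mem,
      Finset.card_univ, Fintype.card_coe, hsc] at h2
    · omega
    · intro i _
      simpa using hs i.2
  obtain ⟨σ, γ₀, hσ⟩ := exists_perm_smul_col (hD.mono (by omega)) (by omega) hspan hw
  choose α hα using exists_smul_col_of_slice_eq (hA.mono (by omega)) hB (by omega) hD (by omega) hk
    hsl (fun r => (hσ r).2)
  choose β hβ using exists_smul_col_of_slice_eq (A := B) (A' := B') (B := A) (B' := A')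
    (hB.mono (by omega)) hA (by omega) hD (by omega) hk
    (fun x => by rw [← slice_transpose, hsl, slice_transpose]) (fun r => (hσ r).2)
  -- With A and B matched, the coefficients of a slice are determined by it, which forces C as well.
  -- The scalars `γ₀` from the permutation lemma only concern the compressed factor and are dropped.
  have hcol : ∀ r, C.col (σ r) = (α r * β r) • C'.col r := by
    intro r
    have h1 : ∀ y, Cᵀ *ᵥ y = fun i => α (σ.symm i) * β (σ.symm i) * (C'ᵀ *ᵥ y) (σ.symm i) := by
      intro y
      rw [← sub_eq_zero]
      refine eq_zero_of_slice_eq_zero hA hB ha (by omega) (by omega) ?_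
      have h2 : ∀ d e, slice A B (d - e) = slice A B d - slice A B e := by
        intro d e
        ext i j
        simp only [Matrix.sub_apply, slice_apply, Pi.sub_apply, mul_sub, Finset.sum_sub_distrib]
      rw [h2, slice_eq_of_ofFactors_eq h, sub_eq_zero]
      ext i j
      rw [slice_apply, slice_apply, ← Equiv.sum_comp σ (fun r => A i r * _ * _)]
      refine Finset.sum_congr rfl fun r _ => ?_
      have h3 : A' i r = α r * A i (σ r) := congrFun (hα r) i
      have h4 : B' j r = β r * B j (σ r) := congrFun (hβ r) j
      rw [h3, h4, Equiv.symm_apply_apply]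
      ring
    ext κ
    have h5 := congrFun (h1 (Pi.single κ 1)) (σ r)
    simpa using h5
  have hne : ∀ r, α r * β r ≠ 0 := by
    intro r h0
    have h1 := hcol r
    rw [h0, zero_smul] at h1
    have := hC {σ r} (Pi.single (σ r) 1) (by simp; omega) (fun i hi => by
      simp only [Finset.mem_singleton] at hi
      simp [hi]) (by rw [mulVec_single_one, h1])
    simpa using congrFun this (σ r)
  refine ⟨σ, α, β, fun r => (α r * β r)⁻¹, fun r => ⟨mul_inv_cancel₀ (hne r), hα r, hβ r, ?_⟩⟩
  rw [hcol, smul_smul, inv_mul_cancel₀ (hne r), one_smul]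

/-- Decompositions can be padded with zero terms. -/
theorem exists_ofFactors_eq_of_le {I J K R R' : ℕ} (hR : R' ≤ R) (A : Matrix (Fin I) (Fin R') ℝ)
    (B : Matrix (Fin J) (Fin R') ℝ) (C : Matrix (Fin K) (Fin R') ℝ) :
    ∃ (A' : Matrix (Fin I) (Fin R) ℝ) (B' : Matrix (Fin J) (Fin R) ℝ)
      (C' : Matrix (Fin K) (Fin R) ℝ), ofFactors A B C = ofFactors A' B' C' ∧
      ∀ r : Fin R, R' ≤ r → C'.col r = 0 := by
  obtain ⟨n, rfl⟩ := Nat.exists_eq_add_of_le hR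
  refine ⟨Matrix.of fun i => Fin.append (A i) 0, Matrix.of fun i => Fin.append (B i) 0,
    Matrix.of fun i => Fin.append (C i) 0, ?_, fun r hr => ?_⟩
  · ext i j k
    simp [ofFactors, Fin.sum_univ_add]
  · ext k
    obtain ⟨s, rfl⟩ : ∃ s, r = Fin.natAdd R' s :=
      ⟨⟨r - R', by omega⟩, by ext; simp; omega⟩
    simp [Matrix.col]

/-- A shorter decomposition padded with zero terms would, by `kruskal`, match the given one and
force a zero column of C. For uniqueness, both CPDs are compared with the given decomposition and
the matchings are composed. -/
theorem isCPD_and_unique {I J K R : ℕ} {T : Tensor I J K} {A : Matrix (Fin I) (Fin R) ℝ}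
    {B : Matrix (Fin J) (Fin R) ℝ} {C : Matrix (Fin K) (Fin R) ℝ} (hT : T = ofFactors A B C)
    (h : 2 * R + 2 ≤ kRank A + kRank B + kRank C) : IsCPD T A B C ∧ CPDUnique T := by
  have hkr {A' : Matrix (Fin I) (Fin R) ℝ} {B' : Matrix (Fin J) (Fin R) ℝ}
      {C' : Matrix (Fin K) (Fin R) ℝ} (h' : T = ofFactors A' B' C') :=
    kruskal (kRank_spec A).2 (kRank_spec B).2 (kRank_spec C).2 (kRank_spec A).1 (kRank_spec B).1
      (kRank_spec C).1 h (hT.symm.trans h')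
  have hrank : tensorRank T = R := by
    refine le_antisymm (Nat.sInf_le ⟨A, B, C, hT⟩) (le_csInf ⟨R, A, B, C, hT⟩ ?_)
    rintro R' ⟨A', B', C', hT'⟩
    by_contra! hlt
    obtain ⟨A₁, B₁, C₁, h₁, h0⟩ := exists_ofFactors_eq_of_le hlt.le A' B' C'
    obtain ⟨σ, α, β, γ, hσ⟩ := hkr (hT'.trans h₁)
    have hr := hσ ⟨R', hlt⟩
    rw [h0 ⟨R', hlt⟩ le_rfl] at hr
    have hγ : γ ⟨R', hlt⟩ ≠ 0 := fun h => by simp [h] at hr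
    have hcol : C.col (σ ⟨R', hlt⟩) = 0 := (smul_eq_zero.mp hr.2.2.2.symm).resolve_left hγ
    have h3 := (kRank_spec A).1
    have h4 := (kRank_spec B).1
    have := (kRank_spec C).2 {σ ⟨R', hlt⟩} (Pi.single (σ ⟨R', hlt⟩) 1) (by simp; omega)
      (fun i hi => by
        simp only [Finset.mem_singleton] at hi
        simp [hi]) (by rw [mulVec_single_one, hcol])
    simpa using congrFun this (σ ⟨R', hlt⟩)
  refine ⟨⟨hT, hrank⟩, fun R' A₁ A₂ B₁ B₂ C₁ C₂ h₁ h₂ => ?_⟩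
  obtain rfl : R' = R := h₁.2.symm.trans hrank
  obtain ⟨σ, α, β, γ, hσ⟩ := hkr h₁.1
  obtain ⟨τ, α', β', γ', hτ⟩ := hkr h₂.1
  refine ⟨τ.trans σ.symm, fun r => α' r / α (σ.symm (τ r)), fun r => β' r / β (σ.symm (τ r)),
    fun r => γ' r / γ (σ.symm (τ r)), fun r => ?_⟩
  obtain ⟨h0, hα, hβ, hγ⟩ := hσ (σ.symm (τ r))
  obtain ⟨h0', hα', hβ', hγ'⟩ := hτ r
  rw [Equiv.apply_symm_apply] at hα hβ hγ
  have ne1 : α (σ.symm (τ r)) ≠ 0 := fun h => by simp [h] at h0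
  have ne2 : β (σ.symm (τ r)) ≠ 0 := fun h => by simp [h] at h0
  have ne3 : γ (σ.symm (τ r)) ≠ 0 := fun h => by simp [h] at h0
  refine ⟨?_, fun i => ?_, fun i => ?_, fun i => ?_⟩
  · rw [div_mul_div_comm, div_mul_div_comm, h0, h0', div_one]
  · have e1 := congrFun hα i
    have e2 := congrFun hα' i
    simp only [col_apply, Pi.smul_apply, smul_eq_mul] at e1 e2
    rw [e2, Equiv.trans_apply, e1]; field_simp
  · have e1 := congrFun hβ i
    have e2 := congrFun hβ' i
    simp only [col_apply, Pi.smul_apply, smul_eq_mul] at e1 e2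
    rw [e2, Equiv.trans_apply, e1]; field_simp
  · have e1 := congrFun hγ i
    have e2 := congrFun hγ' i
    simp only [col_apply, Pi.smul_apply, smul_eq_mul] at e1 e2
    rw [e2, Equiv.trans_apply, e1]; field_simp

/-! ### Minors of slices and products of coefficients. -/

/-- Cauchy–Binet before collecting terms: multilinear expansion in the rows, over all maps rather
than ordered index sets. -/
theorem det_mul_eq_sum {m n : Type*} [Fintype m] [DecidableEq m] [Fintype n] [DecidableEq n]
    (M : Matrix m n ℝ) (N : Matrix n m ℝ) :
    (M * N).det = ∑ h : m → n, (∏ i, M i (h i)) * (N.submatrix h id).det := by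
  have h1 : (M * N).det =
      (detRowAlternating (n := m) (R := ℝ)).toMultilinearMap fun i => ∑ r, M i r • N r := by
    change detRowAlternating (M * N) = detRowAlternating _
    congr 1
    ext i j
    simp [Matrix.mul_apply]
  rw [h1, MultilinearMap.map_sum]
  refine Finset.sum_congr rfl fun h _ => ?_
  exact AlternatingMap.map_smul_univ _ _ _

/-- The indicator vector of a set of terms. -/
def ind {R : ℕ} (s : Finset (Fin R)) (r : Fin R) : ℝ := if r ∈ s then 1 else 0

theorem prod_ind {R : ℕ} {s t : Finset (Fin R)} (h : t.card = s.card) :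
    ∏ r ∈ t, ind s r = if t = s then 1 else 0 := by
  classical
  split_ifs with hts
  · subst hts
    exact Finset.prod_eq_one fun r hr => if_pos hr
  · have : ∃ r ∈ t, r ∉ s := by
      by_contra! hsub
      exact hts (Finset.eq_of_subset_of_card_le hsub h.ge)
    obtain ⟨r, hr, hrs⟩ := this
    exact Finset.prod_eq_zero hr (if_neg hrs)

/-- A minor of `M D N` with `D` diagonal is a combination of products of entries of `D`. -/
theorem det_mul_diagonal_mul {m R : ℕ} (M : Matrix (Fin m) (Fin R) ℝ)
    (N : Matrix (Fin R) (Fin m) ℝ) (d : Fin R → ℝ) :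
    (M * diagonal d * N).det = ∑ s : {s : Finset (Fin R) // s.card = m},
      (∏ r ∈ s.1, d r) * (M * diagonal (ind s.1) * N).det := by
  classical
  simp_rw [det_mul_eq_sum, mul_diagonal, Finset.mul_sum]
  rw [Finset.sum_comm]
  refine Finset.sum_congr rfl fun h _ => ?_
  -- An injective map contributes only to the set that is its image; any other map repeats a row of
  -- N.
  by_cases hinj : Function.Injective h
  · rw [Finset.sum_eq_single ⟨Finset.univ.image h, by
      rw [Finset.card_image_of_injective _ hinj, Finset.card_univ, Fintype.card_fin]⟩]
    · rw [Finset.prod_image fun i _ j _ hij => hinj hij, Finset.prod_mul_distrib,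
        Finset.prod_mul_distrib,
        Finset.prod_eq_one (f := fun i => ind (Finset.univ.image h) (h i))
          fun i _ => if_pos (Finset.mem_image_of_mem h (Finset.mem_univ i))]
      ring
    · intro s _ hs
      have : ∃ i, h i ∉ s.1 := by
        by_contra! hsub
        refine hs (Subtype.ext (Finset.eq_of_subset_of_card_le ?_ ?_).symm)
        · intro r hr
          obtain ⟨i, -, rfl⟩ := Finset.mem_image.mp hr
          exact hsub i
        · rw [Finset.card_image_of_injective _ hinj, Finset.card_univ, Fintype.card_fin, s.2]
      obtain ⟨i, hi⟩ := this
      rw [Finset.prod_eq_zero (Finset.mem_univ i) (by rw [ind, if_neg hi, mul_zero])]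
      simp
    · simp
  · obtain ⟨i, j, hij, hne⟩ : ∃ i j, h i = h j ∧ i ≠ j := by
      simpa [Function.Injective] using hinj
    have h0 : (N.submatrix h id).det = 0 := det_zero_of_row_eq hne (by ext; simp [hij])
    simp [h0]

/-- The minor with rows and columns given by a tuple of positions. -/
def tupleMinor {I J μ : ℕ} (X : Matrix (Fin I) (Fin J) ℝ) (e : Fin μ → Fin (I * J)) : ℝ :=
  (X.submatrix (fun a => (e a).divNat) (fun a => (e a).modNat)).det

/-- The coefficients in the Cauchy–Binet expansion do not depend on d, so they can be read off at
indicator vectors. -/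
theorem tupleMinor_slice {I J R μ : ℕ} (A : Matrix (Fin I) (Fin R) ℝ)
    (B : Matrix (Fin J) (Fin R) ℝ) (d : Fin R → ℝ) (e : Fin μ → Fin (I * J)) :
    tupleMinor (slice A B d) e = ∑ s : {s : Finset (Fin R) // s.card = μ},
      (∏ r ∈ s.1, d r) * tupleMinor (slice A B (ind s.1)) e := by
  have h : ∀ d, (slice A B d).submatrix (fun a => (e a).divNat) (fun a => (e a).modNat) =
      A.submatrix (fun a => (e a).divNat) id * diagonal d *
        Bᵀ.submatrix id (fun a => (e a).modNat) := fun d => rfl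
  simp_rw [tupleMinor, h]
  exact det_mul_diagonal_mul _ _ _

/-- Converse of the expansion: selectors F, G for s turn the slice X into a diagonal matrix, so det
(F X Gᵀ) is the desired product, and expanding F and G by multilinearity writes it in minors of X.
-/
theorem exists_sum_tupleMinor {I J R a b μ : ℕ} {A : Matrix (Fin I) (Fin R) ℝ}
    {B : Matrix (Fin J) (Fin R) ℝ} (hA : ColIndep A a) (hB : ColIndep B b) (s : Finset (Fin R))
    (hs : s.card = μ) (ha : a ≤ R) (hsa : μ ≤ a) (hab : R + μ ≤ a + b) :
    ∃ ω : (Fin μ → Fin (I * J)) → ℝ, ∀ d : Fin R → ℝ,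
      ∑ e, ω e * tupleMinor (slice A B d) e = ∏ r ∈ s, d r := by
  classical
  obtain ⟨F, G, hFG⟩ := exists_selectors hA hB s ha (hs.trans_le hsa) (by omega)
  let φ : Fin μ ≃ s := (Fintype.equivFinOfCardEq (by simpa using hs)).symm
  let F' := F.submatrix φ id
  let G' := G.submatrix φ id
  refine ⟨fun e => (∏ i, F' i (e i).divNat) * ∏ i, G' i (e i).modNat, fun d => ?_⟩
  set X := slice A B d
  have h1 : (F' * (X * G'ᵀ)).det = ∏ r ∈ s, d r := by
    have h2 : F' * (X * G'ᵀ) = (F * X * Gᵀ).submatrix φ φ := by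
      rw [← Matrix.mul_assoc]; rfl
    rw [h2, det_submatrix_equiv_self, hFG, det_diagonal, Finset.prod_coe_sort s d]
  rw [← h1, det_mul_eq_sum]
  have h3 : ∀ f : Fin μ → Fin I, ((X * G'ᵀ).submatrix f id).det =
      ∑ g : Fin μ → Fin J, (∏ i, G' i (g i)) * (X.submatrix f g).det := by
    intro f
    rw [← det_transpose, show ((X * G'ᵀ).submatrix f id)ᵀ = G' * (X.submatrix f id)ᵀ by
      ext i j; simp [Matrix.mul_apply, mul_comm], det_mul_eq_sum]
    refine Finset.sum_congr rfl fun g _ => ?_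
    rw [← det_transpose (X.submatrix f g)]; rfl
  simp_rw [h3, Finset.mul_sum]
  rw [← Fintype.sum_prod_type' (f := fun (f : Fin μ → Fin I) (g : Fin μ → Fin J) =>
    (∏ i, F' i (f i)) * ((∏ i, G' i (g i)) * (X.submatrix f g).det))]
  refine Fintype.sum_equiv (((Equiv.refl (Fin μ)).arrowCongr finProdFinEquiv.symm).trans
    (Equiv.arrowProdEquivProdArrow (Fin μ) (fun _ => Fin I) (fun _ => Fin J))) _ _ fun e => ?_
  rw [mul_assoc]
  rfl

/-- The matrix of coefficients of the minors as combinations of products is injective. -/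
theorem tupleMinor_injective {I J R a b μ : ℕ} {A : Matrix (Fin I) (Fin R) ℝ}
    {B : Matrix (Fin J) (Fin R) ℝ} (hA : ColIndep A a) (hB : ColIndep B b)
    (ha : a ≤ R) (hsa : μ ≤ a) (hab : R + μ ≤ a + b) (v : {s : Finset (Fin R) // s.card = μ} → ℝ)
    (hv : ∀ e : Fin μ → Fin (I * J), ∑ s, tupleMinor (slice A B (ind s.1)) e * v s = 0) :
    v = 0 := by
  classical
  ext t
  obtain ⟨ω, hω⟩ := exists_sum_tupleMinor hA hB t.1 t.2 ha hsa hab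
  have h1 : ∑ e, ω e * ∑ s, tupleMinor (slice A B (ind s.1)) e * v s = 0 := by
    simp_rw [hv, mul_zero, Finset.sum_const_zero]
  simp_rw [Finset.mul_sum, ← mul_assoc] at h1
  rw [Finset.sum_comm] at h1
  simp_rw [← Finset.sum_mul, hω] at h1
  rw [Finset.sum_eq_single t] at h1
  · rw [prod_ind rfl, if_pos rfl, one_mul] at h1
    exact h1
  · intro s _ hst
    rw [prod_ind (t.2.trans s.2.symm), if_neg fun h => hst (Subtype.ext h.symm), zero_mul]
  · simp

/-! ### Polynomial identities on a grid. -/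

/-- The grid `{0, …, D} ^ k`. -/
def gridPoint (D k : ℕ) (p : Fin ((D + 1) ^ k)) (i : Fin k) : ℝ :=
  ((p / (D + 1) ^ (i : ℕ) % (D + 1) : ℕ) : ℝ)

/-- Each variable takes D + 1 values, more than its degree. Hence weights on the grid can stand for
linear functionals on polynomials of degree at most D. -/
theorem eval_eq_zero_of_grid {D k : ℕ} (F : MvPolynomial (Fin k) ℝ) (hF : F.totalDegree ≤ D)
    (h : ∀ p, MvPolynomial.eval (gridPoint D k p) F = 0) : F = 0 := by
  classical
  refine MvPolynomial.eq_zero_of_eval_zero_at_prod_finset F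
    (fun _ => (Finset.range (D + 1)).image (Nat.cast : ℕ → ℝ)) (fun i => ?_) fun x hx => ?_
  · rw [Finset.card_image_of_injective _ Nat.cast_injective, Finset.card_range]
    exact Nat.lt_succ_of_le ((MvPolynomial.degreeOf_le_totalDegree F i).trans hF)
  · simp only [Finset.mem_image, Finset.mem_range] at hx
    choose f hf hfx using hx
    have := h (finFunctionFinEquiv fun i => ⟨f i, hf i⟩)
    convert! this using 3
    ext i
    have h2 := congrArg Fin.val (congrFun
      (finFunctionFinEquiv.symm_apply_apply fun i => (⟨f i, hf i⟩ : Fin (D + 1))) i)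
    rw [finFunctionFinEquiv_symm_apply_val] at h2
    rw [gridPoint, h2, hfx]

/-- The polynomial of a linear form. -/
noncomputable def linPoly {k : ℕ} (v : Fin k → ℝ) : MvPolynomial (Fin k) ℝ :=
  ∑ i, MvPolynomial.C (v i) * MvPolynomial.X i

theorem eval_linPoly {k : ℕ} (v x : Fin k → ℝ) : MvPolynomial.eval x (linPoly v) = v ⬝ᵥ x := by
  simp [linPoly, dotProduct]

theorem totalDegree_linPoly_le {k : ℕ} (v : Fin k → ℝ) : (linPoly v).totalDegree ≤ 1 :=
  MvPolynomial.totalDegree_finsetSum_le fun i _ =>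
    (MvPolynomial.totalDegree_mul _ _).trans (by simp)

theorem totalDegree_prod_linPoly_le {k R : ℕ} (C : Matrix (Fin k) (Fin R) ℝ) (s : Finset (Fin R)) :
    (∏ r ∈ s, linPoly (C.col r)).totalDegree ≤ s.card :=
  (MvPolynomial.totalDegree_finsetProd _ _).trans ((Finset.sum_le_sum fun _ _ =>
    totalDegree_linPoly_le _).trans (by simp))

/-- Relations between products of linear forms that hold on a large grid hold everywhere. -/
theorem sum_prod_eq_of_grid {R k μ : ℕ} (C : Matrix (Fin k) (Fin R) ℝ) (l : Fin k → ℝ)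
    (β : {s : Finset (Fin R) // s.card = μ} → ℝ) (γ : {s : Finset (Fin R) // s.card = μ + 1} → ℝ)
    (h : ∀ p, ∑ s, β s * ((l ⬝ᵥ gridPoint (μ + 1) k p) *
        ∏ r ∈ s.1, (Cᵀ *ᵥ gridPoint (μ + 1) k p) r) =
      ∑ s, γ s * ∏ r ∈ s.1, (Cᵀ *ᵥ gridPoint (μ + 1) k p) r) (x : Fin k → ℝ) :
    ∑ s, β s * ((l ⬝ᵥ x) * ∏ r ∈ s.1, (Cᵀ *ᵥ x) r) = ∑ s, γ s * ∏ r ∈ s.1, (Cᵀ *ᵥ x) r := by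
  let F : MvPolynomial (Fin k) ℝ :=
    ∑ s, MvPolynomial.C (β s) * (linPoly l * ∏ r ∈ s.1, linPoly (C.col r)) -
      ∑ s, MvPolynomial.C (γ s) * ∏ r ∈ s.1, linPoly (C.col r)
  have hev : ∀ x, MvPolynomial.eval x F =
      ∑ s, β s * ((l ⬝ᵥ x) * ∏ r ∈ s.1, (Cᵀ *ᵥ x) r) -
        ∑ s, γ s * ∏ r ∈ s.1, (Cᵀ *ᵥ x) r := by
    intro x
    simp only [F, map_sub, map_sum, map_mul, map_prod, MvPolynomial.eval_C, eval_linPoly]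
    rfl
  have hF : F = 0 := by
    refine eval_eq_zero_of_grid (D := μ + 1) F ?_ fun p => by rw [hev, h, sub_self]
    refine (MvPolynomial.totalDegree_sub _ _).trans (max_le ?_ ?_)
    · refine MvPolynomial.totalDegree_finsetSum_le fun s _ => ?_
      refine (MvPolynomial.totalDegree_mul _ _).trans ?_
      rw [MvPolynomial.totalDegree_C, zero_add, add_comm μ]
      refine (MvPolynomial.totalDegree_mul _ _).trans (add_le_add (totalDegree_linPoly_le l) ?_)
      exact (totalDegree_prod_linPoly_le C s.1).trans_eq s.2
    · refine MvPolynomial.totalDegree_finsetSum_le fun s _ => ?_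
      refine (MvPolynomial.totalDegree_mul _ _).trans ?_
      rw [MvPolynomial.totalDegree_C, zero_add]
      exact (totalDegree_prod_linPoly_le C s.1).trans_eq s.2
  have := hev x
  rw [hF, map_zero] at this
  exact sub_eq_zero.mp this.symm

/-! ### Orthogonal complements. -/

theorem IsOrthBasis.injective {m n d : ℕ} {M : Matrix (Fin m) (Fin n) ℝ}
    {N : Matrix (Fin m) (Fin d) ℝ} (h : IsOrthBasis M N) (u : Fin d → ℝ) (hu : N *ᵥ u = 0) :
    u = 0 :=
  mulVec_injective_iff.mpr h.1 (hu.trans (mulVec_zero N).symm)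

theorem IsOrthBasis.mem_iff {m n d : ℕ} {M : Matrix (Fin m) (Fin n) ℝ}
    {N : Matrix (Fin m) (Fin d) ℝ} (h : IsOrthBasis M N) (w : Fin m → ℝ) :
    Mᵀ *ᵥ w = 0 ↔ ∃ u, N *ᵥ u = w := by
  have h2 := h.2
  rw [← Matrix.range_mulVecLin] at h2
  have := SetLike.ext_iff.mp h2 w
  rw [LinearMap.mem_ker, LinearMap.mem_range] at this
  exact this.symm

/-- The double complement is the column space, so two calls of `orth` produce a basis of it. -/
theorem IsOrthBasis.mem_iff_of_orthBasis {m n d d' : ℕ} {M : Matrix (Fin m) (Fin n) ℝ}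
    {N : Matrix (Fin m) (Fin d) ℝ} {V : Matrix (Fin m) (Fin d') ℝ} (h : IsOrthBasis M N)
    (h' : IsOrthBasis N V) (w : Fin m → ℝ) : (∃ u, V *ᵥ u = w) ↔ ∃ t, M *ᵥ t = w := by
  rw [← h'.mem_iff]
  constructor
  · intro hw
    refine exists_mulVec_eq M w fun w' hw' => ?_
    obtain ⟨u, rfl⟩ := (h.mem_iff w').mp hw'
    rw [dotProduct_mulVec, ← mulVec_transpose, hw, zero_dotProduct]
  · rintro ⟨t, rfl⟩
    refine dotProduct_eq_zero _ fun u => ?_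
    have := (h.mem_iff (N *ᵥ u)).mpr ⟨u, rfl⟩
    rw [mulVec_transpose, ← dotProduct_mulVec, dotProduct_comm, dotProduct_mulVec,
      ← mulVec_transpose, this, zero_dotProduct]

theorem dotProduct_mulVec_self_eq_zero {m n : Type*} [Fintype m] [Fintype n] {M : Matrix m n ℝ}
    {u : n → ℝ} (h : (Mᵀ * M) *ᵥ u = 0) : M *ᵥ u = 0 := by
  rw [← dotProduct_self_eq_zero, dotProduct_mulVec, ← mulVec_transpose, mulVec_mulVec, h,
    zero_dotProduct]

theorem diagonal_mulVec_eq_zero {n : Type*} [Fintype n] [DecidableEq n] {δ u : n → ℝ}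
    (hδ : ∀ i, δ i ≠ 0) (h : diagonal δ *ᵥ u = 0) : u = 0 := by
  ext i
  have := congrFun h i
  rw [mulVec_diagonal, Pi.zero_apply] at this
  exact (mul_eq_zero.mp this).resolve_left (hδ i)

/-! ### Pencils in factored form. -/

section GEVD

variable {n : ℕ} {Q : Type*} [Fintype Q]

/-- The generalized eigenvalue decomposition of a pencil given in factored form. -/
theorem gevd_of_isUnit {E : Matrix Q (Fin n) ℝ}
    (hE : ∀ u, E *ᵥ u = 0 → u = 0) {Y : Matrix (Fin n) (Fin n) ℝ} (hY : IsUnit Y)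
    {δ₁ δ₂ : Fin n → ℝ} (hδ : ∀ i, δ₂ i ≠ 0) (hr : ∀ i j, i ≠ j → δ₁ i * δ₂ j ≠ δ₁ j * δ₂ i)
    {M₁ M₂ : Matrix Q (Fin n) ℝ} (h₁ : M₁ = E * diagonal δ₁ * Y) (h₂ : M₂ = E * diagonal δ₂ * Y) :
    (∃ X d, IsGEVD (M₂ᵀ * M₁) (M₂ᵀ * M₂) X d) ∧ ∀ X d, IsGEVD (M₂ᵀ * M₁) (M₂ᵀ * M₂) X d →
      ∀ i, ∃ j c, c ≠ 0 ∧ ∀ i', (Y * X) i' j = if i' = i then c else 0 := by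
  have hYinj : ∀ u, Y *ᵥ u = 0 → u = 0 := fun u hu =>
    mulVec_injective_iff_isUnit.mpr hY (hu.trans (mulVec_zero Y).symm)
  have hYtinj : ∀ u, Yᵀ *ᵥ u = 0 → u = 0 := fun u hu =>
    mulVec_injective_iff_isUnit.mpr ((isUnit_transpose (A := Y)).mpr hY)
      (hu.trans (mulVec_zero Yᵀ).symm)
  have hM₂ : ∀ u, M₂ *ᵥ u = 0 → u = 0 := by
    intro u hu
    rw [h₂, ← mulVec_mulVec, ← mulVec_mulVec] at hu
    exact hYinj _ (diagonal_mulVec_eq_zero hδ (hE _ hu))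
  have hN : IsUnit (M₂ᵀ * M₂) := by
    rw [← mulVec_injective_iff_isUnit]
    intro u v huv
    rw [← sub_eq_zero]
    apply hM₂
    apply dotProduct_mulVec_self_eq_zero
    rw [mulVec_sub]
    exact sub_eq_zero.mpr huv
  have hYu : IsUnit Y.det := (isUnit_iff_isUnit_det Y).mp hY
  refine ⟨⟨Y⁻¹, fun i => δ₁ i / δ₂ i, hN, ?_, ?_⟩, ?_⟩
  · exact (isUnit_nonsing_inv_iff).mpr hY
  · have e1 : M₁ * Y⁻¹ = E * diagonal δ₁ := by
      rw [h₁, Matrix.mul_assoc, mul_nonsing_inv _ hYu, Matrix.mul_one]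
    have e2 : M₂ * Y⁻¹ = E * diagonal δ₂ := by
      rw [h₂, Matrix.mul_assoc, mul_nonsing_inv _ hYu, Matrix.mul_one]
    rw [Matrix.mul_assoc, e1, Matrix.mul_assoc M₂ᵀ M₂, e2, Matrix.mul_assoc M₂ᵀ,
      Matrix.mul_assoc E, diagonal_mul_diagonal]
    congr 4
    ext i
    have := hδ i
    field_simp
  · rintro X d ⟨-, hX, hXd⟩ i
    have hZu : IsUnit (Y * X) := hY.mul hX
    -- On the left of the eigenvector equation stand the injective factors Yᵀ, diag(δ₂) and EᵀE.
    -- Cancelling them leaves scalar equations for the entries of Y X.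
    have key : ∀ i' j, (δ₁ i' - δ₂ i' * d j) * (Y * X) i' j = 0 := by
      intro i' j
      let w : Fin n → ℝ := fun i' => (δ₁ i' - δ₂ i' * d j) * (Y * X) i' j
      have h0 : Yᵀ *ᵥ (diagonal δ₂ *ᵥ ((Eᵀ * E) *ᵥ w)) = 0 := by
        have hw : w = (diagonal δ₁ * (Y * X) - diagonal δ₂ * (Y * X) * diagonal d).col j := by
          ext i'
          simp only [w, col_apply, Matrix.sub_apply, diagonal_mul, mul_diagonal]
          ring
        have h3 : Yᵀ * (diagonal δ₂ * ((Eᵀ * E) *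
            (diagonal δ₁ * (Y * X) - diagonal δ₂ * (Y * X) * diagonal d))) = 0 := by
          have e1 : Yᵀ * (diagonal δ₂ * ((Eᵀ * E) * (diagonal δ₁ * (Y * X)))) =
              M₂ᵀ * M₁ * X := by
            rw [h₁, h₂]
            simp only [transpose_mul, diagonal_transpose, Matrix.mul_assoc]
          have e2 : Yᵀ * (diagonal δ₂ * ((Eᵀ * E) * (diagonal δ₂ * (Y * X) * diagonal d))) =
              M₂ᵀ * M₂ * X * diagonal d := by
            rw [h₂]
            simp only [transpose_mul, diagonal_transpose, Matrix.mul_assoc]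
          rw [Matrix.mul_sub, Matrix.mul_sub, Matrix.mul_sub, e1, e2, hXd, sub_self]
        rw [hw, mulVec_mulVec, mulVec_mulVec, ← mulVec_single_one, mulVec_mulVec]
        rw [Matrix.mul_assoc, Matrix.mul_assoc, h3, zero_mulVec]
      have h1 := diagonal_mulVec_eq_zero hδ (hYtinj _ h0)
      exact congrFun (hE _ (dotProduct_mulVec_self_eq_zero h1)) i'
    -- Y X is invertible, so row i has a nonzero entry; its eigenvalue is δ₁ i / δ₂ i, and the other
    -- ratios differ, so the rest of that column is zero.
    obtain ⟨j, hj⟩ : ∃ j, (Y * X) i j ≠ 0 := by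
      by_contra! hrow
      have := (isUnit_iff_isUnit_det _).mp hZu
      rw [det_eq_zero_of_row_eq_zero i hrow] at this
      exact not_isUnit_zero this
    refine ⟨j, _, hj, fun i' => ?_⟩
    split_ifs with h
    · rw [h]
    · by_contra h'
      have e1 := (mul_eq_zero.mp (key i j)).resolve_right hj
      have e2 := (mul_eq_zero.mp (key i' j)).resolve_right h'
      refine hr i' i h ?_
      linear_combination δ₂ i * e2 - δ₂ i' * e1

/-- Injectivity of both Y and Yᵀ makes Y square, and enumerating S reduces to the invertible case.
-/
theorem gevd_of_factorization {S : Type*} [Fintype S] [DecidableEq S] {E : Matrix Q S ℝ}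
    (hE : ∀ u, E *ᵥ u = 0 → u = 0) {Y : Matrix S (Fin n) ℝ} (hY : ∀ u, Y *ᵥ u = 0 → u = 0)
    (hY' : ∀ u, Yᵀ *ᵥ u = 0 → u = 0)
    {δ₁ δ₂ : S → ℝ} (hδ : ∀ i, δ₂ i ≠ 0) (hr : ∀ i j, i ≠ j → δ₁ i * δ₂ j ≠ δ₁ j * δ₂ i)
    {M₁ M₂ : Matrix Q (Fin n) ℝ} (h₁ : M₁ = E * diagonal δ₁ * Y) (h₂ : M₂ = E * diagonal δ₂ * Y) :
    Fintype.card S = n ∧ (∃ X d, IsGEVD (M₂ᵀ * M₁) (M₂ᵀ * M₂) X d) ∧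
      ∀ X d, IsGEVD (M₂ᵀ * M₁) (M₂ᵀ * M₂) X d →
      ∀ i, ∃ j c, c ≠ 0 ∧ ∀ i', (Y * X) i' j = if i' = i then c else 0 := by
  have hcard : Fintype.card S = n := by
    have i1 := LinearMap.finrank_le_finrank_of_injective (f := Y.mulVecLin)
      ((injective_iff_map_eq_zero _).mpr hY)
    have i2 := LinearMap.finrank_le_finrank_of_injective (f := Yᵀ.mulVecLin)
      ((injective_iff_map_eq_zero _).mpr hY')
    simp only [Module.finrank_fintype_fun_eq_card, Fintype.card_fin] at i1 i2
    omega
  let e : Fin n ≃ S := (Fintype.equivFinOfCardEq hcard).symm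
  have hYe : IsUnit (Y.submatrix e id) := by
    refine mulVec_injective_iff_isUnit.mp
      ((injective_iff_map_eq_zero (Y.submatrix e id).mulVecLin).mpr fun u hu => ?_)
    apply hY
    ext s
    have := congrFun hu (e.symm s)
    simpa [mulVec] using this
  have hfac : ∀ δ : S → ℝ, E * diagonal δ * Y =
      E.submatrix id e * diagonal (δ ∘ e) * Y.submatrix e id := by
    intro δ
    ext q j
    rw [Matrix.mul_apply, Matrix.mul_apply, ← Equiv.sum_comp e]
    simp [mul_diagonal]
  obtain ⟨hex, hall⟩ := gevd_of_isUnit (E := E.submatrix id e) (Y := Y.submatrix e id)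
    (δ₁ := δ₁ ∘ e) (δ₂ := δ₂ ∘ e) (M₁ := M₁) (M₂ := M₂) (fun u hu => by
      have : E *ᵥ (u ∘ e.symm) = 0 := by
        rw [← hu]
        ext q
        simp only [mulVec, dotProduct]
        rw [← Equiv.sum_comp e]
        simp
      have h0 := hE _ this
      ext i
      have := congrFun h0 (e i)
      simpa using this) hYe (fun i => hδ _) (fun i j hij => hr _ _ fun h => hij (e.injective h))
    (by rw [h₁, hfac]) (by rw [h₂, hfac])
  refine ⟨hcard, hex, fun X d hX s => ?_⟩
  obtain ⟨j, c, hc, hj⟩ := hall X d hX (e.symm s)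
  refine ⟨j, c, hc, fun s' => ?_⟩
  have := hj (e.symm s')
  simp only [EmbeddingLike.apply_eq_iff_eq] at this
  rw [← this, Matrix.mul_apply, Matrix.mul_apply]
  simp

end GEVD

/-! ### Recovery of the normals. -/

/-- The product of the linear forms `⟨c_r, x⟩` over `r ∈ s`. -/
def prodForm {R k : ℕ} (C : Matrix (Fin k) (Fin R) ℝ) (s : Finset (Fin R)) (x : Fin k → ℝ) : ℝ :=
  ∏ r ∈ s, (Cᵀ *ᵥ x) r

/-- A combination of point evaluations that kills all products of `s.card + 1` of the forms
multiplies with linear forms on `prodForm C s` by evaluation at the normal of `s`. -/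
theorem sum_linear_mul_prodForm {R k P : ℕ} {C : Matrix (Fin k) (Fin R) ℝ} {s : Finset (Fin R)}
    {y : Fin P → Fin k → ℝ} {w : Fin P → ℝ}
    (hw : ∀ t : Finset (Fin R), t.card = s.card + 1 → ∑ p, w p * prodForm C t (y p) = 0)
    {x : Fin k → ℝ} (hx : ∀ v, v ⬝ᵥ x = 0 → ∃ l, (∀ r ∈ s, l r = 0) ∧ C *ᵥ l = v)
    {l : Fin k → ℝ} (hl : l ⬝ᵥ x ≠ 0) (v : Fin k → ℝ) :
    ∑ p, w p * ((v ⬝ᵥ y p) * prodForm C s (y p)) =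
      (v ⬝ᵥ x) * ((∑ p, w p * ((l ⬝ᵥ y p) * prodForm C s (y p))) / (l ⬝ᵥ x)) := by
  classical
  obtain ⟨m, hm, hmv⟩ := hx (v - (v ⬝ᵥ x / l ⬝ᵥ x) • l) (by
    rw [sub_dotProduct, smul_dotProduct, smul_eq_mul, div_mul_cancel₀ _ hl, sub_self])
  -- Modulo l, every linear form is a combination of columns outside s. Multiplying `prodForm C s`
  -- by such a column gives a product of s.card + 1 forms, which w kills; so v matters only through
  -- v ⬝ᵥ x.
  have h0 : ∑ p, w p * (((C *ᵥ m) ⬝ᵥ y p) * prodForm C s (y p)) = 0 := by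
    have h1 : ∀ p, w p * (((C *ᵥ m) ⬝ᵥ y p) * prodForm C s (y p)) =
        ∑ r, m r * (w p * ((Cᵀ *ᵥ y p) r * prodForm C s (y p))) := by
      intro p
      have : (C *ᵥ m) ⬝ᵥ y p = ∑ r, m r * (Cᵀ *ᵥ y p) r := by
        rw [mulVec_transpose, dotProduct_comm, dotProduct_mulVec, dotProduct_comm]
        rfl
      rw [this, Finset.sum_mul, Finset.mul_sum]
      exact Finset.sum_congr rfl fun r _ => by ring
    simp_rw [h1]
    rw [Finset.sum_comm]
    refine Finset.sum_eq_zero fun r _ => ?_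
    rw [← Finset.mul_sum]
    by_cases hr : r ∈ s
    · rw [hm r hr, zero_mul]
    · have := hw (insert r s) (Finset.card_insert_of_notMem hr)
      simp_rw [prodForm, Finset.prod_insert hr] at this
      simp_rw [prodForm]
      rw [this, mul_zero]
  rw [hmv] at h0
  simp_rw [sub_dotProduct, smul_dotProduct, sub_mul, mul_sub, smul_eq_mul] at h0
  rw [Finset.sum_sub_distrib, sub_eq_zero] at h0
  rw [h0, mul_div_assoc', Finset.mul_sum, Finset.sum_div]
  exact Finset.sum_congr rfl fun p _ => by ring

section Core

variable {R k μ n n' d₁ : ℕ} {C : Matrix (Fin k) (Fin R) ℝ}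
  {x : {s : Finset (Fin R) // s.card = μ} → Fin k → ℝ} {l₁ l₂ : Fin k → ℝ}
  {W : Matrix (Fin ((μ + 1 + 1) ^ k)) (Fin n) ℝ}

/-- The functionals `w ↦ w (l · prodForm C s)`, up to normalization, on the span of the columns
of `W`. -/
noncomputable def residues (C : Matrix (Fin k) (Fin R) ℝ)
    (x : {s : Finset (Fin R) // s.card = μ} → Fin k → ℝ) (l : Fin k → ℝ)
    (W : Matrix (Fin ((μ + 1 + 1) ^ k)) (Fin n) ℝ) :
    Matrix {s : Finset (Fin R) // s.card = μ} (Fin n) ℝ :=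
  Matrix.of fun s c => (∑ p, W p c * ((l ⬝ᵥ gridPoint (μ + 1) k p) *
    prodForm C s.1 (gridPoint (μ + 1) k p))) / (l ⬝ᵥ x s)

/-- A relation between the residues means that l₂ · ∑ β_s / (l₂ · x_s) P_s is killed by all
annihilators of the products of μ + 1 forms. So it lies in their span, first on the grid and then as
a polynomial, and evaluation at x_s isolates β_s. -/
theorem residues_transpose_injective
    (hx : ∀ s r, (Cᵀ *ᵥ x s) r = 0 ↔ r ∉ s.1) (hl : ∀ s, l₂ ⬝ᵥ x s ≠ 0)
    (hW : ∀ w, (∀ t : Finset (Fin R), t.card = μ + 1 →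
      ∑ p, w p * prodForm C t (gridPoint (μ + 1) k p) = 0) → ∃ u, W *ᵥ u = w)
    (β : {s : Finset (Fin R) // s.card = μ} → ℝ) (hβ : (residues C x l₂ W)ᵀ *ᵥ β = 0) :
    β = 0 := by
  classical
  let y := gridPoint (μ + 1) k
  let g : Fin ((μ + 1 + 1) ^ k) → ℝ := fun p =>
    ∑ s, β s / (l₂ ⬝ᵥ x s) * ((l₂ ⬝ᵥ y p) * prodForm C s.1 (y p))
  let Φ : Matrix (Fin ((μ + 1 + 1) ^ k)) {s : Finset (Fin R) // s.card = μ + 1} ℝ :=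
    Matrix.of fun p t => prodForm C t.1 (y p)
  have hgW : g ᵥ* W = 0 := by
    ext c
    rw [← hβ]
    simp only [vecMul, mulVec, dotProduct, g, residues, transpose_apply, Matrix.of_apply,
      Finset.sum_mul, Finset.sum_div]
    rw [Finset.sum_comm]
    exact Finset.sum_congr rfl fun s _ => Finset.sum_congr rfl fun p _ => by
      simp only [y]; ring
  obtain ⟨γ, hγ⟩ := exists_mulVec_eq Φ g (fun w hw => by
    obtain ⟨u, rfl⟩ := hW w fun t ht => by
      have := congrFun hw ⟨t, ht⟩
      rw [← Pi.zero_apply (M := fun _ => ℝ), ← this]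
      simp only [Φ, mulVec, dotProduct, transpose_apply, Matrix.of_apply]
      exact Finset.sum_congr rfl fun p _ => mul_comm _ _
    rw [dotProduct_mulVec, hgW, zero_dotProduct])
  have hall := sum_prod_eq_of_grid C l₂ (fun s => β s / (l₂ ⬝ᵥ x s)) γ fun p => by
    have := congrFun hγ p
    rw [mulVec, dotProduct] at this
    refine this.symm.trans (Finset.sum_congr rfl fun t _ => mul_comm _ _)
  ext s
  have hs := hall (x s)
  -- At x s the product over t vanishes unless t ⊆ s, which leaves only t = s among sets of size μ
  -- and none of size μ + 1.
  have hz : ∀ t : Finset (Fin R), (∃ r ∈ t, r ∉ s.1) → ∏ r ∈ t, (Cᵀ *ᵥ x s) r = 0 := by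
    rintro t ⟨r, hr, hrs⟩
    exact Finset.prod_eq_zero hr ((hx s r).mpr hrs)
  rw [Finset.sum_eq_single s, Finset.sum_eq_zero] at hs
  · rw [← mul_assoc, div_mul_cancel₀ _ (hl s)] at hs
    refine (mul_eq_zero.mp hs).resolve_right (Finset.prod_ne_zero_iff.mpr fun r hr h0 => ?_)
    exact (hx s r).mp h0 hr
  · intro t _
    rw [hz, mul_zero]
    by_contra! hts
    have := Finset.card_le_card hts
    rw [t.2, s.2] at this
    omega
  · intro t _ hts
    rw [hz, mul_zero, mul_zero]
    by_contra! hsub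
    exact hts (Subtype.ext (Finset.eq_of_subset_of_card_le hsub (by rw [s.2, t.2])))
  · simp

/-- Recovery, up to scaling, of the vectors orthogonal to all columns of `C` outside a set of `μ`
columns, from generators of the spans of the products of `μ` and of `μ + 1` linear forms. -/
theorem gevd_recovers_normals {q₀ q₁ : ℕ}
    (hx : ∀ s r, (Cᵀ *ᵥ x s) r = 0 ↔ r ∉ s.1)
    (hx' : ∀ s v, v ⬝ᵥ x s = 0 → ∃ l, (∀ r ∈ s.1, l r = 0) ∧ C *ᵥ l = v)
    (hl : ∀ s, l₂ ⬝ᵥ x s ≠ 0)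
    (hl' : ∀ s t, s ≠ t → (l₁ ⬝ᵥ x s) * (l₂ ⬝ᵥ x t) ≠ (l₁ ⬝ᵥ x t) * (l₂ ⬝ᵥ x s))
    {G₀ : Matrix (Fin ((μ + 1 + 1) ^ k)) (Fin q₀) ℝ} {E : Matrix (Fin q₀) _ ℝ}
    (hG₀ : ∀ p q, G₀ p q = ∑ s : {s : Finset (Fin R) // s.card = μ},
      prodForm C s.1 (gridPoint (μ + 1) k p) * E q s)
    (hE : ∀ v, E *ᵥ v = 0 → v = 0)
    {G₁ : Matrix (Fin ((μ + 1 + 1) ^ k)) (Fin q₁) ℝ}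
    (hG₁ : ∀ w, G₁ᵀ *ᵥ w = 0 ↔ ∀ t : Finset (Fin R), t.card = μ + 1 →
      ∑ p, w p * prodForm C t (gridPoint (μ + 1) k p) = 0)
    (hW : IsOrthBasis G₁ W) {M₁ M₂ : Matrix (Fin q₀) (Fin n) ℝ}
    (hM₁ : M₁ = G₀ᵀ * (diagonal (fun p => l₁ ⬝ᵥ gridPoint (μ + 1) k p) * W))
    (hM₂ : M₂ = G₀ᵀ * (diagonal (fun p => l₂ ⬝ᵥ gridPoint (μ + 1) k p) * W))
    {O : Matrix (Fin n) (Fin d₁) ℝ} {V : Matrix (Fin n) (Fin n') ℝ} (hO : IsOrthBasis M₂ᵀ O)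
    (hV : IsOrthBasis O V) :
    Fintype.card {s : Finset (Fin R) // s.card = μ} = n' ∧
    (∃ X d, IsGEVD ((M₂ * V)ᵀ * (M₁ * V)) ((M₂ * V)ᵀ * (M₂ * V)) X d) ∧
    ∀ X d, IsGEVD ((M₂ * V)ᵀ * (M₁ * V)) ((M₂ * V)ᵀ * (M₂ * V)) X d → ∀ s, ∃ j q, ∃ c : ℝ, c ≠ 0 ∧
      ∀ v, ∑ p, G₀ p q * (W * (V * X)) p j * (v ⬝ᵥ gridPoint (μ + 1) k p) = c * (v ⬝ᵥ x s) := by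
  classical
  set y := gridPoint (μ + 1) k with hy
  set Z := residues C x l₂ W
  have hcol : ∀ c, ∀ t : Finset (Fin R), t.card = μ + 1 →
      ∑ p, W p c * prodForm C t (y p) = 0 := by
    intro c
    refine (hG₁ (W.col c)).mp ((hW.mem_iff _).mpr ⟨Pi.single c 1, ?_⟩)
    rw [mulVec_single_one]
  -- Multiplications by all linear forms are diagonalized by the same E and Z; only the diagonal
  -- depends on v.
  have hfac : ∀ v, G₀ᵀ * (diagonal (fun p => v ⬝ᵥ y p) * W) =
      E * diagonal (fun s => v ⬝ᵥ x s) * Z := by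
    intro v
    ext q c
    rw [Matrix.mul_apply, Matrix.mul_apply]
    have h1 : ∀ s, (v ⬝ᵥ x s) * Z s c = ∑ p, W p c * ((v ⬝ᵥ y p) * prodForm C s.1 (y p)) :=
      fun s => (sum_linear_mul_prodForm (fun t ht => hcol c t (by rw [ht, s.2])) (hx' s) (hl s)
        v).symm
    simp_rw [mul_diagonal, diagonal_mul, transpose_apply, mul_assoc, h1, hG₀, Finset.sum_mul,
      Finset.mul_sum]
    rw [Finset.sum_comm]
    exact Finset.sum_congr rfl fun s _ => Finset.sum_congr rfl fun p _ => by ring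
  rw [hfac] at hM₁ hM₂
  have hZt : ∀ β, Zᵀ *ᵥ β = 0 → β = 0 := residues_transpose_injective hx hl fun w hw =>
    (hW.mem_iff w).mp ((hG₁ w).mpr hw)
  have hM₂0 : ∀ u, M₂ *ᵥ u = 0 → Z *ᵥ u = 0 := by
    intro u hu
    rw [hM₂, ← mulVec_mulVec, ← mulVec_mulVec] at hu
    exact diagonal_mulVec_eq_zero hl (hE _ hu)
  have hVM : ∀ w, (∃ u, V *ᵥ u = w) ↔ ∃ t, M₂ᵀ *ᵥ t = w := hO.mem_iff_of_orthBasis hV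
  -- The range of V is the row space of M₂, on which M₂ is injective, and M₂ factors through Z.
  have hY : ∀ u, (Z * V) *ᵥ u = 0 → u = 0 := by
    intro u hu
    obtain ⟨t, ht⟩ := (hVM _).mp ⟨u, rfl⟩
    apply hV.injective
    rw [← ht]
    refine dotProduct_mulVec_self_eq_zero ?_
    rw [transpose_transpose, ← mulVec_mulVec, ht, hM₂, ← mulVec_mulVec, mulVec_mulVec _ Z V, hu,
      mulVec_zero]
  -- Since ker M₂ ⊆ ker Z, the row space of Z lies in the range of V; a vector Zᵀ u orthogonal to
  -- that range is zero.
  have hY' : ∀ u, (Z * V)ᵀ *ᵥ u = 0 → u = 0 := by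
    intro u hu
    apply hZt
    obtain ⟨t, ht⟩ := exists_mulVec_eq M₂ᵀ (Zᵀ *ᵥ u) (fun w hw => by
      rw [transpose_transpose] at hw
      rw [mulVec_transpose, ← dotProduct_mulVec, hM₂0 w hw, dotProduct_zero])
    obtain ⟨t', ht'⟩ := (hVM _).mpr ⟨t, ht⟩
    rw [← dotProduct_self_eq_zero]
    nth_rw 2 [← ht']
    rw [dotProduct_mulVec, ← mulVec_transpose, mulVec_mulVec, ← transpose_mul, hu,
      zero_dotProduct]
  obtain ⟨hcard, hex, hall⟩ := gevd_of_factorization (δ₁ := fun s => l₁ ⬝ᵥ x s)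
    (δ₂ := fun s => l₂ ⬝ᵥ x s) hE hY hY' hl hl' (M₁ := M₁ * V) (M₂ := M₂ * V)
    (by rw [hM₁]; simp only [Matrix.mul_assoc]) (by rw [hM₂]; simp only [Matrix.mul_assoc])
  refine ⟨hcard, hex, fun X d hX s => ?_⟩
  obtain ⟨j, c, hc, hj⟩ := hall X d hX s
  -- A particular minor may fail to involve P_s, which is why the index q has to be guessed.
  obtain ⟨q, hq⟩ : ∃ q, E q s ≠ 0 := by
    by_contra! h0
    have := hE (Pi.single s 1) (by rw [mulVec_single_one]; ext q; exact h0 q)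
    simpa using congrFun this s
  refine ⟨j, q, E q s * c, mul_ne_zero hq hc, fun v => ?_⟩
  have h1 : ∑ p, G₀ p q * (W * (V * X)) p j * (v ⬝ᵥ y p) =
      (G₀ᵀ * (diagonal (fun p => v ⬝ᵥ y p) * W) * (V * X)) q j := by
    rw [Matrix.mul_assoc, Matrix.mul_assoc, Matrix.mul_apply]
    simp_rw [diagonal_mul, transpose_apply]
    exact Finset.sum_congr rfl fun p _ => by ring
  rw [h1, hfac, Matrix.mul_assoc, ← Matrix.mul_assoc Z V X, Matrix.mul_apply,
    Finset.sum_eq_single s]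
  · rw [mul_diagonal, hj, if_pos rfl]; ring
  · intro t _ hts
    rw [hj, if_neg hts, mul_zero]
  · simp

end Core

/-! ### Matrix operations on matrices of known size. -/

namespace Mat

theorem build_eq (m n : ℕ) (f : ℕ → ℕ → ℝ) :
    build m n f = ⟨m, n, Matrix.of fun i j => f i j⟩ := rfl

theorem mul_mk {m n p : ℕ} (M : Matrix (Fin m) (Fin n) ℝ) (N : Matrix (Fin n) (Fin p) ℝ) :
    (⟨m, n, M⟩ : Mat).mul ⟨n, p, N⟩ = ⟨m, p, M * N⟩ := by
  simp only [mul, dif_pos]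
  rfl

theorem transpose_mk {m n : ℕ} (M : Matrix (Fin m) (Fin n) ℝ) :
    (⟨m, n, M⟩ : Mat).transpose = ⟨n, m, Mᵀ⟩ := rfl

theorem inv_mk {n : ℕ} (M : Matrix (Fin n) (Fin n) ℝ) : (⟨n, n, M⟩ : Mat).inv = ⟨n, n, M⁻¹⟩ := by
  simp only [inv, dif_pos]
  rfl

theorem entry_mk {m n : ℕ} (M : Matrix (Fin m) (Fin n) ℝ) {i j : ℕ} (hi : i < m) (hj : j < n) :
    (⟨m, n, M⟩ : Mat).entry i j = M ⟨i, hi⟩ ⟨j, hj⟩ := dif_pos ⟨hi, hj⟩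

theorem entry_val {m n : ℕ} (M : Matrix (Fin m) (Fin n) ℝ) (i : Fin m) (j : Fin n) :
    (⟨m, n, M⟩ : Mat).entry i j = M i j := entry_mk M i.2 j.2

theorem entry_build {m n i j : ℕ} (f : ℕ → ℕ → ℝ) (hi : i < m) (hj : j < n) :
    (build m n f).entry i j = f i j := entry_mk _ hi hj

theorem subsets_self (n : ℕ) : subsets n n = [List.range n] := by
  have := List.sublistsLen_length (List.range n)
  rw [List.length_range] at this
  rw [subsets, this, List.reverse_singleton]

/-- The n-th compound of an n × n matrix has a single entry, so compound matrices provide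
determinants, also for n = 0. -/
theorem compound_build_entry (n : ℕ) (f : ℕ → ℕ → ℝ) :
    ((build n n f).compound n).entry 0 0 = (Matrix.of fun a b : Fin n => f a b).det := by
  have h : (subsets n n).length = 1 := by rw [subsets_self]; rfl
  rw [compound, show (build n n f).rows = n from rfl, show (build n n f).cols = n from rfl,
    entry_build _ (by rw [h]; exact one_pos) (by rw [h]; exact one_pos), subsets_self]
  congr 1
  ext a b
  simp [entry_build f a.2 b.2]

end Mat

theorem Solver.gevdMat_mk (S : Solver) {n : ℕ} (M N : Matrix (Fin n) (Fin n) ℝ) :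
    S.gevdMat ⟨n, n, M⟩ ⟨n, n, N⟩ = (⟨n, n, (S.gevd M N).1⟩, ⟨n, n, diagonal (S.gevd M N).2⟩) := by
  simp only [gevdMat, and_self, dif_pos]
  rfl

namespace Prog

variable {a b c : Ty}

/-! ### Combinators -/

instance (n : ℕ) : OfNat (Prog a .nat) n := ⟨natConst n⟩
instance : Add (Prog a .nat) := ⟨fun f g => comp natAdd (pair f g)⟩
instance : Sub (Prog a .nat) := ⟨fun f g => comp natSub (pair f g)⟩
instance : Mul (Prog a .nat) := ⟨fun f g => comp natMul (pair f g)⟩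
instance : Div (Prog a .nat) := ⟨fun f g => comp natDiv (pair f g)⟩
instance : Mod (Prog a .nat) := ⟨fun f g => comp natMod (pair f g)⟩
instance : Add (Prog a .scalar) := ⟨fun f g => comp add (pair f g)⟩
instance : Mul (Prog a .scalar) := ⟨fun f g => comp mul (pair f g)⟩
instance : Neg (Prog a .scalar) := ⟨fun f => comp neg f⟩
instance : Mul (Prog a .mat) := ⟨fun f g => comp matMul (pair f g)⟩

/-- Conversion to a real number. -/
def toReal (f : Prog a .nat) : Prog a .scalar := comp cast f

/-- Transpose of the result. -/
def tr (f : Prog a .mat) : Prog a .mat := comp matTranspose f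

/-- Orthogonal complement of the result. -/
def compl (f : Prog a .mat) : Prog a .mat := comp orth f

/-- Weakening of the context. -/
def lift (f : Prog a c) : Prog (.prod a b) c := comp f fst

/-- Row index in the body of `mk`. -/
def row : Prog (.prod a (.prod .nat .nat)) .nat := comp fst snd

/-- Column index in the body of `mk`. -/
def column : Prog (.prod a (.prod .nat .nat)) .nat := comp snd snd

/-- The matrix with given size and entries. -/
def mk (m n : Prog a .nat) (f : Prog (.prod a (.prod .nat .nat)) .scalar) : Prog a .mat :=
  comp (build f) (pair id (pair m n))

/-- An entry of a matrix. -/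
def get (M : Prog a .mat) (i j : Prog a .nat) : Prog a .scalar :=
  comp entry (pair M (pair i j))

/-- Powers of natural numbers. -/
def pow (f g : Prog a .nat) : Prog a .nat :=
  comp snd (comp (iter (pair fst (comp natMul (pair snd fst)))) (pair g (pair f (natConst 1))))

/-- Finite sums. -/
def sum (n : Prog a .nat) (f : Prog (.prod a .nat) .scalar) : Prog a .scalar :=
  get (mk 1 n (comp f (pair fst column)) * mk n 1 (toReal 1)) 0 0

/-- The determinant of an `n × n` matrix with given entries. -/
def det (n : Prog a .nat) (f : Prog (.prod a (.prod .nat .nat)) .scalar) : Prog a .scalar :=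
  get (comp compound (pair (mk n n f) n)) 0 0

/-- The last of the values `f (x, i)`, `i < n`, at which `t` vanishes. -/
def search (n : Prog a .nat) (f : Prog (.prod a .nat) b) (t : Prog (.prod a b) .scalar) :
    Prog a b :=
  comp snd (comp (iter (pair (pair (comp fst fst) (comp natAdd (pair (comp snd fst) (natConst 1))))
    (ifZero (comp t (pair (comp fst fst) (comp f fst))) (comp f fst) snd)))
    -- The loop starts from the value at 0, a default that is returned if no value passes the test.
    (pair n (pair (pair id (natConst 0)) (comp f (pair id (natConst 0))))))

variable (S : Solver) (x : a.El)

@[simp] theorem run_zero : (0 : Prog a .nat).run S x = (0 : ℕ) := rfl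
@[simp] theorem run_one : (1 : Prog a .nat).run S x = (1 : ℕ) := rfl
@[simp] theorem run_two : (2 : Prog a .nat).run S x = (2 : ℕ) := rfl
@[simp] theorem run_three : (3 : Prog a .nat).run S x = (3 : ℕ) := rfl
@[simp] theorem run_four : (4 : Prog a .nat).run S x = (4 : ℕ) := rfl
@[simp] theorem run_natAdd (f g : Prog a .nat) : (f + g).run S x = f.run S x + g.run S x := rfl
@[simp] theorem run_natSub (f g : Prog a .nat) : (f - g).run S x = f.run S x - g.run S x := rfl
@[simp] theorem run_natMul (f g : Prog a .nat) : (f * g).run S x = f.run S x * g.run S x := rfl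
@[simp] theorem run_natDiv (f g : Prog a .nat) : (f / g).run S x = f.run S x / g.run S x := rfl
@[simp] theorem run_natMod (f g : Prog a .nat) : (f % g).run S x = f.run S x % g.run S x := rfl
@[simp] theorem run_add (f g : Prog a .scalar) : (f + g).run S x = f.run S x + g.run S x := rfl
@[simp] theorem run_mul (f g : Prog a .scalar) : (f * g).run S x = f.run S x * g.run S x := rfl
@[simp] theorem run_neg (f : Prog a .scalar) : (-f).run S x = -f.run S x := rfl
@[simp] theorem run_matMul (f g : Prog a .mat) :
    (f * g).run S x = (f.run S x).mul (g.run S x) := rfl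
@[simp] theorem run_toReal (f : Prog a .nat) : (toReal f).run S x = (f.run S x : ℝ) := rfl
@[simp] theorem run_tr (f : Prog a .mat) : (tr f).run S x = (f.run S x).transpose := rfl
@[simp] theorem run_compl (f : Prog a .mat) : (compl f).run S x = S.orthMat (f.run S x) := rfl
@[simp] theorem run_comp (g : Prog b c) (f : Prog a b) :
    (comp g f).run S x = g.run S (f.run S x) := rfl
@[simp] theorem run_pair (f : Prog a b) (g : Prog a c) :
    (pair f g).run S x = (f.run S x, g.run S x) := rfl
@[simp] theorem run_fst (y : (Ty.prod a b).El) : (fst : Prog (.prod a b) a).run S y = y.1 := rfl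
@[simp] theorem run_lift (f : Prog a c) (y : (Ty.prod a b).El) :
    (lift f).run S y = f.run S y.1 := rfl
@[simp] theorem run_row (y : (Ty.prod a (.prod .nat .nat)).El) : row.run S y = y.2.1 := rfl
@[simp] theorem run_column (y : (Ty.prod a (.prod .nat .nat)).El) : column.run S y = y.2.2 := rfl
@[simp] theorem run_mk (m n : Prog a .nat) (f : Prog (.prod a (.prod .nat .nat)) .scalar) :
    (mk m n f).run S x =
      Mat.build (m.run S x) (n.run S x) fun (i j : ℕ) => f.run S (x, ((i, j) : ℕ × ℕ)) := rfl
@[simp] theorem run_get (M : Prog a .mat) (i j : Prog a .nat) :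
    (get M i j).run S x = (M.run S x).entry (i.run S x) (j.run S x) := rfl

@[simp] theorem run_pow (f g : Prog a .nat) : (pow f g).run S x = f.run S x ^ g.run S x := by
  have h : ∀ n : ℕ, (fun y : ℕ × ℕ => ((y.1, y.2 * y.1) : ℕ × ℕ))^[n] (f.run S x, 1) =
      (f.run S x, f.run S x ^ n) := by
    intro n
    induction n with
    | zero => rfl
    | succ n ih => rw [Function.iterate_succ_apply', ih, pow_succ]
  exact congrArg Prod.snd (h (g.run S x))

@[simp] theorem run_sum (n : Prog a .nat) (f : Prog (.prod a .nat) .scalar) :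
    (sum n f).run S x = ∑ i ∈ Finset.range (n.run S x), f.run S (x, i) := by
  simp only [sum, run_get, run_matMul, run_mk, run_comp, run_pair, run_fst, run_column, run_zero,
    run_one, run_toReal]
  rw [Mat.build_eq, Mat.build_eq, Mat.mul_mk, Mat.entry_mk _ one_pos one_pos, Matrix.mul_apply,
    Finset.sum_range]
  simp

@[simp] theorem run_det (n : Prog a .nat) (f : Prog (.prod a (.prod .nat .nat)) .scalar) :
    (det n f).run S x = (Matrix.of fun i j : Fin (n.run S x) =>
      f.run S (x, (((i : ℕ), (j : ℕ)) : ℕ × ℕ))).det :=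
  Mat.compound_build_entry _ _

open Classical in
-- Loop invariant: the stored result is always some f (x, j), and it passes the test as soon as the
-- counter has moved beyond i; later failures leave it unchanged.
theorem run_search (n : Prog a .nat) (f : Prog (.prod a .nat) b) (t : Prog (.prod a b) .scalar)
    {i : ℕ} (hi : i < n.run S x) (h : t.run S (x, f.run S (x, i)) = (0 : ℝ)) :
    ∃ j : ℕ, (search n f t).run S x = f.run S (x, j) ∧
      t.run S (x, (search n f t).run S x) = (0 : ℝ) := by
  let step : (a.El × ℕ) × b.El → (a.El × ℕ) × b.El := fun y =>
    ((y.1.1, y.1.2 + 1), if t.run S (y.1.1, f.run S y.1) = (0 : ℝ) then f.run S y.1 else y.2)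
  have hrun : (search n f t).run S x = (step^[n.run S x] ((x, 0), f.run S (x, (0 : ℕ)))).2 := rfl
  have key : ∀ N : ℕ, (step^[N] ((x, 0), f.run S (x, (0 : ℕ)))).1 = (x, N) ∧
      (∃ j : ℕ, (step^[N] ((x, 0), f.run S (x, (0 : ℕ)))).2 = f.run S (x, j)) ∧
      (i < N → t.run S (x, (step^[N] ((x, 0), f.run S (x, (0 : ℕ)))).2) = (0 : ℝ)) := by
    intro N
    induction N with
    | zero => exact ⟨rfl, ⟨0, rfl⟩, fun h => absurd h (Nat.not_lt_zero i)⟩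
    | succ N ih =>
      rw [Function.iterate_succ_apply']
      set y := step^[N] ((x, 0), f.run S (x, (0 : ℕ)))
      obtain ⟨h1, ⟨j, hj⟩, h2⟩ := ih
      refine ⟨by simp only [step, h1], ?_, fun hiN => ?_⟩
      · simp only [step]
        split_ifs
        · exact ⟨N, by rw [h1]⟩
        · exact ⟨j, hj⟩
      · simp only [step, h1]
        split_ifs with h3
        · exact h3
        · refine h2 (lt_of_le_of_ne (Nat.lt_succ_iff.mp hiN) ?_)
          rintro rfl
          exact h3 h
  obtain ⟨-, ⟨j, hj⟩, h2⟩ := key (n.run S x)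
  exact ⟨j, hrun.trans hj, by rw [hrun]; exact h2 hi⟩

/-! ### The algorithm -/

/-- Input together with a number encoding a sequence of guesses. -/
abbrev Ctx : Ty := .prod InputTy .nat

def inI : Prog InputTy .nat := comp fst fst
def inJ : Prog InputTy .nat := comp snd fst
def inR : Prog InputTy .nat := comp fst snd
def inU : Prog InputTy .mat := comp snd snd
def inK : Prog InputTy .nat := comp cols inU

/-- A strict upper bound for all guesses. -/
def guessBound : Prog InputTy .nat :=
  pow 4 inR * (inR + inK + 1) + pow (inI * inJ + 1) inR + inR + 1

/-- The number of guesses. -/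
def guessCount : Prog InputTy .nat := 3 + inR + 2 * (inR * inR)

variable {c : Ty}

/-- The guess at a given position. -/
def guess (g : Prog c Ctx) (p : Prog c .nat) : Prog c .nat :=
  (comp snd g / pow (comp guessBound (comp fst g)) p) % comp guessBound (comp fst g)

def pI : Prog Ctx .nat := lift inI
def pJ : Prog Ctx .nat := lift inJ
def pR : Prog Ctx .nat := lift inR
def pU : Prog Ctx .mat := lift inU
def pK : Prog Ctx .nat := lift inK

/-- The guessed k-rank of the third factor. -/
def pk : Prog Ctx .nat := guess id 0

/-- The size of the minors used as test functions. -/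
def pμ : Prog Ctx .nat := pR + 1 - pk

/-- The compression of the third mode. -/
def pMoment : Prog Ctx .mat := mk pk pK (toReal (pow (guess fst (3 + row)) column))

/-- The number of grid points. -/
def pGridCard : Prog Ctx .nat := pow (pμ + 2) pk

def pGrid : Prog Ctx .mat :=
  mk pk pGridCard (toReal ((column / pow (lift (pμ + 2)) row) % lift (pμ + 2)))

/-- The vectorized slices at the grid points. -/
def pEval : Prog Ctx .mat := pU * tr pMoment * pGrid

/-- A digit of the column index in base `I * J`, in the body of a determinant. -/
def pDigit (i : Prog (.prod (.prod Ctx (.prod .nat .nat)) (.prod .nat .nat)) .nat) :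
    Prog (.prod (.prod Ctx (.prod .nat .nat)) (.prod .nat .nat)) .nat :=
  (lift column / pow (lift (lift (pI * pJ))) i) % lift (lift (pI * pJ))

/-- The minors of a given size, at the grid points. -/
def pMinors (m : Prog Ctx .nat) : Prog Ctx .mat :=
  mk pGridCard (pow (pI * pJ) m) (det (lift m) (get (lift (lift pEval))
    ((pDigit row / lift (lift pJ)) * lift (lift pJ) + pDigit column % lift (lift pJ)) (lift row)))

/-- The functionals on the grid that annihilate the large minors. -/
def pAnn : Prog Ctx .mat := compl (pMinors (pμ + 1))

/-- The values of a guessed linear form on the grid. -/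
def pForm (p : Prog Ctx .nat) : Prog Ctx .mat :=
  mk 1 pk (toReal (pow (lift (guess id p)) column)) * pGrid

/-- The matrix of a multiplication by a guessed linear form. -/
def pMult (p : Prog Ctx .nat) : Prog Ctx .mat :=
  tr (pMinors pμ) * mk pGridCard (comp cols pAnn)
    (get (lift (pForm p)) 0 row * get (lift pAnn) row column)

/-- A basis of the row space of the second multiplication matrix. -/
def pRowBasis : Prog Ctx .mat := compl (compl (tr (pMult 2)))

/-- The eigenvectors of the pencil. -/
def pEigen : Prog Ctx .mat :=
  comp fst (comp gevd (pair (tr (pMult 2 * pRowBasis) * (pMult 1 * pRowBasis))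
    (tr (pMult 2 * pRowBasis) * (pMult 2 * pRowBasis))))

def pResidues : Prog Ctx .mat := pAnn * (pRowBasis * pEigen)

/-- The slice of guessed index `(r, t)`. -/
def pSlice : Prog (.prod Ctx (.prod .nat .nat)) .mat :=
  mk (lift pI) (lift pJ) (get (lift (lift pEval *
    mk (lift pGridCard) 1
      (get (lift (lift (pMinors pμ))) row
          (lift (guess fst (4 + lift pR + 2 * (row * lift pR + column)))) *
        get (lift (lift pResidues)) row
          (lift (guess fst (3 + lift pR + 2 * (row * lift pR + column)))))))
    (row * lift (lift pJ) + column) 0)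

/-- The sum over the guessed slices for `r` of `N Nᵀ`, with `N` an orthogonal complement. -/
def pGram (n : Prog Ctx .nat) (T : Prog (.prod Ctx (.prod .nat .nat)) .mat) :
    Prog (.prod Ctx .nat) .mat :=
  mk (lift n) (lift n) (sum (lift (lift pR)) (get
    (comp (compl T * tr (compl T)) (pair (lift (lift fst)) (pair (lift (lift snd)) snd)))
    (lift row) (lift column)))

/-- A factor whose columns span the intersections of the ranges of the guessed slices. -/
def pFactor (n : Prog Ctx .nat) (T : Prog (.prod Ctx (.prod .nat .nat)) .mat) : Prog Ctx .mat :=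
  mk n pR (get (comp (compl (pGram n T)) (pair fst column)) row 0)

def pA : Prog Ctx .mat := pFactor pI pSlice
def pB : Prog Ctx .mat := pFactor pJ (tr pSlice)

/-- The Khatri–Rao product of the first two factors. -/
def pKhatriRao : Prog Ctx .mat :=
  mk (pI * pJ) pR (get (lift pA) (row / lift pJ) column * get (lift pB) (row % lift pJ) column)

def pC : Prog Ctx .mat :=
  mk pK pR (get (lift (comp matInv (tr pKhatriRao * pKhatriRao) * (tr pKhatriRao * pU))) column row)

/-- The decomposition resulting from the guesses. -/
def candidate : Prog Ctx OutputTy := pair pA (pair pB pC)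

/-- An entry of the residual of a decomposition. -/
def residual : Prog (.prod (.prod (.prod InputTy OutputTy) .nat) .nat) .scalar :=
  get (lift (lift (lift inU))) (lift snd) snd +
    -sum (lift (lift (lift inR)))
      (get (lift (lift (lift (comp fst snd)))) (lift (lift snd) / lift (lift (lift (lift inJ))))
          snd *
        get (lift (lift (lift (comp fst (comp snd snd)))))
          (lift (lift snd) % lift (lift (lift (lift inJ)))) snd *
        get (lift (lift (lift (comp snd (comp snd snd))))) (lift snd) snd)

/-- The squared norm of the residual of a decomposition. -/
def residualNorm : Prog (.prod InputTy OutputTy) .scalar :=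
  sum (lift (inI * inJ)) (sum (lift (lift inK)) (residual * residual))

/-- Computation of a decomposition by exhaustive search over all guesses. -/
def findCPD : Prog InputTy OutputTy :=
  search (pow guessBound guessCount) candidate residualNorm

end Prog

/-! ### Encoded guesses and the matrices computed from them. -/

theorem Mat.build_eq_mk {m n : ℕ} {f : ℕ → ℕ → ℝ} {M : Matrix (Fin m) (Fin n) ℝ}
    (h : ∀ (i : Fin m) (j : Fin n), f i j = M i j) : Mat.build m n f = ⟨m, n, M⟩ := by
  rw [Mat.build_eq]
  congr 1
  ext i j
  exact h i j

/-- The base in which guesses are encoded. -/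
def guessBase (I J K R : ℕ) : ℕ := 4 ^ R * (R + K + 1) + (I * J + 1) ^ R + R + 1

/-- The guess at a given position encoded by `σ`. -/
def guessDigit (I J K R σ p : ℕ) : ℕ := σ / guessBase I J K R ^ p % guessBase I J K R

/-- The context `y` consists of an input and a number `σ` encoding the guesses `k`, `t`, `τ₁`
and `τ₂`. -/
structure IsGuess {I J K : ℕ} (T : Tensor I J K) (R : ℕ) (y : Prog.Ctx.El) (σ k μ : ℕ)
    (t : ℕ → ℕ) (τ₁ τ₂ : ℕ) : Prop where
  eq : y = (input T R, σ)
  rank : guessDigit I J K R σ 0 = k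
  size : μ + k = R + 1
  moment : ∀ i < k, guessDigit I J K R σ (3 + i) = t i
  form₁ : guessDigit I J K R σ 1 = τ₁
  form₂ : guessDigit I J K R σ 2 = τ₂

/-- The point with parameter `τ` of the moment curve. -/
def momentPoint (k τ : ℕ) : Fin k → ℝ := fun i => (τ : ℝ) ^ (i : ℕ)

/-- The matrix unfolding as a matrix of known size. -/
def unfoldingMat {I J K : ℕ} (T : Tensor I J K) : Matrix (Fin (I * J)) (Fin K) ℝ :=
  Matrix.of fun p k => T p.divNat p.modNat k

section Matrices

variable (S : Solver) {I J K R k : ℕ} (A : Matrix (Fin I) (Fin R) ℝ) (B : Matrix (Fin J) (Fin R) ℝ)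
  (D : Matrix (Fin k) (Fin R) ℝ) (μ τ₁ τ₂ : ℕ)

/-- The minors of size `ν` of the slices at the grid points. -/
noncomputable def minorsMat (ν : ℕ) :
    Matrix (Fin ((μ + 1 + 1) ^ k)) (Fin ((I * J) ^ ν)) ℝ :=
  Matrix.of fun p q =>
    tupleMinor (slice A B (Dᵀ *ᵥ gridPoint (μ + 1) k p)) (finFunctionFinEquiv.symm q)

/-- A basis of the combinations of point evaluations that annihilate the minors of size `μ + 1`. -/
noncomputable def annMat : Matrix (Fin ((μ + 1 + 1) ^ k))
    (Fin (S.orth (minorsMat A B D μ (μ + 1))).1) ℝ := (S.orth (minorsMat A B D μ (μ + 1))).2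

/-- The matrix of the multiplication by a linear form, between annihilator and minors. -/
noncomputable def multMat (τ : ℕ) : Matrix (Fin ((I * J) ^ μ))
    (Fin (S.orth (minorsMat A B D μ (μ + 1))).1) ℝ :=
  (minorsMat A B D μ μ)ᵀ *
    (diagonal (fun p => momentPoint k τ ⬝ᵥ gridPoint (μ + 1) k p) * annMat S A B D μ)

/-- A basis of the row space of the second multiplication matrix. -/
noncomputable def rowBasisMat : Matrix (Fin (S.orth (minorsMat A B D μ (μ + 1))).1)
    (Fin (S.orth (S.orth (multMat S A B D μ τ₂)ᵀ).2).1) ℝ :=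
  (S.orth (S.orth (multMat S A B D μ τ₂)ᵀ).2).2

/-- The eigenvectors of the pencil of multiplication matrices. -/
noncomputable def eigenMat : Matrix (Fin (S.orth (S.orth (multMat S A B D μ τ₂)ᵀ).2).1)
    (Fin (S.orth (S.orth (multMat S A B D μ τ₂)ᵀ).2).1) ℝ :=
  (S.gevd ((multMat S A B D μ τ₂ * rowBasisMat S A B D μ τ₂)ᵀ *
      (multMat S A B D μ τ₁ * rowBasisMat S A B D μ τ₂))
    ((multMat S A B D μ τ₂ * rowBasisMat S A B D μ τ₂)ᵀ *
      (multMat S A B D μ τ₂ * rowBasisMat S A B D μ τ₂))).1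

/-- The combinations of point evaluations that correspond to the eigenvectors. -/
noncomputable def residuesMat : Matrix (Fin ((μ + 1 + 1) ^ k))
    (Fin (S.orth (S.orth (multMat S A B D μ τ₂)ᵀ).2).1) ℝ :=
  annMat S A B D μ * (rowBasisMat S A B D μ τ₂ * eigenMat S A B D μ τ₁ τ₂)

end Matrices

/-! ### Semantics of the program for correct guesses. -/

namespace Prog

section Input

variable (S : Solver) {I J K : ℕ} {T : Tensor I J K} {R σ : ℕ} {x : InputTy.El} {y : Ctx.El}

theorem run_inI (hx : x = input T R) : inI.run S x = I := by subst hx; rfl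
theorem run_inJ (hx : x = input T R) : inJ.run S x = J := by subst hx; rfl
theorem run_inR (hx : x = input T R) : inR.run S x = R := by subst hx; rfl
theorem run_inK (hx : x = input T R) : inK.run S x = K := by subst hx; rfl
theorem run_pI (hy : y = (input T R, σ)) : pI.run S y = I := by subst hy; rfl
theorem run_pJ (hy : y = (input T R, σ)) : pJ.run S y = J := by subst hy; rfl
theorem run_pR (hy : y = (input T R, σ)) : pR.run S y = R := by subst hy; rfl
theorem run_pK (hy : y = (input T R, σ)) : pK.run S y = K := by subst hy; rfl
theorem run_pU (hy : y = (input T R, σ)) : pU.run S y = ⟨I * J, K, unfoldingMat T⟩ := by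
  subst hy; rfl

theorem run_guessBound (hx : x = input T R) : guessBound.run S x = guessBase I J K R := by
  simp [guessBound, guessBase, run_inI S hx, run_inJ S hx, run_inR S hx, run_inK S hx]

theorem run_guessCount (hx : x = input T R) : guessCount.run S x = 3 + R + 2 * (R * R) := by
  simp [guessCount, run_inR S hx]

theorem run_guess_id (hy : y = (input T R, σ)) (p : Prog Ctx .nat) :
    (guess id p).run S y = guessDigit I J K R σ (p.run S y) := by
  have h1 : (comp guessBound (comp fst id)).run S y = guessBase I J K R :=
    run_guessBound S (T := T) (by subst hy; rfl)
  have h2 : (comp snd id).run S y = σ := by subst hy; rfl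
  simp only [guess, run_natMod, run_natDiv, run_pow, h1, h2]
  rfl

theorem run_guess_fst (hy : y = (input T R, σ)) {c : Ty} (w : c.El)
    (p : Prog (.prod Ctx c) .nat) :
    (guess fst p).run S (y, w) = guessDigit I J K R σ (p.run S (y, w)) := by
  have h1 : (comp guessBound (comp fst fst)).run S (y, w) = guessBase I J K R :=
    run_guessBound S (T := T) (by subst hy; rfl)
  have h2 : (comp snd fst).run S (y, w) = σ := by subst hy; rfl
  simp only [guess, run_natMod, run_natDiv, run_pow, h1, h2]
  rfl

end Input

section Semantics

variable (S : Solver) {I J K R k μ σ τ₁ τ₂ : ℕ} {t : ℕ → ℕ} {A : Matrix (Fin I) (Fin R) ℝ}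
  {B : Matrix (Fin J) (Fin R) ℝ} {C : Matrix (Fin K) (Fin R) ℝ} {T : Tensor I J K}
  {y : Ctx.El}

theorem run_pk (h : IsGuess T R y σ k μ t τ₁ τ₂) : pk.run S y = k := by
  rw [pk, run_guess_id S h.eq]
  exact h.rank

theorem run_pμ (h : IsGuess T R y σ k μ t τ₁ τ₂) : pμ.run S y = μ := by
  have := h.size
  simp only [pμ, run_natSub, run_natAdd, run_pR S h.eq, run_pk S h, run_one]
  change R + 1 - k = μ
  omega

theorem run_pMoment (h : IsGuess T R y σ k μ t τ₁ τ₂) : pMoment.run S y = ⟨k, K, momentRows K t k⟩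
    := by
  simp only [pMoment, run_mk, run_pk S h, run_pK S h.eq]
  refine Mat.build_eq_mk fun i j => ?_
  simp only [run_toReal, run_pow, run_column]
  rw [run_guess_fst S h.eq, run_natAdd, run_three, run_row]
  rw [h.moment i i.2, Nat.cast_pow]
  rfl

theorem run_pGridCard (h : IsGuess T R y σ k μ t τ₁ τ₂) : pGridCard.run S y = (μ + 1 + 1) ^ k := by
  simp only [pGridCard, run_pow, run_natAdd, run_two, run_pμ S h, run_pk S h]

theorem run_pGrid (h : IsGuess T R y σ k μ t τ₁ τ₂) : pGrid.run S y =
    ⟨k, (μ + 1 + 1) ^ k, Matrix.of fun i p => gridPoint (μ + 1) k p i⟩ := by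
  simp only [pGrid, run_mk, run_pk S h, run_pGridCard S h]
  refine Mat.build_eq_mk fun i j => ?_
  simp only [run_toReal, run_natMod, run_natDiv, run_pow, run_column, run_row, run_lift, run_natAdd,
    run_two, run_pμ S h]
  rfl

/-- The program only contracts T with known vectors; the unknown factors enter the description of
the result through `ofFactors_mulVec`. -/
theorem run_pEval (h : IsGuess T R y σ k μ t τ₁ τ₂) (hT : T = ofFactors A B C) : pEval.run S y =
    ⟨I * J, (μ + 1 + 1) ^ k, Matrix.of fun p q =>
      slice A B ((momentRows K t k * C)ᵀ *ᵥ gridPoint (μ + 1) k q) p.divNat p.modNat⟩ := by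
  simp only [pEval, run_matMul, run_tr, run_pU S h.eq, run_pMoment S h, run_pGrid S h,
      Mat.transpose_mk]
  rw [Mat.mul_mk, Mat.mul_mk]
  refine congrArg _ ?_
  ext p q
  rw [Matrix.of_apply, transpose_mul, ← mulVec_mulVec, ofFactors_mulVec, ← hT, Matrix.mul_assoc,
    Matrix.mul_apply]
  rfl

theorem run_pMinors (h : IsGuess T R y σ k μ t τ₁ τ₂) (hT : T = ofFactors A B C)
    {m : Prog Ctx .nat} {ν : ℕ}
    (hm : m.run S y = ν) : (pMinors m).run S y =
      ⟨(μ + 1 + 1) ^ k, (I * J) ^ ν, minorsMat A B (momentRows K t k * C) μ ν⟩ := by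
  simp only [pMinors, run_mk, run_pow, run_natMul, run_pI S h.eq, run_pJ S h.eq, run_pGridCard S h]
  subst hm
  refine Mat.build_eq_mk fun p q => ?_
  simp only [run_det, run_lift, run_get, run_pEval S h hT, run_natAdd, run_natMul, run_natDiv,
    run_natMod, pDigit, run_pow, run_row, run_column, run_pI S h.eq, run_pJ S h.eq]
  rw [minorsMat, Matrix.of_apply, tupleMinor]
  refine congrArg Matrix.det (Matrix.ext fun a b => ?_)
  have hq : ∀ i : Fin (m.run S y), (q : ℕ) / (I * J) ^ (i : ℕ) % (I * J) =
      (finFunctionFinEquiv.symm q i : Fin (I * J)) := fun i =>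
    (finFunctionFinEquiv_symm_apply_val q i).symm
  change Mat.entry _ ((q : ℕ) / (I * J) ^ (a : ℕ) % (I * J) / J * J +
    (q : ℕ) / (I * J) ^ (b : ℕ) % (I * J) % J) p = _
  rw [hq, hq, submatrix_apply]
  set u := (finFunctionFinEquiv.symm q a : Fin (I * J))
  set v := (finFunctionFinEquiv.symm q b : Fin (I * J))
  have hw : (u : ℕ) / J * J + (v : ℕ) % J = (finProdFinEquiv (u.divNat, v.modNat) : ℕ) := by
    rw [finProdFinEquiv_apply_val, Fin.coe_divNat, Fin.coe_modNat, add_comm,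
      mul_comm J]
  rw [hw, Mat.entry_val, Matrix.of_apply]
  have h2 := finProdFinEquiv.symm_apply_apply (u.divNat, v.modNat)
  rw [finProdFinEquiv_symm_apply, Prod.mk.injEq] at h2
  rw [h2.1, h2.2]

theorem run_pAnn (h : IsGuess T R y σ k μ t τ₁ τ₂) (hT : T = ofFactors A B C) : pAnn.run S y =
    ⟨(μ + 1 + 1) ^ k, _, annMat S A B (momentRows K t k * C) μ⟩ := by
  simp only [pAnn, run_compl]
  rw [run_pMinors S h hT (ν := μ + 1) (by rw [run_natAdd, run_one, run_pμ S h])]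
  rfl

theorem run_pForm (h : IsGuess T R y σ k μ t τ₁ τ₂) {p : Prog Ctx .nat} {τ : ℕ}
    (hp : guessDigit I J K R σ (p.run S y) = τ) :
    (pForm p).run S y = ⟨1, (μ + 1 + 1) ^ k,
      Matrix.of fun _ q => momentPoint k τ ⬝ᵥ gridPoint (μ + 1) k q⟩ := by
  have h1 : (mk 1 pk (toReal (pow (lift (guess id p)) column))).run S y =
      ⟨1, k, Matrix.of fun _ i => momentPoint k τ i⟩ := by
    simp only [run_mk, run_one, run_pk S h]
    refine Mat.build_eq_mk fun i j => ?_
    simp only [run_toReal, run_pow, run_lift, run_column]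
    rw [run_guess_id S h.eq, hp, Nat.cast_pow]
    rfl
  rw [pForm, run_matMul, h1, run_pGrid S h, Mat.mul_mk]
  rfl

theorem run_pMult (h : IsGuess T R y σ k μ t τ₁ τ₂) (hT : T = ofFactors A B C) {p : Prog Ctx .nat}
    {τ : ℕ}
    (hp : guessDigit I J K R σ (p.run S y) = τ) :
    (pMult p).run S y =
      ⟨(I * J) ^ μ, _, multMat S A B (momentRows K t k * C) μ τ⟩ := by
  have h1 : (mk pGridCard (comp cols pAnn)
      (get (lift (pForm p)) 0 row * get (lift pAnn) row column)).run S y =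
      ⟨(μ + 1 + 1) ^ k, _, diagonal (fun p => momentPoint k τ ⬝ᵥ gridPoint (μ + 1) k p) *
        annMat S A B (momentRows K t k * C) μ⟩ := by
    have h2 : (comp cols pAnn).run S y =
        (S.orth (minorsMat A B (momentRows K t k * C) μ (μ + 1))).1 := by
      rw [run_comp, run_pAnn S h hT]; rfl
    simp only [run_mk, run_pGridCard S h]
    rw [h2]
    refine Mat.build_eq_mk fun i j => ?_
    simp only [run_mul, run_get, run_lift, run_pForm S h hp, run_pAnn S h hT, run_zero, run_row,
      run_column]
    rw [Mat.entry_val, Mat.entry_mk _ one_pos i.2, diagonal_mul]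
    rfl
  rw [pMult, run_matMul, h1, run_tr, run_pMinors S h hT (run_pμ S h), Mat.transpose_mk, Mat.mul_mk]
  rfl

theorem run_pRowBasis (h : IsGuess T R y σ k μ t τ₁ τ₂) (hT : T = ofFactors A B C) : pRowBasis.run
    S y =
    ⟨_, _, rowBasisMat S A B (momentRows K t k * C) μ τ₂⟩ := by
  rw [pRowBasis, run_compl, run_compl, run_tr, run_pMult S h hT (p := 2) h.form₂]
  rfl

theorem run_pEigen (h : IsGuess T R y σ k μ t τ₁ τ₂) (hT : T = ofFactors A B C) : pEigen.run S y =
    ⟨_, _, eigenMat S A B (momentRows K t k * C) μ τ₁ τ₂⟩ := by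
  have h1 : (pMult 2 * pRowBasis).run S y =
      ⟨_, _, multMat S A B (momentRows K t k * C) μ τ₂ *
        rowBasisMat S A B (momentRows K t k * C) μ τ₂⟩ := by
    rw [run_matMul, run_pMult S h hT (p := 2) h.form₂, run_pRowBasis S h hT, Mat.mul_mk]
  have h2 : (pMult 1 * pRowBasis).run S y =
      ⟨_, _, multMat S A B (momentRows K t k * C) μ τ₁ *
        rowBasisMat S A B (momentRows K t k * C) μ τ₂⟩ := by
    rw [run_matMul, run_pMult S h hT (p := 1) h.form₁, run_pRowBasis S h hT, Mat.mul_mk]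
  have h3 : ∀ y : (Ty.prod .mat .mat).El,
      (gevd : Prog (.prod .mat .mat) (.prod .mat .mat)).run S y = S.gevdMat y.1 y.2 := fun _ => rfl
  have h4 : (tr (pMult 2 * pRowBasis) * (pMult 1 * pRowBasis)).run S y = ⟨_, _,
      (multMat S A B (momentRows K t k * C) μ τ₂ *
      rowBasisMat S A B (momentRows K t k * C) μ τ₂)ᵀ *
      (multMat S A B (momentRows K t k * C) μ τ₁ *
      rowBasisMat S A B (momentRows K t k * C) μ τ₂)⟩ := by
    rw [run_matMul, run_tr, h1, h2, Mat.transpose_mk, Mat.mul_mk]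
  have h5 : (tr (pMult 2 * pRowBasis) * (pMult 2 * pRowBasis)).run S y = ⟨_, _,
      (multMat S A B (momentRows K t k * C) μ τ₂ *
      rowBasisMat S A B (momentRows K t k * C) μ τ₂)ᵀ *
      (multMat S A B (momentRows K t k * C) μ τ₂ *
      rowBasisMat S A B (momentRows K t k * C) μ τ₂)⟩ := by
    rw [run_matMul, run_tr, h1, Mat.transpose_mk, Mat.mul_mk]
  rw [pEigen, run_comp, run_comp, run_pair, h4, h5, h3, Solver.gevdMat_mk]
  rfl

theorem run_pResidues (h : IsGuess T R y σ k μ t τ₁ τ₂) (hT : T = ofFactors A B C) : pResidues.run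
    S y =
    ⟨_, _, residuesMat S A B (momentRows K t k * C) μ τ₁ τ₂⟩ := by
  rw [pResidues, run_matMul, run_matMul, run_pAnn S h hT, run_pRowBasis S h hT, run_pEigen S h hT,
    Mat.mul_mk, Mat.mul_mk]
  rfl

/-- By `hx` the guessed weights sum the grid points to c • x, and slices are linear in the point.
The program therefore obtains this slice by adding slices it already has. -/
theorem run_pSlice (h : IsGuess T R y σ k μ t τ₁ τ₂) (hT : T = ofFactors A B C) {r s : ℕ}
    (j : Fin (S.orth (S.orth (multMat S A B (momentRows K t k * C) μ τ₂)ᵀ).2).1)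
    (q : Fin ((I * J) ^ μ)) (hj : guessDigit I J K R σ (3 + R + 2 * (r * R + s)) = j)
    (hq : guessDigit I J K R σ (4 + R + 2 * (r * R + s)) = q) {c : ℝ} {x : Fin k → ℝ}
    (hx : ∀ v, ∑ p, minorsMat A B (momentRows K t k * C) μ μ p q *
      residuesMat S A B (momentRows K t k * C) μ τ₁ τ₂ p j * (v ⬝ᵥ gridPoint (μ + 1) k p) =
        c * (v ⬝ᵥ x)) :
    pSlice.run S (y, ((r, s) : ℕ × ℕ)) =
      ⟨I, J, slice A B (c • ((momentRows K t k * C)ᵀ *ᵥ x))⟩ := by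
  have h1 : (lift pEval * mk (lift pGridCard) 1
      (get (lift (lift (pMinors pμ))) row
          (lift (guess fst (4 + lift pR + 2 * (row * lift pR + column)))) *
        get (lift (lift pResidues)) row
          (lift (guess fst (3 + lift pR + 2 * (row * lift pR + column)))))).run S
            (y, ((r, s) : ℕ × ℕ)) =
      ⟨I * J, 1, Matrix.of fun p _ => slice A B (c • ((momentRows K t k * C)ᵀ *ᵥ x)) p.divNat
          p.modNat⟩ := by
    rw [run_matMul, run_lift, run_pEval S h hT]
    have h2 : (mk (lift pGridCard) 1
      (get (lift (lift (pMinors pμ))) row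
          (lift (guess fst (4 + lift pR + 2 * (row * lift pR + column)))) *
        get (lift (lift pResidues)) row
          (lift (guess fst (3 + lift pR + 2 * (row * lift pR + column)))))).run S
            (y, ((r, s) : ℕ × ℕ)) = ⟨(μ + 1 + 1) ^ k, 1, Matrix.of fun p _ =>
              minorsMat A B (momentRows K t k * C) μ μ p q * residuesMat S A B
                  (momentRows K t k * C) μ τ₁ τ₂ p j⟩ := by
      simp only [run_mk, run_lift, run_pGridCard S h, run_one]
      refine Mat.build_eq_mk fun p z => ?_
      rw [run_mul, run_get, run_get]
      simp only [run_lift]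
      rw [run_guess_fst S h.eq, run_guess_fst S h.eq, run_pMinors S h hT (run_pμ S h),
        run_pResidues S h hT]
      simp only [run_natAdd, run_natMul, run_four, run_three, run_two, run_lift, run_pR S h.eq,
          run_row,
        run_column, hj, hq]
      rw [Mat.entry_val, Mat.entry_val]
      rfl
    rw [h2, Mat.mul_mk]
    congr 1
    ext p z
    rw [Matrix.mul_apply]
    simp only [Matrix.of_apply, slice_apply, Finset.sum_mul, Pi.smul_apply, smul_eq_mul]
    rw [Finset.sum_comm]
    refine Finset.sum_congr rfl fun i _ => ?_
    have := hx ((momentRows K t k * C).col i)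
    have e : ∀ y, ((momentRows K t k * C)ᵀ *ᵥ y) i = (momentRows K t k * C).col i ⬝ᵥ y := fun y =>
        rfl
    rw [e, ← this, Finset.mul_sum]
    exact Finset.sum_congr rfl fun p' _ => by rw [e]; ring
  simp only [pSlice, run_mk]
  rw [run_lift, run_lift, run_pI S h.eq, run_pJ S h.eq]
  refine Mat.build_eq_mk fun i i' => ?_
  rw [run_get, run_lift, h1]
  have hw : (row * lift (lift pJ) + column : Prog (.prod (.prod Ctx (.prod .nat .nat))
      (.prod .nat .nat)) .nat).run S ((y, ((r, s) : ℕ × ℕ)), (((i : ℕ), (i' : ℕ)) :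
        ℕ × ℕ)) = (finProdFinEquiv (i, i') : ℕ) := by
    simp only [run_natAdd, run_natMul, run_row, run_column, run_lift, run_pJ S h.eq]
    rw [finProdFinEquiv_apply_val, add_comm, mul_comm]
  rw [hw, run_zero, Mat.entry_mk _ (finProdFinEquiv (i, i')).2 one_pos, Matrix.of_apply]
  have h2 := finProdFinEquiv.symm_apply_apply (i, i')
  rw [finProdFinEquiv_symm_apply, Prod.mk.injEq] at h2
  change slice A B _ (finProdFinEquiv (i, i')).divNat (finProdFinEquiv (i, i')).modNat = _
  rw [h2.1, h2.2]

end Semantics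

end Prog

/-! ### Factors from ranges of slices. -/

/-- The complement is the line of a, so every basis vector is a nonzero multiple of a; as a ≠ 0, the
column 0 that the program reads exists. -/
theorem exists_smul_col_of_ker {N d n' : ℕ} {G : Matrix (Fin N) (Fin n') ℝ}
    {O : Matrix (Fin N) (Fin d) ℝ} (hO : IsOrthBasis G O) {a : Fin N → ℝ} (ha : a ≠ 0)
    (h : ∀ v, Gᵀ *ᵥ v = 0 ↔ ∃ c : ℝ, v = c • a) :
    ∃ α : ℝ, α ≠ 0 ∧ ∀ i : Fin N, (⟨N, d, O⟩ : Mat).entry i 0 = α * a i := by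
  obtain ⟨u, hu⟩ := (hO.mem_iff a).mp ((h a).mpr ⟨1, (one_smul ℝ a).symm⟩)
  have hd : 0 < d := by
    rcases Nat.eq_zero_or_pos d with rfl | hd
    · refine absurd hu.symm ?_
      rwa [Subsingleton.elim u 0, mulVec_zero]
    · exact hd
  have hcol : O *ᵥ Pi.single ⟨0, hd⟩ 1 = O.col ⟨0, hd⟩ := mulVec_single_one O _
  obtain ⟨α, hα⟩ := (h (O.col ⟨0, hd⟩)).mp ((hO.mem_iff _).mpr ⟨_, hcol⟩)
  refine ⟨α, ?_, fun i => ?_⟩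
  · rintro rfl
    rw [zero_smul, ← hcol] at hα
    have := congrFun (hO.injective _ hα) ⟨0, hd⟩
    simp at this
  · rw [Mat.entry_mk O i.2 hd]
    exact congrFun hα i

/-- The quadratic form of the sum is a sum of squares, so one kernel computes an intersection of
kernels. -/
theorem sum_mul_transpose_mulVec_eq_zero_iff {ι : Type*} [Fintype ι] {N : ℕ} {d : ι → ℕ}
    (M : ∀ s, Matrix (Fin N) (Fin (d s)) ℝ) (v : Fin N → ℝ) :
    (∑ s, M s * (M s)ᵀ)ᵀ *ᵥ v = 0 ↔ ∀ s, (M s)ᵀ *ᵥ v = 0 := by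
  have hsymm : (∑ s, M s * (M s)ᵀ)ᵀ = ∑ s, M s * (M s)ᵀ := by
    simp only [transpose_sum, transpose_mul, transpose_transpose]
  rw [hsymm, sum_mulVec]
  constructor
  · intro h
    have h0 : ∑ s, ((M s)ᵀ *ᵥ v) ⬝ᵥ ((M s)ᵀ *ᵥ v) = 0 := by
      have := congrArg (fun w => v ⬝ᵥ w) h
      simp only [dotProduct_sum, dotProduct_zero] at this
      rw [← this]
      refine Finset.sum_congr rfl fun s _ => ?_
      rw [← mulVec_mulVec, dotProduct_mulVec v (M s), ← mulVec_transpose]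
    intro s
    have hn : ∀ s, 0 ≤ ((M s)ᵀ *ᵥ v) ⬝ᵥ ((M s)ᵀ *ᵥ v) := fun s =>
      Finset.sum_nonneg fun i _ => mul_self_nonneg _
    rw [Finset.sum_eq_zero_iff_of_nonneg fun s _ => hn s] at h0
    exact dotProduct_self_eq_zero.mp (h0 s (Finset.mem_univ s))
  · intro h
    refine Finset.sum_eq_zero fun s _ => ?_
    rw [← mulVec_mulVec, h s, mulVec_zero]

/-- The Khatri–Rao product. -/
def khatriRao {I J R : ℕ} (A : Matrix (Fin I) (Fin R) ℝ) (B : Matrix (Fin J) (Fin R) ℝ) :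
    Matrix (Fin (I * J)) (Fin R) ℝ := Matrix.of fun p r => A p.divNat r * B p.modNat r

theorem divNat_finProdFinEquiv {I J : ℕ} (i : Fin I) (j : Fin J) :
    (finProdFinEquiv (i, j)).divNat = i :=
  congrArg Prod.fst (finProdFinEquiv.symm_apply_apply (i, j))

theorem modNat_finProdFinEquiv {I J : ℕ} (i : Fin I) (j : Fin J) :
    (finProdFinEquiv (i, j)).modNat = j :=
  congrArg Prod.snd (finProdFinEquiv.symm_apply_apply (i, j))

theorem slice_eq_zero_of_khatriRao {I J R : ℕ} {A : Matrix (Fin I) (Fin R) ℝ}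
    {B : Matrix (Fin J) (Fin R) ℝ} {d : Fin R → ℝ} (h : khatriRao A B *ᵥ d = 0) :
    slice A B d = 0 := by
  ext i j
  have := congrFun h (finProdFinEquiv (i, j))
  rw [mulVec, dotProduct] at this
  simp only [khatriRao, Matrix.of_apply, divNat_finProdFinEquiv, modNat_finProdFinEquiv] at this
  rw [slice_apply, this]
  rfl

theorem unfoldingMat_ofFactors {I J K R : ℕ} (A : Matrix (Fin I) (Fin R) ℝ)
    (B : Matrix (Fin J) (Fin R) ℝ) (C : Matrix (Fin K) (Fin R) ℝ) :
    unfoldingMat (ofFactors A B C) = khatriRao A B * Cᵀ := by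
  ext p k
  rw [Matrix.mul_apply]
  rfl

/-- The Khatri–Rao product has full column rank, so the normal equations return the exact third
factor. -/
theorem inv_mul_khatriRao {I J K R : ℕ} {A : Matrix (Fin I) (Fin R) ℝ}
    {B : Matrix (Fin J) (Fin R) ℝ} (h : ∀ d, slice A B d = 0 → d = 0)
    (C : Matrix (Fin K) (Fin R) ℝ) :
    ((khatriRao A B)ᵀ * khatriRao A B)⁻¹ *
      ((khatriRao A B)ᵀ * unfoldingMat (ofFactors A B C)) = Cᵀ := by
  have hu : IsUnit ((khatriRao A B)ᵀ * khatriRao A B) := by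
    refine mulVec_injective_iff_isUnit.mp fun u v huv => sub_eq_zero.mp ?_
    refine h _ (slice_eq_zero_of_khatriRao (dotProduct_mulVec_self_eq_zero ?_))
    rw [mulVec_sub, sub_eq_zero]
    exact huv
  rw [unfoldingMat_ofFactors, ← Matrix.mul_assoc (khatriRao A B)ᵀ,
    Matrix.nonsing_inv_mul_cancel_left _ _ ((Matrix.isUnit_iff_isUnit_det _).mp hu)]

namespace Prog

variable (S : Solver) {I J K R σ : ℕ} {T : Tensor I J K} {y : Ctx.El}

theorem run_pGram (hy : y = (input T R, σ)) {n : Prog Ctx .nat} {N J' : ℕ} (hn : n.run S y = N)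
    {P : Prog (.prod Ctx (.prod .nat .nat)) .mat} {r : ℕ} {X : Fin R → Matrix (Fin N) (Fin J') ℝ}
    (hX : ∀ s : Fin R, P.run S (y, ((r, (s : ℕ)) : ℕ × ℕ)) = ⟨N, J', X s⟩) :
    (pGram n P).run S (y, r) = ⟨N, N, ∑ s, (S.orth (X s)).2 * (S.orth (X s)).2ᵀ⟩ := by
  simp only [pGram, run_mk]
  rw [run_lift, hn]
  refine Mat.build_eq_mk fun i j => ?_
  rw [run_sum]
  have hR : (lift (lift pR) : Prog (.prod (.prod Ctx .nat) (.prod .nat .nat)) .nat).run S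
    ((y, r), (((i : ℕ), (j : ℕ)) : ℕ × ℕ)) = R := run_pR S hy
  rw [hR, Finset.sum_range, Matrix.sum_apply]
  refine Finset.sum_congr rfl fun s _ => ?_
  have h1 : (compl P).run S (y, ((r, (s : ℕ)) : ℕ × ℕ)) = ⟨N, _, (S.orth (X s)).2⟩ := by
    rw [run_compl, hX]; rfl
  have h2 : (compl P * tr (compl P)).run S (y, ((r, (s : ℕ)) : ℕ × ℕ)) =
      ⟨N, N, (S.orth (X s)).2 * (S.orth (X s)).2ᵀ⟩ := by
    rw [run_matMul, run_tr, h1, Mat.transpose_mk, Mat.mul_mk]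
  change Mat.entry ((compl P * tr (compl P)).run S (y, ((r, (s : ℕ)) : ℕ × ℕ))) i j = _
  rw [h2, Mat.entry_val]

/-- A vector is killed by all transposed complements exactly when it lies in all ranges; by `hr`
this intersection is the line of the column sought. -/
theorem exists_run_pFactor (hy : y = (input T R, σ)) {n : Prog Ctx .nat} {N J' : ℕ}
    (hn : n.run S y = N) {P : Prog (.prod Ctx (.prod .nat .nat)) .mat}
    {X : Fin R → Fin R → Matrix (Fin N) (Fin J') ℝ}
    (hX : ∀ r s : Fin R, P.run S (y, (((r : ℕ), (s : ℕ)) : ℕ × ℕ)) = ⟨N, J', X r s⟩)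
    {A : Matrix (Fin N) (Fin R) ℝ} (hA : ∀ r, A.col r ≠ 0)
    (hr : ∀ r v, (∀ s, ∃ u, X r s *ᵥ u = v) ↔ ∃ c : ℝ, v = c • A.col r) :
    ∃ α : Fin R → ℝ, (∀ r, α r ≠ 0) ∧
      (pFactor n P).run S y = ⟨N, R, Matrix.of fun i r => α r * A i r⟩ := by
  have h : ∀ r : Fin R, ∃ α : ℝ, α ≠ 0 ∧ ∀ i : Fin N,
      ((compl (pGram n P)).run S (y, (r : ℕ))).entry i 0 = α * A i r := by
    intro r
    rw [run_compl, run_pGram S hy hn (hX r)]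
    refine exists_smul_col_of_ker (a := A.col r) (S.orth_spec _) (hA r) fun v => ?_
    rw [sum_mul_transpose_mulVec_eq_zero_iff, ← hr]
    refine forall_congr' fun s => ?_
    have h1 := (S.orth_spec (X r s)).mem_iff
    constructor
    · intro hv
      refine exists_mulVec_eq _ v fun w hw => ?_
      obtain ⟨u, rfl⟩ := (h1 w).mp hw
      rw [dotProduct_mulVec, ← mulVec_transpose, hv, zero_dotProduct]
    · rintro ⟨u, rfl⟩
      have h2 : (S.orth (X r s)).2ᵀ * X r s = 0 := by
        refine transpose_injective ?_
        rw [transpose_mul, transpose_transpose, transpose_zero]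
        refine Matrix.ext_of_mulVec_single fun i => ?_
        rw [← mulVec_mulVec, (h1 _).mpr ⟨_, rfl⟩, zero_mulVec]
      rw [mulVec_mulVec, h2, zero_mulVec]
  choose α hα h using h
  refine ⟨α, hα, ?_⟩
  simp only [pFactor, run_mk, hn, run_pR S hy]
  exact Mat.build_eq_mk fun i r => h r i

theorem run_pKhatriRao (hy : y = (input T R, σ)) {A : Matrix (Fin I) (Fin R) ℝ}
    {B : Matrix (Fin J) (Fin R) ℝ} (hA : pA.run S y = ⟨I, R, A⟩) (hB : pB.run S y = ⟨J, R, B⟩) :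
    pKhatriRao.run S y = ⟨I * J, R, khatriRao A B⟩ := by
  simp only [pKhatriRao, run_mk, run_natMul, run_pI S hy, run_pJ S hy, run_pR S hy]
  refine Mat.build_eq_mk fun p r => ?_
  simp only [run_mul, run_get, run_lift, run_natDiv, run_natMod, run_row, run_column, hA, hB,
    run_pJ S hy]
  rw [← Fin.coe_divNat, ← Fin.coe_modNat, Mat.entry_val, Mat.entry_val]
  rfl

theorem run_pC (hy : y = (input T R, σ)) {A : Matrix (Fin I) (Fin R) ℝ}
    {B : Matrix (Fin J) (Fin R) ℝ} {C : Matrix (Fin K) (Fin R) ℝ} (hT : T = ofFactors A B C)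
    (hA : pA.run S y = ⟨I, R, A⟩) (hB : pB.run S y = ⟨J, R, B⟩)
    (h : ∀ d, slice A B d = 0 → d = 0) : pC.run S y = ⟨K, R, C⟩ := by
  have h1 : (comp matInv (tr pKhatriRao * pKhatriRao) * (tr pKhatriRao * pU)).run S y =
      ⟨R, K, Cᵀ⟩ := by
    have h2 : (tr pKhatriRao * pKhatriRao).run S y = ⟨R, R, (khatriRao A B)ᵀ * khatriRao A B⟩ := by
      rw [run_matMul, run_tr, run_pKhatriRao S hy hA hB, Mat.transpose_mk, Mat.mul_mk]
    have h3 : (comp matInv (tr pKhatriRao * pKhatriRao)).run S y =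
        ⟨R, R, ((khatriRao A B)ᵀ * khatriRao A B)⁻¹⟩ := by
      rw [run_comp, h2]; exact Mat.inv_mk _
    rw [run_matMul, h3, run_matMul, run_tr, run_pKhatriRao S hy hA hB, run_pU S hy,
      Mat.transpose_mk, Mat.mul_mk, Mat.mul_mk, hT, inv_mul_khatriRao h]
  simp only [pC, run_mk, run_pK S hy, run_pR S hy]
  refine Mat.build_eq_mk fun k r => ?_
  rw [run_get, run_lift, h1]
  exact Mat.entry_val Cᵀ r k

/-- Over the reals a sum of squares tests all entries at once with a single branch. -/
theorem run_residualNorm_eq_zero_iff (A : Matrix (Fin I) (Fin R) ℝ) (B : Matrix (Fin J) (Fin R) ℝ)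
    (C : Matrix (Fin K) (Fin R) ℝ) :
    residualNorm.run S (input T R, output A B C) = (0 : ℝ) ↔ T = ofFactors A B C := by
  have h1 : ∀ (p : Fin (I * J)) (k : Fin K),
      residual.run S (((input T R, output A B C), (p : ℕ)), (k : ℕ)) =
        (T p.divNat p.modNat k - ofFactors A B C p.divNat p.modNat k : ℝ) := by
    intro p k
    rw [residual, run_add, run_neg, run_sum, ← sub_eq_add_neg]
    refine congrArg₂ (fun a b : ℝ => a - b) (Mat.entry_val (unfoldingMat T) p k) ?_
    refine (Finset.sum_range _).trans (Finset.sum_congr rfl fun r _ => ?_)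
    refine congrArg₂ (fun a b : ℝ => a * b) (congrArg₂ (fun a b : ℝ => a * b) ?_ ?_) ?_
    · exact Mat.entry_val A p.divNat r
    · exact Mat.entry_val B p.modNat r
    · exact Mat.entry_val C k r
  have h2 : residualNorm.run S (input T R, output A B C) =
      ∑ p : Fin (I * J), ∑ k : Fin K,
        (T p.divNat p.modNat k - ofFactors A B C p.divNat p.modNat k) *
          (T p.divNat p.modNat k - ofFactors A B C p.divNat p.modNat k) := by
    rw [residualNorm, run_sum]
    refine (Finset.sum_range _).trans (Finset.sum_congr rfl fun p _ => ?_)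
    rw [run_sum]
    refine (Finset.sum_range _).trans (Finset.sum_congr rfl fun k _ => ?_)
    exact congrArg₂ (fun a b : ℝ => a * b) (h1 p k) (h1 p k)
  rw [h2]
  constructor
  · intro h
    rw [Finset.sum_eq_zero_iff_of_nonneg fun p _ =>
      Finset.sum_nonneg fun k _ => mul_self_nonneg _] at h
    ext i j k
    have h3 := h (finProdFinEquiv (i, j)) (Finset.mem_univ _)
    rw [Finset.sum_eq_zero_iff_of_nonneg fun k _ => mul_self_nonneg _] at h3
    have h4 := mul_self_eq_zero.mp (h3 k (Finset.mem_univ _))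
    rw [divNat_finProdFinEquiv, modNat_finProdFinEquiv] at h4
    exact sub_eq_zero.mp h4
  · intro h
    rw [← h]
    simp

/-- The final `mk`s fix the sizes of the output whatever the guesses, so wrong guesses can only fail
the residual test. -/
theorem exists_run_candidate (T : Tensor I J K) (R σ : ℕ) :
    ∃ (A : Matrix (Fin I) (Fin R) ℝ) (B : Matrix (Fin J) (Fin R) ℝ)
      (C : Matrix (Fin K) (Fin R) ℝ), candidate.run S (input T R, σ) = output A B C :=
  ⟨_, _, _, rfl⟩

/-- One correct guess, possibly depending on S, ensures that the search ends with a zero residual.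
It may return another candidate, but an exact decomposition of length equal to the rank is a CPD. -/
theorem findsCPD_of_exists {T : Tensor I J K} (hR : tensorRank T = R)
    (h : ∀ S : Solver, ∃ σ < guessBase I J K R ^ (3 + R + 2 * (R * R)),
      ∃ (A : Matrix (Fin I) (Fin R) ℝ) (B : Matrix (Fin J) (Fin R) ℝ)
          (C : Matrix (Fin K) (Fin R) ℝ),
        candidate.run S (input T R, σ) = output A B C ∧ T = ofFactors A B C) :
    findCPD.FindsCPD T R := by
  intro S
  obtain ⟨σ, hσ, A, B, C, hrun, hT⟩ := h S
  have hσ' : σ < (pow guessBound guessCount).run S (input T R) := by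
    rw [run_pow, run_guessBound S rfl, run_guessCount S rfl]
    exact hσ
  obtain ⟨τ, h1, h2⟩ := run_search S (input T R) (pow guessBound guessCount) candidate residualNorm
    hσ' (by rw [hrun]; exact (run_residualNorm_eq_zero_iff S A B C).mpr hT)
  obtain ⟨A', B', C', h3⟩ := exists_run_candidate S T R τ
  refine ⟨A', B', C', h1.trans h3, (run_residualNorm_eq_zero_iff S A' B' C').mp ?_, hR⟩
  rwa [h1, h3] at h2

end Prog

/-! ### Existence of correct guesses. -/

theorem exists_div_pow_mod_eq {b n : ℕ} (f : ℕ → ℕ) (hf : ∀ p, f p < b) :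
    ∃ σ < b ^ n, ∀ p < n, σ / b ^ p % b = f p := by
  refine ⟨finFunctionFinEquiv (fun p : Fin n => (⟨f p, hf p⟩ : Fin b)), Fin.is_lt _,
    fun p hp => ?_⟩
  have := finFunctionFinEquiv_symm_apply_val
    (finFunctionFinEquiv (fun p : Fin n => (⟨f p, hf p⟩ : Fin b))) ⟨p, hp⟩
  rw [Equiv.symm_apply_apply] at this
  exact this.symm

/-- For every term there are sets of terms of given size whose only common element it is, in such
a way that the corresponding spans of columns intersect in the span of one column. -/
theorem exists_sets {R μ : ℕ} (h1 : 1 ≤ μ) (hR : μ < R) (r : Fin R) :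
    ∃ F : Fin R → {s : Finset (Fin R) // s.card = μ}, ∀ (I : ℕ) (A : Matrix (Fin I) (Fin R) ℝ),
      ColIndep A (μ + 1) → ∀ v, (∀ z, ∃ l : Fin R → ℝ, (∀ i ∉ (F z).1, l i = 0) ∧ A *ᵥ l = v) ↔
        ∃ c : ℝ, v = c • A.col r := by
  classical
  obtain ⟨s, hrs, hs⟩ : ∃ s : Finset (Fin R), {r} ⊆ s ∧ s.card = μ := by
    obtain ⟨s, h, -, hs⟩ := Finset.exists_subsuperset_card_eq (Finset.subset_univ {r}) (by simpa)
      (by rw [Finset.card_univ, Fintype.card_fin]; exact hR.le)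
    exact ⟨s, h, hs⟩
  rw [Finset.singleton_subset_iff] at hrs
  obtain ⟨t, ht⟩ : ∃ t, t ∉ s := by
    by_contra! h
    rw [Finset.eq_univ_iff_forall.mpr h, Finset.card_univ, Fintype.card_fin] at hs
    omega
  have hcard : ∀ z ∈ s, (insert t (s.erase z)).card = μ := by
    intro z hz
    rw [Finset.card_insert_of_notMem fun h => ht (Finset.mem_of_mem_erase h),
      Finset.card_erase_of_mem hz]
    omega
  -- Each z ∈ s other than r is exchanged for t; the other indices repeat s, so that the program can
  -- always loop over R sets.
  refine ⟨fun z => if h : z ∈ s ∧ z ≠ r then ⟨insert t (s.erase z), hcard z h.1⟩ else ⟨s, hs⟩,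
    fun I A hA v => ⟨fun h => ?_, ?_⟩⟩
  · refine exists_smul_col hA (by omega) ?_ (fun j hj hjr => ?_) ht
    · simpa using h r
    · simpa only [dif_pos (show j ∈ s ∧ j ≠ r from ⟨hj, hjr⟩)] using h j
  · rintro ⟨c, rfl⟩ z
    refine ⟨c • Pi.single r 1, fun i hi => ?_, by rw [mulVec_smul, mulVec_single_one]⟩
    have hir : i ≠ r := by
      rintro rfl
      beta_reduce at hi
      split_ifs at hi with h
      · exact hi (Finset.mem_insert_of_mem (Finset.mem_erase.mpr ⟨h.2.symm, hrs⟩))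
      · exact hi hrs
    simp [hir]

/-- Two linear forms that separate the normals. -/
theorem exists_momentPoint {R k μ : ℕ} {D : Matrix (Fin k) (Fin R) ℝ} (h1 : 1 ≤ μ)
    {x : {s : Finset (Fin R) // s.card = μ} → Fin k → ℝ}
    (hx : ∀ s r, (Dᵀ *ᵥ x s) r = 0 ↔ r ∉ s.1) :
    ∃ τ₁ ≤ 4 ^ R * k, ∃ τ₂ ≤ 4 ^ R * k, (∀ s, momentPoint k τ₂ ⬝ᵥ x s ≠ 0) ∧
      ∀ s t, s ≠ t → (momentPoint k τ₁ ⬝ᵥ x s) * (momentPoint k τ₂ ⬝ᵥ x t) ≠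
        (momentPoint k τ₁ ⬝ᵥ x t) * (momentPoint k τ₂ ⬝ᵥ x s) := by
  classical
  have hcard : Fintype.card {s : Finset (Fin R) // s.card = μ} ≤ 2 ^ R :=
    (Fintype.card_subtype_le _).trans (by simp)
  have hval : ∀ (τ : ℕ) y, ∑ κ : Fin k, y κ * (τ : ℝ) ^ (κ : ℕ) = momentPoint k τ ⬝ᵥ y := fun τ y =>
    dotProduct_comm y (momentPoint k τ)
  obtain ⟨τ₂, hτ₂, h₂⟩ := exists_pow_ne_zero x fun s hs => by
    obtain ⟨r, hr⟩ := Finset.card_pos.mp (h1.trans_eq s.2.symm)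
    exact (hx s r).mp (by rw [hs, mulVec_zero]; rfl) hr
  simp_rw [hval] at h₂
  obtain ⟨τ₁, hτ₁, h₁⟩ := exists_pow_ne_zero
    (fun p : {p : {s : Finset (Fin R) // s.card = μ} × {s : Finset (Fin R) // s.card = μ} //
      p.1 ≠ p.2} => (momentPoint k τ₂ ⬝ᵥ x p.1.2) • x p.1.1 - (momentPoint k τ₂ ⬝ᵥ x p.1.1) • x
          p.1.2)
    (fun ⟨⟨s, t⟩, hst⟩ h => by
      -- A column in s but not in t is orthogonal to x t and not to x s, so the combination to be
      -- avoided is nonzero.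
      obtain ⟨r, hr, hrt⟩ : ∃ r ∈ s.1, r ∉ t.1 := by
        by_contra! hsub
        exact hst (Subtype.ext (Finset.eq_of_subset_of_card_le hsub (by rw [s.2, t.2])))
      have := congrFun (congrArg (Dᵀ *ᵥ ·) h) r
      simp only [mulVec_sub, mulVec_smul, mulVec_zero, Pi.sub_apply, Pi.smul_apply, smul_eq_mul,
        (hx t r).mpr hrt, mul_zero, sub_zero, Pi.zero_apply] at this
      exact (mul_eq_zero.mp this).elim (h₂ t) fun h => (hx s r).mp h hr)
  simp_rw [hval] at h₁
  refine ⟨τ₁, hτ₁.trans (Nat.mul_le_mul_right _ ?_), τ₂, hτ₂.trans (Nat.mul_le_mul_right _ ?_), h₂,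
    fun s t hst h => h₁ ⟨(s, t), hst⟩ ?_⟩
  · refine (Fintype.card_subtype_le _).trans ?_
    rw [Fintype.card_prod, show 4 = 2 * 2 from rfl, mul_pow]
    exact Nat.mul_le_mul hcard hcard
  · exact hcard.trans (Nat.pow_le_pow_left (by norm_num) R)
  · rw [dotProduct_sub, dotProduct_smul, dotProduct_smul, smul_eq_mul, smul_eq_mul, mul_comm,
      h, mul_comm, sub_self]

/-- The minors of sizes μ and μ + 1 serve as generators of the spans of products. Whatever the
solver does, the number of eigenvectors is the number of μ-sets, which bounds j. -/
theorem exists_residue (S : Solver) {I J R k μ a b τ₁ τ₂ : ℕ} {A : Matrix (Fin I) (Fin R) ℝ}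
    {B : Matrix (Fin J) (Fin R) ℝ} {D : Matrix (Fin k) (Fin R) ℝ} (hA : ColIndep A a)
    (hB : ColIndep B b) (ha : a ≤ R) (hμ : μ + 1 ≤ a) (hab : R + (μ + 1) ≤ a + b)
    {x : {s : Finset (Fin R) // s.card = μ} → Fin k → ℝ}
    (hx : ∀ s r, (Dᵀ *ᵥ x s) r = 0 ↔ r ∉ s.1)
    (hx' : ∀ s v, v ⬝ᵥ x s = 0 → ∃ l, (∀ r ∈ s.1, l r = 0) ∧ D *ᵥ l = v)
    (hl : ∀ s, momentPoint k τ₂ ⬝ᵥ x s ≠ 0)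
    (hl' : ∀ s t, s ≠ t → (momentPoint k τ₁ ⬝ᵥ x s) * (momentPoint k τ₂ ⬝ᵥ x t) ≠
        (momentPoint k τ₁ ⬝ᵥ x t) * (momentPoint k τ₂ ⬝ᵥ x s))
    (s : {s : Finset (Fin R) // s.card = μ}) :
    ∃ (j : Fin (S.orth (S.orth (multMat S A B D μ τ₂)ᵀ).2).1) (q : Fin ((I * J) ^ μ)) (c : ℝ),
      (j : ℕ) < 4 ^ R ∧ c ≠ 0 ∧ ∀ v, ∑ p, minorsMat A B D μ μ p q *
        residuesMat S A B D μ τ₁ τ₂ p j * (v ⬝ᵥ gridPoint (μ + 1) k p) = c * (v ⬝ᵥ x s) := by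
  classical
  obtain ⟨hn, hex, h⟩ := gevd_recovers_normals (μ := μ) (l₁ := momentPoint k τ₁)
    (l₂ := momentPoint k τ₂) hx hx' hl hl'
    (G₀ := minorsMat A B D μ μ)
    (E := Matrix.of fun q s => tupleMinor (slice A B (ind s.1)) (finFunctionFinEquiv.symm q))
    (fun p q => tupleMinor_slice A B _ _)
    (fun v hv => tupleMinor_injective hA hB ha (by omega) (by omega) v fun e => by
      have := congrFun hv (finFunctionFinEquiv e)
      rw [mulVec, dotProduct] at this
      simpa only [Matrix.of_apply, Equiv.symm_apply_apply, Pi.zero_apply] using this)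
    (G₁ := minorsMat A B D μ (μ + 1))
    (fun w => by
      have hG : ∀ q, ((minorsMat A B D μ (μ + 1))ᵀ *ᵥ w) q =
          ∑ p, tupleMinor (slice A B (Dᵀ *ᵥ gridPoint (μ + 1) k p)) (finFunctionFinEquiv.symm q) *
            w p := fun q => rfl
      constructor
      · intro hw t ht
        obtain ⟨ω, hω⟩ := exists_sum_tupleMinor hA hB t ht ha hμ hab
        have : ∀ e : Fin (μ + 1) → Fin (I * J),
            ∑ p, tupleMinor (slice A B (Dᵀ *ᵥ gridPoint (μ + 1) k p)) e * w p = 0 := by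
          intro e
          have := hG (finFunctionFinEquiv e)
          rw [hw, Equiv.symm_apply_apply] at this
          exact this.symm
        have h0 : ∑ e, ω e *
            ∑ p, tupleMinor (slice A B (Dᵀ *ᵥ gridPoint (μ + 1) k p)) e * w p = 0 :=
          Finset.sum_eq_zero fun e _ => by rw [this, mul_zero]
        simp_rw [Finset.mul_sum] at h0
        rw [Finset.sum_comm] at h0
        rw [← h0]
        refine Finset.sum_congr rfl fun p _ => ?_
        rw [prodForm, ← hω, Finset.mul_sum]
        exact Finset.sum_congr rfl fun e _ => by ring
      · intro hw
        ext q
        rw [hG]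
        refine (Finset.sum_congr rfl fun p _ => by rw [tupleMinor_slice, Finset.sum_mul]).trans ?_
        rw [Finset.sum_comm]
        refine Finset.sum_eq_zero fun t _ => ?_
        rw [← mul_zero (tupleMinor (slice A B (ind t.1)) (finFunctionFinEquiv.symm q)),
          ← hw t.1 t.2, Finset.mul_sum]
        exact Finset.sum_congr rfl fun p _ => by rw [prodForm]; ring)
    (S.orth_spec _) (M₁ := multMat S A B D μ τ₁) (M₂ := multMat S A B D μ τ₂) rfl rfl
    (S.orth_spec _) (S.orth_spec _)
  obtain ⟨j, q, c, hc, hv⟩ := h _ _ (S.gevd_spec _ _ hex) s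
  refine ⟨j, q, c, j.2.trans_le ?_, hc, hv⟩
  rw [← hn]
  refine (Fintype.card_subtype_le _).trans ?_
  simpa using Nat.pow_le_pow_left (by norm_num : 2 ≤ 4) R

/-- Existence of guesses. -/
theorem exists_isGuess {I J K R k μ τ₁ τ₂ : ℕ} (T : Tensor I J K) {t : ℕ → ℕ}
    {j q : Fin R → Fin R → ℕ} (hk : k ≤ R) (hμ : μ + k = R + 1) (h₁ : τ₁ ≤ 4 ^ R * k)
    (h₂ : τ₂ ≤ 4 ^ R * k) (ht : ∀ i, t i ≤ 2 ^ R * K) (hj : ∀ r z, j r z < 4 ^ R)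
    (hq : ∀ r z, q r z < (I * J) ^ μ) (hμR : μ ≤ R) :
    ∃ σ < guessBase I J K R ^ (3 + R + 2 * (R * R)),
      IsGuess T R (input T R, σ) σ k μ t τ₁ τ₂ ∧ ∀ r z : Fin R,
        guessDigit I J K R σ (3 + R + 2 * (r * R + z)) = j r z ∧
        guessDigit I J K R σ (4 + R + 2 * (r * R + z)) = q r z := by
  classical
  -- Layout of the digits: k, τ₁, τ₂, then R places for the moment parameters, then for each (r, z)
  -- the eigenvector index followed by the minor index.
  let f : ℕ → ℕ := fun p =>
    if p = 0 then k else if p = 1 then τ₁ else if p = 2 then τ₂ else if p < 3 + R then t (p - 3)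
    else if h : (p - 3 - R) / 2 / R < R ∧ (p - 3 - R) / 2 % R < R then
      if (p - 3 - R) % 2 = 0 then j ⟨_, h.1⟩ ⟨_, h.2⟩ else q ⟨_, h.1⟩ ⟨_, h.2⟩
    else 0
  have hτ : 4 ^ R * k ≤ 4 ^ R * R := Nat.mul_le_mul_left _ hk
  have hb : ∀ m, m ≤ R ∨ m ≤ 4 ^ R * R ∨ m ≤ 4 ^ R * K ∨ m < 4 ^ R ∨ m < (I * J + 1) ^ R →
      m < guessBase I J K R := by
    intro m
    rw [guessBase, mul_add, mul_add, mul_one]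
    generalize 4 ^ R * R = x₁
    generalize 4 ^ R * K = x₂
    generalize 4 ^ R = x₃
    generalize (I * J + 1) ^ R = x₄
    omega
  have h24 : 2 ^ R * K ≤ 4 ^ R * K :=
    Nat.mul_le_mul_right _ (Nat.pow_le_pow_left (by norm_num) R)
  have hqq : (I * J) ^ μ ≤ (I * J + 1) ^ R :=
    (Nat.pow_le_pow_left (Nat.le_succ _) μ).trans (Nat.pow_le_pow_right (Nat.succ_pos _) hμR)
  have hf : ∀ p, f p < guessBase I J K R := by
    intro p
    refine hb _ ?_
    simp only [f]
    split_ifs with _ _ _ _ h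
    · exact Or.inl hk
    · exact Or.inr (Or.inl (h₁.trans hτ))
    · exact Or.inr (Or.inl (h₂.trans hτ))
    · exact Or.inr (Or.inr (Or.inl ((ht _).trans h24)))
    · exact Or.inr (Or.inr (Or.inr (Or.inl (hj _ _))))
    · exact Or.inr (Or.inr (Or.inr (Or.inr ((hq _ _).trans_le hqq))))
    · exact Or.inl (Nat.zero_le _)
  obtain ⟨σ, hσ, hd⟩ := exists_div_pow_mod_eq (n := 3 + R + 2 * (R * R)) f hf
  have hslot : ∀ r z : Fin R, (r * R + z : ℕ) < R * R ∧ (r * R + z : ℕ) / R = r ∧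
      (r * R + z : ℕ) % R = z := by
    intro r z
    have h := (finProdFinEquiv (r, z)).2
    have h1 := congrArg Fin.val (divNat_finProdFinEquiv r z)
    have h2 := congrArg Fin.val (modNat_finProdFinEquiv r z)
    rw [Fin.coe_divNat] at h1
    rw [Fin.coe_modNat] at h2
    rw [finProdFinEquiv_apply_val, add_comm, mul_comm] at h h1 h2
    exact ⟨h, h1, h2⟩
  have hslot' : ∀ (r z : Fin R) (ε : ℕ), ε < 2 → f (3 + ε + R + 2 * (r * R + z)) =
      if ε = 0 then j r z else q r z := by
    intro r z ε hε
    obtain ⟨-, h2, h3⟩ := hslot r z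
    have h4 : (3 + ε + R + 2 * (r * R + z : ℕ) - 3 - R) / 2 = r * R + z := by omega
    have h5 : (3 + ε + R + 2 * (r * R + z : ℕ) - 3 - R) % 2 = ε := by omega
    simp only [f, h4, h5, h2, h3]
    rw [if_neg (by omega), if_neg (by omega), if_neg (by omega), if_neg (by omega),
      dif_pos ⟨r.2, z.2⟩]
  refine ⟨σ, hσ, ⟨rfl, ?_, hμ, fun i hi => ?_, ?_, ?_⟩, fun r z => ⟨?_, ?_⟩⟩
  · exact hd 0 (by omega)
  · refine (hd (3 + i) (by omega)).trans ?_
    simp only [f]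
    rw [if_neg (by omega), if_neg (by omega), if_neg (by omega), if_pos (by omega),
      Nat.add_sub_cancel_left]
  · exact hd 1 (by omega)
  · exact hd 2 (by omega)
  · have := (hslot r z).1
    exact (hd _ (by omega)).trans (hslot' r z 0 (by norm_num))
  · have := (hslot r z).1
    exact (hd _ (by omega)).trans (hslot' r z 1 (by norm_num))

/-! ### Correctness of the algorithm. -/

namespace Prog

theorem findsCPD_findCPD {I J K R : ℕ} {T : Tensor I J K} {A : Matrix (Fin I) (Fin R) ℝ}
    {B : Matrix (Fin J) (Fin R) ℝ} {C : Matrix (Fin K) (Fin R) ℝ} (hT : T = ofFactors A B C)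
    (h : 2 * R + 2 ≤ kRank A + kRank B + kRank C) : findCPD.FindsCPD T R := by
  classical
  refine findsCPD_of_exists (isCPD_and_unique hT h).1.2 fun S => ?_
  obtain ⟨haR, hA⟩ := kRank_spec A
  obtain ⟨hbR, hB⟩ := kRank_spec B
  obtain ⟨hkR, hC⟩ := kRank_spec C
  set a := kRank A
  set b := kRank B
  set k := kRank C
  -- From k ≤ R comes 1 ≤ μ, and from a, b ≤ R comes k ≥ 2, so μ < R. Kruskal's condition is R + (μ
  -- + 1) ≤ a + b, whence also μ + 1 ≤ a and μ + 1 ≤ b.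
  obtain ⟨μ, hμ⟩ : ∃ μ, μ + k = R + 1 := ⟨R + 1 - k, by omega⟩
  obtain ⟨t, ht, hD⟩ := hC.exists_momentRows
  have hnormal : ∀ s : {s : Finset (Fin R) // s.card = μ}, ∃ x : Fin k → ℝ,
      (∀ r, ((momentRows K t k * C)ᵀ *ᵥ x) r = 0 ↔ r ∉ s.1) ∧
      ∀ v, v ⬝ᵥ x = 0 → ∃ l, (∀ r ∈ s.1, l r = 0) ∧ (momentRows K t k * C) *ᵥ l = v := fun s =>
    hD.exists_normal (by rw [s.2]; exact hμ) (Finset.card_pos.mp (by rw [s.2]; omega))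
  choose x hx hx' using hnormal
  obtain ⟨τ₁, hτ₁, τ₂, hτ₂, hl, hl'⟩ := exists_momentPoint (by omega) hx
  choose j q c hj hc hv using
    exists_residue S hA hB haR (by omega) (by omega) hx hx' hl hl'
  choose F hF using exists_sets (R := R) (μ := μ) (by omega) (by omega)
  obtain ⟨σ, hσ, hg, hjq⟩ := exists_isGuess T (t := t) (j := fun r z => j (F r z))
    (q := fun r z => q (F r z)) hkR hμ hτ₁ hτ₂ ht (fun r z => hj _) (fun r z => (q _).2) (by omega)
  have hslice := fun r z => run_pSlice S hg hT (j (F r z)) (q (F r z)) (hjq r z).1 (hjq r z).2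
    (hv (F r z))
  have hsupp : ∀ (s : {s : Finset (Fin R) // s.card = μ}) (r : Fin R),
      (c s • ((momentRows K t k * C)ᵀ *ᵥ x s)) r = 0 ↔ r ∉ s.1 := fun s r => by
    rw [Pi.smul_apply, smul_eq_mul, mul_eq_zero, ← hx s r, or_iff_right (hc s)]
  have hcol : ∀ {N n : ℕ} {M : Matrix (Fin N) (Fin R) ℝ}, ColIndep M n → 1 ≤ n →
      ∀ r, M.col r ≠ 0 := by
    intro N n M hM hn r h0
    have := congrFun (hM {r} (Pi.single r 1) (by simpa) (fun i hi => by
      simp only [Finset.mem_singleton] at hi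
      simp [hi]) (by rw [mulVec_single_one, h0])) r
    simp at this
  obtain ⟨α, hα, hpA⟩ := exists_run_pFactor S hg.eq (run_pI S hg.eq) hslice
    (hcol hA (by omega)) fun r v => by
      rw [← hF r I A (hA.mono (by omega))]
      exact forall_congr' fun z =>
        mem_range_slice_iff (hB.mono (by rw [(F r z).2]; omega)) (hsupp _) v
  obtain ⟨β, hβ, hpB⟩ := exists_run_pFactor S (P := tr pSlice) hg.eq (run_pJ S hg.eq)
    (fun r z => by
      rw [run_tr, hslice r z, Mat.transpose_mk, slice_transpose])
    (hcol hB (by omega)) fun r v => by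
      rw [← hF r J B (hB.mono (by omega))]
      exact forall_congr' fun z =>
        mem_range_slice_iff (hA.mono (by rw [(F r z).2]; omega)) (hsupp _) v
  -- The first two factors are found only up to column scalings; the third absorbs the inverses, and
  -- the linear system for it returns exactly this scaled factor.
  have hTC : T = ofFactors (Matrix.of fun i r => α r * A i r) (Matrix.of fun i r => β r * B i r)
      (Matrix.of fun i r => (α r * β r)⁻¹ * C i r) := by
    rw [hT]
    funext i j k
    refine Finset.sum_congr rfl fun r _ => ?_
    have := hα r
    have := hβ r
    simp only [Matrix.of_apply]
    field_simp
  refine ⟨σ, hσ, _, _, _, ?_, hTC⟩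
  have hpC := run_pC S hg.eq hTC hpA hpB fun d hd => by
    have h0 : slice A B (fun r => α r * β r * d r) = 0 := by
      rw [← hd]
      ext i i'
      simp only [slice_apply, Matrix.of_apply]
      exact Finset.sum_congr rfl fun r _ => by ring
    have h1 := eq_zero_of_slice_eq_zero hA hB haR (by omega) (by omega) h0
    ext r
    exact (mul_eq_zero.mp (congrFun h1 r)).resolve_left (mul_ne_zero (hα r) (hβ r))
  rw [candidate, run_pair, run_pair, pA, pB, hpA, hpB, hpC]
  rfl

end Prog

end CPD

theorem corollary1p9 :
    (∀ (I J K R : ℕ) (T : CPD.Tensor I J K) (A : Matrix (Fin I) (Fin R) ℝ)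
      (B : Matrix (Fin J) (Fin R) ℝ) (C : Matrix (Fin K) (Fin R) ℝ),
      T = CPD.ofFactors A B C →
      2 * R + 2 ≤ CPD.kRank A + CPD.kRank B + CPD.kRank C →
      CPD.IsCPD T A B C ∧ CPD.CPDUnique T) ∧
    ∃ P : CPD.Prog CPD.InputTy CPD.OutputTy,
      ∀ (I J K R : ℕ) (T : CPD.Tensor I J K) (A : Matrix (Fin I) (Fin R) ℝ)
        (B : Matrix (Fin J) (Fin R) ℝ) (C : Matrix (Fin K) (Fin R) ℝ),
        T = CPD.ofFactors A B C →
        2 * R + 2 ≤ CPD.kRank A + CPD.kRank B + CPD.kRank C →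
        P.FindsCPD T R :=
  ⟨fun _ _ _ _ _ _ _ _ hT h => CPD.isCPD_and_unique hT h, CPD.Prog.findCPD,
    fun _ _ _ _ _ _ _ _ hT h => CPD.Prog.findsCPD_findCPD hT h⟩
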